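/- Let $V$ be a compact smooth manifold without boundary with a smooth codimension-one foliation $\mathscr F$, and let $\phi=(\phi_t)_{t\in\mathbb R}$ be a smooth flow on $V$ that maps leaves to leaves and whose generating vector field $\Phi$ is nowhere tangent to the leaves. Let $B\to V$ be an immersion of a closed one-dimensional manifold, everywhere transverse to the leaves and meeting every leaf, and let $\overline\phi$ be the flow on $B$ generated by the component $\overline\Phi$ of $\Phi$ along $TB$ in the splitting $TV|_B=TB\oplus T\mathscr F|_B$. Let $H_B$ be the étale groupoid of holonomy classes of leafwise paths $\gamma$ with source $s(\gamma)$ and range $r(\gamma)$ in $B$. The flow $\overline\phi$ lifts to $H_B$ by homomorphisms; let $G=H_B\rtimes\mathbb R$, with arrows $(\gamma,t)$ of range $r(\gamma)$ and source $\overline\phi_t(s(\gamma))$ and product $(\gamma,t)(\delta,u)=(\gamma\,\overline\phi_{-t}(\delta),t+u)$. Each connected component $B_p$ of $B$ is an orbit of $\overline\phi$ with some period $p>0$. After the choice of a base-point it is identified with $\mathbb R/p\mathbb Z$, with $\overline\phi_t(b)\equiv b+t$ mod $p$, and points of $B_p$ are represented by numbers in $[0,p)$. Let $db$ be the resulting Lebesgue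 measure on $B$ and $r^*db$ its pullback to $H_B$ by the étale map $r$, i.e. $(r^*db)(A)=\int_B \#(A\cap r^{-1}(b))\,db$. Let $H_{B_p}\subset H_B$ be the subgroupoid of arrows with source and range in $B_p$. Then $C_c^\infty(G)$ is an associative algebra under the convolution $$(f*g)(\gamma,t)=\sum_{\gamma_1\gamma_2=\gamma}\int_{\mathbb R} f(\gamma_1,u)\,g(\overline\phi_u(\gamma_2),t-u)\,du ,$$ and the formula $$(f\cdot\xi)(b)=\sum_{\gamma\in H_B,\ r(\gamma)=b}\int_{\mathbb R} f(\gamma,t)\,\xi(\overline\phi_t(s(\gamma)))\,dt$$ is a representation of this algebra on $C^\infty(B)$ by smoothing operators (operators with a kernel in $C^\infty(B\times B)$ with respect to $db$). For every $f\in C_c^\infty(G)$ this operator extends to a bounded operator on $L^2(B,db)$ that has a trace $\mathrm{Tr}(f)$ (the sum of its diagonal coefficients, convergent and the same in every Hilbert basis), and $$\mathrm{Tr}(f)=\sum_{B_p}\sum_{n\in\mathbb Z}\int_{H_{B_p}} f\big(\gamma,\;np+r(\gamma)-s(\gamma)\big)\,r^*db(\gamma),$$ where the sum runs over the connected components of $B$,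 the integrals exist and the double sum converges absolutely. The linear functional $\mathrm{Tr}$ on $C_c^\infty(G)$ is integration against a locally finite Borel measure on $G$, whose support is the set $\{(\gamma,t)\in G : \overline\phi_t(s(\gamma))=r(\gamma)\}$ of automorphisms of $G$. This set is a closed submanifold of $G=H_B\times\mathbb R$, locally of the form $U\times\{t\}$ with $U\subset H_B$ open. -/

import Mathlib

open scoped Manifold ContDiff Topology unitInterval ENNReal
open MeasureTheory Set

namespace TransverseFlow

noncomputable section

/-! ## Codimension one foliations with a transverse flow -/

/-- The model space `ℝⁿ × ℝ`: leaf coordinates and one transverse coordinate. -/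
abbrev Model (n : ℕ) : Type := EuclideanSpace ℝ (Fin n) × ℝ

section Foliation

variable {n : ℕ} {V : Type*} [TopologicalSpace V] [ChartedSpace (Model n) V]

/-- The atlas of `V` is a codimension one foliated atlas: every change of charts has locally the
form `(x, y) ↦ (g (x, y), h y)`, so that the plaques `y = const` glue to leaves of dimension `n`. -/
def IsFoliatedAtlas (n : ℕ) (V : Type*) [TopologicalSpace V] [ChartedSpace (Model n) V] : Prop :=
  ∀ e ∈ atlas (Model n) V, ∀ e' ∈ atlas (Model n) V, ∀ p ∈ (e.symm ≫ₕ e').source,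
    ∃ h : ℝ → ℝ, ∀ᶠ q in 𝓝 p, (e' (e.symm q)).2 = h q.2

/-- A leafwise path: a continuous path along which the transverse coordinate of every foliated
chart is locally constant (that is, a path which is continuous for the leaf topology). -/
def IsLeafwise (n : ℕ) {V : Type*} [TopologicalSpace V] [ChartedSpace (Model n) V]
    (c : I → V) : Prop :=
  Continuous c ∧ ∀ e ∈ atlas (Model n) V, ∀ s, c s ∈ e.source →
    ∀ᶠ s' in 𝓝 s, (e (c s')).2 = (e (c s)).2

/-- Two points lie on the same leaf if a leafwise path joins them. -/
def SameLeaf (n : ℕ) {V : Type*} [TopologicalSpace V] [ChartedSpace (Model n) V]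
    (v w : V) : Prop :=
  ∃ c : Path v w, IsLeafwise n c

/-- The tangent space of the leaf through `v`: the kernel of the differential at `v` of the
transverse coordinate. -/
def leafTangent (n : ℕ) {V : Type*} [TopologicalSpace V] [ChartedSpace (Model n) V] (v : V) :
    Submodule ℝ (TangentSpace 𝓘(ℝ, Model n) v) :=
  LinearMap.ker
    (mfderiv 𝓘(ℝ, Model n) 𝓘(ℝ, ℝ) (fun w : V => (chartAt (Model n) v w).2) v).toLinearMap

/-- The vector field `Φ` generating a flow `φ` on a manifold. -/
def generator {E : Type*} [NormedAddCommGroup E] [NormedSpace ℝ E] {X : Type*}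
    [TopologicalSpace X] [ChartedSpace E X] (φ : Flow ℝ X) (x : X) : TangentSpace 𝓘(ℝ, E) x :=
  mfderiv 𝓘(ℝ, ℝ) 𝓘(ℝ, E) (fun t : ℝ => φ t x) 0 (1 : ℝ)

/-- A transverse flow: a smooth one-parameter group of diffeomorphisms mapping leaves to leaves
(leafwise paths to leafwise paths), whose generator is nowhere tangent to the leaves. -/
structure IsTransverseFlow (n : ℕ) {V : Type*} [TopologicalSpace V] [ChartedSpace (Model n) V]
    (φ : Flow ℝ V) : Prop where
  smooth : ContMDiff (𝓘(ℝ, ℝ).prod 𝓘(ℝ, Model n)) 𝓘(ℝ, Model n) ∞ (fun p : ℝ × V => φ p.1 p.2)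
  map_leafwise : ∀ (t : ℝ) (c : I → V), IsLeafwise n c → IsLeafwise n (fun s => φ t (c s))
  transverse : ∀ v : V, (generator φ v : TangentSpace 𝓘(ℝ, Model n) v) ∉ leafTangent n v

end Foliation

section Transversal

variable {V : Type*} [TopologicalSpace V] {B : Type*} [TopologicalSpace B] [ChartedSpace ℝ B]

/-- `ι : B → V` is a complete transversal: an immersion of a one-dimensional manifold, everywhere
transverse to the leaves, and meeting each leaf at least once. -/
structure IsCompleteTransversal (n : ℕ) [ChartedSpace (Model n) V] (ι : B → V) : Prop where
  smooth : ContMDiff 𝓘(ℝ, ℝ) 𝓘(ℝ, Model n) ∞ ι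
  immersion : ∀ b, Function.Injective (mfderiv 𝓘(ℝ, ℝ) 𝓘(ℝ, Model n) ι b)
  transverse : ∀ b, IsCompl
    (LinearMap.range (mfderiv 𝓘(ℝ, ℝ) 𝓘(ℝ, Model n) ι b).toLinearMap)
    (leafTangent n (ι b))
  complete : ∀ v : V, ∃ b : B, SameLeaf n (ι b) v

/-- The flow `φb` on the transversal is induced by `φ`: it is the smooth flow whose generator at
`b` is the component along `T_b B` of the generator of `φ` in `T_b V = T_b B ⊕ T_b (leaf)`. -/
structure IsInducedFlow (n : ℕ) [ChartedSpace (Model n) V] (φ : Flow ℝ V) (ι : B → V)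
    (φb : Flow ℝ B) : Prop where
  smooth : ContMDiff (𝓘(ℝ, ℝ).prod 𝓘(ℝ, ℝ)) 𝓘(ℝ, ℝ) ∞ (fun p : ℝ × B => φb p.1 p.2)
  generator_eq : ∀ b : B,
    (mfderiv 𝓘(ℝ, ℝ) 𝓘(ℝ, Model n) ι b (generator φb b) - generator φ (ι b) :
      TangentSpace 𝓘(ℝ, Model n) (ι b)) ∈ leafTangent n (ι b)

end Transversal

/-! ## The reduced holonomy groupoid `H_B` -/

section Holonomy

variable (n : ℕ) {V : Type*} [TopologicalSpace V] [ChartedSpace (Model n) V]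
  {B : Type*} [TopologicalSpace B] (ι : B → V)

/-- Leafwise paths in `V` from a source point to a range point of the transversal. -/
structure LeafPath where
  src : B
  rng : B
  path : Path (ι src) (ι rng)
  leafwise : IsLeafwise n path

/-- A continuous family of leafwise paths parametrized by its source point, which runs through an
open subset of the transversal. Sliding along it is the local map `z ↦ (toPath z).rng`. -/
structure LeafPathFamily where
  dom : TopologicalSpace.Opens B
  toPath : dom → LeafPath n ι
  src_eq : ∀ z, (toPath z).src = z
  continuous_rng : Continuous (fun z => (toPath z).rng)
  continuous_path : Continuous (fun p : dom × I => (toPath p.1).path p.2)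

variable {n ι}

/-- The holonomy of a leafwise path, as a germ at its source of local maps of the transversal: the
set of all maps `h` that represent this germ. -/
def LeafPath.holonomy (c : LeafPath n ι) : Set (B → B) :=
  {h | ∃ (F : LeafPathFamily n ι) (hc : c.src ∈ F.dom), F.toPath ⟨c.src, hc⟩ = c ∧
    ∀ z : F.dom, (F.toPath z).rng = h z}

variable (n ι)

/-- Leafwise paths are equivalent when they have the same source, range and holonomy. -/
instance LeafPath.setoid : Setoid (LeafPath n ι) :=
  Setoid.ker (fun c : LeafPath n ι => (c.src, c.rng, c.holonomy))

/-- The set of arrows of the reduced holonomy groupoid `H_B`. -/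
def Arrow : Type _ := Quotient (LeafPath.setoid n ι)

variable {n ι}

def LeafPath.toArrow (c : LeafPath n ι) : Arrow n ι := Quotient.mk (LeafPath.setoid n ι) c

def Arrow.src : Arrow n ι → B :=
  Quotient.lift (fun c : LeafPath n ι => c.src) fun _ _ h => congrArg Prod.fst h

def Arrow.rng : Arrow n ι → B :=
  Quotient.lift (fun c : LeafPath n ι => c.rng) fun _ _ h =>
    congrArg (fun q : B × B × Set (B → B) => q.2.1) h

/-- The étale topology of `H_B`: the classes of the members of a family of leafwise paths form
a basic open set, which the source map identifies with an open subset of the transversal. -/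
instance : TopologicalSpace (Arrow n ι) :=
  TopologicalSpace.generateFrom
    {S | ∃ F : LeafPathFamily n ι, S = range (fun z => (F.toPath z).toArrow)}

instance : MeasurableSpace (Arrow n ι) := borel _

instance : BorelSpace (Arrow n ι) := ⟨rfl⟩

/-- `IsComp γ δ ε` says `γ δ = ε` in `H_B`: a path in the class `δ` followed by a path in the
class `γ` is in the class `ε`. -/
def IsComp (γ δ ε : Arrow n ι) : Prop :=
  ∃ (p q w : LeafPath n ι) (h : q.rng = p.src), p.toArrow = γ ∧ q.toArrow = δ ∧ w.toArrow = ε ∧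
    w.src = q.src ∧ w.rng = p.rng ∧
    ∀ s, w.path s = (q.path.trans (p.path.cast (congrArg ι h) rfl)) s

open Classical in
/-- The lift to `H_B` of a flow `φb` on the transversal: `γ` is moved along the continuous curve of
arrows that starts at `γ` and covers the flow under both étale maps, source and range. -/
def liftedFlow (φb : Flow ℝ B) (t : ℝ) (γ : Arrow n ι) : Arrow n ι :=
  if h : ∃ Γ : C(ℝ, Arrow n ι), Γ 0 = γ ∧
      ∀ u, (Γ u).src = φb u γ.src ∧ (Γ u).rng = φb u γ.rng
  then h.choose t else γ

variable (n ι) in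
/-- The space of arrows `(γ, t)` of the crossed product `G = H_B ⋊ ℝ`. The range of `(γ, t)` is
`γ.rng`, its source is `φb t γ.src`, and `(γ, t) (δ, u) = (γ (φb (-t) δ), t + u)`. -/
abbrev CrossedProduct : Type _ := Arrow n ι × ℝ

variable (n ι) in
/-- The set of automorphisms in `G`: arrows with the same source and range. -/
def automorphisms (φb : Flow ℝ B) : Set (CrossedProduct n ι) :=
  {g | φb g.2 g.1.src = g.1.rng}

end Holonomy

/-! ## The convolution algebra and its action -/

section Algebra

variable (n : ℕ) {V : Type*} [TopologicalSpace V] [ChartedSpace (Model n) V]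
  {B : Type*} [TopologicalSpace B] [ChartedSpace ℝ B] (ι : B → V)

/-- Smoothness of a function on `G = H_B × ℝ`, read in the étale charts of `H_B` provided by the
local sections of the source map. -/
def SmoothOnG (f : CrossedProduct n ι → ℂ) : Prop :=
  ∀ F : LeafPathFamily n ι,
    ContMDiff (𝓘(ℝ, ℝ).prod 𝓘(ℝ, ℝ)) 𝓘(ℝ, ℂ) ∞
      (fun p : F.dom × ℝ => f ((F.toPath p.1).toArrow, p.2))

/-- The space `C_c^∞(G)`. The canonical density `dt` on `ℝ` trivializes the density bundle, so
that elements of the convolution algebra are functions. -/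
def testFunctions : Submodule ℂ (CrossedProduct n ι → ℂ) where
  carrier := {f | SmoothOnG n ι f ∧ HasCompactSupport f}
  add_mem' := fun hf hg => ⟨fun F => (hf.1 F).add (hg.1 F), hf.2.add hg.2⟩
  zero_mem' := ⟨fun _ => contMDiff_const, HasCompactSupport.zero⟩
  smul_mem' := fun c _ hf =>
    ⟨fun F => (contDiff_const_smul c).contMDiff.comp (hf.1 F), hf.2.smul_left (f := fun _ => c)⟩

variable (B) in
/-- The space `C^∞(B)` of complex valued smooth functions. -/
def smoothFunctions : Submodule ℂ (B → ℂ) where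
  carrier := {ξ | ContMDiff 𝓘(ℝ, ℝ) 𝓘(ℝ, ℂ) ∞ ξ}
  add_mem' := fun hf hg => hf.add hg
  zero_mem' := contMDiff_const
  smul_mem' := fun c _ hf => (contDiff_const_smul c).contMDiff.comp hf

variable {n ι}

/-- The convolution product on `G`:
`(f * g)(γ, t) = ∑_{γ₁ γ₂ = γ} ∫ f(γ₁, u) g(φb_u(γ₂), t - u) du`. -/
def convolution (φb : Flow ℝ B) (f g : CrossedProduct n ι → ℂ) : CrossedProduct n ι → ℂ :=
  fun x => ∑' p : {p : Arrow n ι × Arrow n ι // IsComp p.1 p.2 x.1},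
    ∫ u : ℝ, f (p.1.1, u) * g (liftedFlow φb u p.1.2, x.2 - u)

/-- The action of `f` on a function `ξ` on the transversal:
`(f · ξ)(b) = ∑_{r(γ) = b} ∫ f(γ, t) ξ(φb_t(s(γ))) dt`. -/
def action (φb : Flow ℝ B) (f : CrossedProduct n ι → ℂ) (ξ : B → ℂ) : B → ℂ :=
  fun b => ∑' γ : {γ : Arrow n ι // γ.rng = b}, ∫ t : ℝ, f (γ.1, t) * ξ (φb t γ.1.src)

end Algebra

/-! ## Periods, Lebesgue measure and coordinates on the transversal -/

section Circles

variable {B : Type*} [TopologicalSpace B]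

/-- The period of the flow at the point `b`. -/
def periodAt (φb : Flow ℝ B) (b : B) : ℝ := sInf {t : ℝ | 0 < t ∧ φb t b = b}

/-- The coordinate of `b` in `ℝ/pℤ`, represented in `[0, p)`: the first time at which the flow
carries the base-point of the connected component of `b` to `b`. -/
def coordinate (φb : Flow ℝ B) (base : ConnectedComponents B → B) (b : B) : ℝ :=
  sInf {t : ℝ | 0 ≤ t ∧ φb t (base b) = b}

/-- The measure `db` on `B`: on a component `ℝ/pℤ` it is the Lebesgue measure in the flow
parameter. -/
def lebesgue [MeasurableSpace B] (φb : Flow ℝ B) (base : ConnectedComponents B → B) : Measure B :=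
  Measure.sum fun C => (volume.restrict (Ico 0 (periodAt φb (base C)))).map fun t => φb t (base C)

/-- The pullback `r^* db` of a measure by the étale map `r : H_B → B`, that is
`A ↦ ∫ #(A ∩ r⁻¹(b)) db`. -/
def pullback {n : ℕ} {V : Type*} [TopologicalSpace V] [ChartedSpace (Model n) V] {ι : B → V}
    [MeasurableSpace B] (μ : Measure B) : Measure (Arrow n ι) :=
  μ.bind fun b => Measure.count.restrict {γ : Arrow n ι | γ.rng = b}

variable {n : ℕ} {V : Type*} [TopologicalSpace V] [ChartedSpace (Model n) V]

variable (n) in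
/-- The subgroupoid `H_{B_p}` of arrows with source and range in a connected component. -/
def arrowsIn (ι : B → V) (C : ConnectedComponents B) : Set (Arrow n ι) :=
  {γ | (γ.src : ConnectedComponents B) = C ∧ (γ.rng : ConnectedComponents B) = C}

end Circles

/-! ## Smoothing operators and operator traces -/

section Operators

variable {B : Type*} [TopologicalSpace B] [ChartedSpace ℝ B] [MeasurableSpace B]

/-- A smoothing operator on `C^∞(B)`: one given by a smooth kernel on `B × B`. -/
def IsSmoothing (μ : Measure B) (T : Module.End ℂ (smoothFunctions B)) : Prop :=
  ∃ k : B × B → ℂ, ContMDiff (𝓘(ℝ, ℝ).prod 𝓘(ℝ, ℝ)) 𝓘(ℝ, ℂ) ∞ k ∧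
    ∀ (ξ : smoothFunctions B) (b : B), (T ξ : B → ℂ) b = ∫ b', k (b, b') * (ξ : B → ℂ) b' ∂μ

/-- `τ` is the operator trace of `T`: the operator `T` on `C^∞(B)` extends to a bounded operator
of `L²(B)`, and the sum of its diagonal coefficients in every Hilbert basis converges to `τ`. -/
def IsOperatorTrace (μ : Measure B) (T : Module.End ℂ (smoothFunctions B)) (τ : ℂ) : Prop :=
  ∃ S : Lp ℂ 2 μ →L[ℂ] Lp ℂ 2 μ,
    (∀ (ξ : smoothFunctions B) (u : Lp ℂ 2 μ), u =ᵐ[μ] (ξ : B → ℂ) →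
      S u =ᵐ[μ] (T ξ : B → ℂ)) ∧
    ∀ (κ : Type) (e : HilbertBasis κ ℂ (Lp ℂ 2 μ)), HasSum (fun i => inner ℂ (e i) (S (e i))) τ

end Operators

end

end TransverseFlow

open TransverseFlow

/-! Holonomy commutes with the flow. In a foliated chart the flow permutes plaques, so the height of
a moving point solves an autonomous equation, and this equation is the same for `φ` and for the
induced flow `φb` (`IsInducedFlow.eventually_height_eq`). Pushing a leafwise path from `b` to `b'`
by `φ` then shows that its holonomy is the germ of `φb t b ↦ φb t b'`
(`IsTransverseSystem.holonomy_equivariant`). This germ depends only on the end points. Hence `H_B`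
is the relation "on the same leaf" on `B` (`IsTransverseSystem.arrow_ext`), and the orbits of the
lifted flow are open in it, with time as étale coordinate (`IsTransverseSystem.nhds_arrow`). Each
leaf meets `B` in a countable set (`IsTransverseSystem.countable_leaf`). These facts are collected
in `IsFlowRelation`, and the foliation is not needed for the analysis that follows.

On the compact space `B` the orbits are open, so they are the components; stabilizers are discrete
and nontrivial, so the components are circles with a rotation flow. The convolution algebra acts on
functions on any space that carries an action of the crossed product. Convolution is the case of `G`
acting on itself, so a single Fubini argument (`IsFlowRelation.act_conv`) gives both associativity
and the representation on `B`.

Cutting the time integral into periods shows that `f` acts by the kernel `k(b, b')` which sums `f`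
over the arrows with range `b` and source `b'` (`IsFlowRelation.act_eq_integral`). Moving `b` and
`b'` along the flow moves these arrows, so `k` is locally a fixed finite sum of smooth functions.
Its Fourier series in `b'` has coefficients that are `O(1/n²)` uniformly in `b`; the operator is
therefore an absolutely convergent series of operators of rank one, and its trace in every Hilbert
basis is `∫ k(b, b) db` (`exists_operatorTrace`).

An arrow `(γ, t)` is an automorphism exactly when source and range of `γ` lie on the same circle and
`t = np + r(γ) - s(γ)` for some `n`. Unfolding `k(b, b)` over these arrows gives the trace formula
(`IsFlowRelation.hasSum_trace`). The automorphism condition is invariant when `γ` moves along the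
lifted flow with `t` fixed. So the trace is also the integral over the curves `u ↦ (Ψ u γ, t)`, and
the sum of their Lebesgue measures is the required measure, supported by the automorphisms. -/

set_option linter.unusedSectionVars false

namespace TransverseFlow

/-! ### Plaques, leafwise paths and transport along leaves -/

section LeafGeometry

variable {n : ℕ} {V : Type*} [TopologicalSpace V] [ChartedSpace (Model n) V]

theorem IsFoliatedAtlas.exists_height_map (hV : IsFoliatedAtlas n V)
    {e e' : OpenPartialHomeomorph V (Model n)} (he : e ∈ atlas (Model n) V)
    (he' : e' ∈ atlas (Model n) V) {p : V} (hp : p ∈ e.source) (hp' : p ∈ e'.source) :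
    ∃ h : ℝ → ℝ, ∀ᶠ v in 𝓝 p, (e' v).2 = h (e v).2 := by
  obtain ⟨h, hh⟩ := hV e he e' he' (e p) (by simp [hp, hp'])
  refine ⟨h, ?_⟩
  filter_upwards [(e.continuousAt hp).eventually hh, e.open_source.mem_nhds hp] with v hv hv'
  rwa [e.left_inv hv'] at hv

/-- Near `p` the second height is a function of the first, so lying on the same plaque near `p` does
not depend on the chart. -/
theorem IsFoliatedAtlas.height_eq_transfer (hV : IsFoliatedAtlas n V)
    {e e' : OpenPartialHomeomorph V (Model n)} (he : e ∈ atlas (Model n) V)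
    (he' : e' ∈ atlas (Model n) V) {p : V} (hp : p ∈ e.source) (hp' : p ∈ e'.source)
    {T : Type*} {l : Filter T} {α β : T → V} (hα : Filter.Tendsto α l (𝓝 p))
    (hβ : Filter.Tendsto β l (𝓝 p)) (h : ∀ᶠ t in l, (e (α t)).2 = (e (β t)).2) :
    ∀ᶠ t in l, (e' (α t)).2 = (e' (β t)).2 := by
  obtain ⟨k, hk⟩ := hV.exists_height_map he he' hp hp'
  filter_upwards [h, hα.eventually hk, hβ.eventually hk] with t h1 h2 h3
  rw [h2, h3, h1]

theorem IsFoliatedAtlas.isLeafwise_symm_comp (hV : IsFoliatedAtlas n V)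
    {e : OpenPartialHomeomorph V (Model n)} (he : e ∈ atlas (Model n) V) {q : I → Model n}
    (hq : Continuous q) (hqt : ∀ s, q s ∈ e.target) (hc : ∀ s s', (q s).2 = (q s').2) :
    IsLeafwise n (fun s => e.symm (q s)) := by
  refine ⟨continuous_iff_continuousAt.2 fun s =>
    (e.continuousAt_symm (hqt s)).comp hq.continuousAt, fun e' he' s hs => ?_⟩
  obtain ⟨h, hh⟩ := hV e he e' he' (q s) ⟨hqt s, hs⟩
  filter_upwards [hq.continuousAt.eventually hh] with s' hs'
  have h0 := hh.self_of_nhds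
  rw [hs', h0, hc s' s]

theorem IsLeafwise.comp {c : I → V} (hc : IsLeafwise n c) {g : I → I} (hg : Continuous g) :
    IsLeafwise n (c ∘ g) :=
  ⟨hc.1.comp hg, fun e he s hs => hg.continuousAt.eventually (hc.2 e he (g s) hs)⟩

theorem isLeafwise_const (v : V) : IsLeafwise n (fun _ : I => v) :=
  ⟨continuous_const, fun _ _ _ _ => Filter.Eventually.of_forall fun _ => rfl⟩

theorem IsLeafwise.height_eq {c : I → V} (hc : IsLeafwise n c)
    {e : OpenPartialHomeomorph V (Model n)} (he : e ∈ atlas (Model n) V) {J : Set I}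
    (hJ : IsPreconnected J) (hs : ∀ s ∈ J, c s ∈ e.source) {s s' : I} (h : s ∈ J) (h' : s' ∈ J) :
    (e (c s)).2 = (e (c s')).2 := by
  refine hJ.induction₂ (fun x y => (e (c x)).2 = (e (c y)).2) (fun x hx => ?_) ?_ ?_ h h'
  · filter_upwards [mem_nhdsWithin_of_mem_nhds (hc.2 e he x (hs x hx))] with y hy using hy.symm
  · intro x y z _ _ _ h1 h2
    exact h1.trans h2
  · intro x y _ _ h1
    exact h1.symm

theorem IsLeafwise.ite {c c' : I → V} (hc : IsLeafwise n c) (hc' : IsLeafwise n c') {δ : ℝ}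
    (hδ : ∀ s : I, (s : ℝ) = δ → c s = c' s) :
    IsLeafwise n (fun s : I => if (s : ℝ) ≤ δ then c s else c' s) := by
  refine ⟨hc.1.if_le hc'.1 continuous_subtype_val continuous_const hδ, fun e he s hs => ?_⟩
  dsimp only at hs ⊢
  rcases lt_trichotomy (s : ℝ) δ with h | h | h
  · have h1 : ∀ᶠ s' : I in 𝓝 s, (s' : ℝ) < δ :=
      continuous_subtype_val.continuousAt.eventually (Iio_mem_nhds h)
    rw [if_pos h.le] at hs
    filter_upwards [h1, hc.2 e he s hs] with s' h2 h3
    rwa [if_pos h2.le, if_pos h.le]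
  · rw [if_pos h.le] at hs
    have hs' : c' s ∈ e.source := hδ s h ▸ hs
    filter_upwards [hc.2 e he s hs, hc'.2 e he s hs'] with s' h2 h3
    rw [if_pos h.le]
    split_ifs
    · exact h2
    · rw [h3, hδ s h]
  · have h1 : ∀ᶠ s' : I in 𝓝 s, δ < (s' : ℝ) :=
      continuous_subtype_val.continuousAt.eventually (Ioi_mem_nhds h)
    rw [if_neg h.not_ge] at hs
    filter_upwards [h1, hc'.2 e he s hs] with s' h2 h3
    rwa [if_neg h2.not_ge, if_neg h.not_ge]

theorem IsLeafwise.trans {u v w : V} {c : Path u v} {c' : Path v w} (hc : IsLeafwise n c)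
    (hc' : IsLeafwise n c') : IsLeafwise n (c.trans c') := by
  have h1 := hc.comp (g := fun s : I => projIcc 0 1 zero_le_one (2 * (s : ℝ))) (by fun_prop)
  have h2 := hc'.comp (g := fun s : I => projIcc 0 1 zero_le_one (2 * (s : ℝ) - 1)) (by fun_prop)
  have h3 := h1.ite h2 (δ := 1 / 2) (by
    intro s hs
    simp [hs])
  have : (c.trans c' : I → V) = fun s : I => if (s : ℝ) ≤ 1 / 2 then
      (c ∘ fun s : I => projIcc 0 1 zero_le_one (2 * (s : ℝ))) s else
      (c' ∘ fun s : I => projIcc 0 1 zero_le_one (2 * (s : ℝ) - 1)) s := by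
    ext s
    simp only [Path.trans, Path.coe_mk', Function.comp_apply]
    rfl
  rw [this]
  exact h3

theorem SameLeaf.refl (v : V) : SameLeaf n v v := ⟨Path.refl v, isLeafwise_const v⟩

theorem SameLeaf.symm {v w : V} : SameLeaf n v w → SameLeaf n w v := fun ⟨c, hc⟩ =>
  ⟨c.symm, hc.comp unitInterval.continuous_symm⟩

theorem SameLeaf.trans {u v w : V} : SameLeaf n u v → SameLeaf n v w → SameLeaf n u w :=
  fun ⟨c, hc⟩ ⟨c', hc'⟩ => ⟨c.trans c', hc.trans hc'⟩

theorem IsTransverseFlow.continuous {φ : Flow ℝ V} (_ : IsTransverseFlow n φ) (t : ℝ) :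
    Continuous (φ t) := φ.cont'.comp (Continuous.prodMk_right t)

theorem IsTransverseFlow.sameLeaf {φ : Flow ℝ V} (hφ : IsTransverseFlow n φ) (t : ℝ) {v w : V} :
    SameLeaf n v w → SameLeaf n (φ t v) (φ t w) := fun ⟨c, hc⟩ =>
  ⟨c.map (hφ.continuous t), hφ.map_leafwise t c hc⟩

theorem IsTransverseFlow.sameLeaf_iff {φ : Flow ℝ V} (hφ : IsTransverseFlow n φ) (t : ℝ)
    {v w : V} : SameLeaf n (φ t v) (φ t w) ↔ SameLeaf n v w := by
  refine ⟨fun h => ?_, hφ.sameLeaf t⟩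
  have := hφ.sameLeaf (-t) h
  rwa [← φ.map_add, ← φ.map_add, neg_add_cancel, φ.map_zero_apply, φ.map_zero_apply] at this

theorem exists_isPreconnected_nhds {s : I} {J : Set I} (hJ : J ∈ 𝓝 s) :
    ∃ J0 ∈ 𝓝 s, IsPreconnected J0 ∧ J0 ⊆ J := by
  obtain ⟨ε, hε, h⟩ := Metric.mem_nhds_iff.1 hJ
  refine ⟨Metric.ball s ε, Metric.ball_mem_nhds s hε, ?_, h⟩
  rw [← Topology.IsInducing.subtypeVal.isPreconnected_image]
  have : Subtype.val '' Metric.ball s ε = Icc (0 : ℝ) 1 ∩ Metric.ball (s : ℝ) ε := by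
    ext x
    constructor
    · rintro ⟨y, hy, rfl⟩
      exact ⟨y.2, hy⟩
    · exact fun hx => ⟨⟨x, hx.1⟩, hx.2, rfl⟩
  rw [this]
  exact ((convex_Icc 0 1).inter (convex_ball _ _)).isPreconnected

/-- Two families of leafwise paths close to a given path that start on the same plaques
also end on the same plaques. -/
theorem IsFoliatedAtlas.transport (hV : IsFoliatedAtlas n V) {T : Type*} {l : Filter T}
    {P P' : T → I → V} {c : I → V} (hc : Continuous c)
    (hP : ∀ s, Filter.Tendsto (fun x : T × I => P x.1 x.2) (l ×ˢ 𝓝 s) (𝓝 (c s)))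
    (hP' : ∀ s, Filter.Tendsto (fun x : T × I => P' x.1 x.2) (l ×ˢ 𝓝 s) (𝓝 (c s)))
    (hl : ∀ᶠ t in l, IsLeafwise n (P t)) (hl' : ∀ᶠ t in l, IsLeafwise n (P' t))
    (h0 : ∃ e ∈ atlas (Model n) V, c 0 ∈ e.source ∧ ∀ᶠ t in l, (e (P t 0)).2 = (e (P' t 0)).2)
    {e : OpenPartialHomeomorph V (Model n)} (he : e ∈ atlas (Model n) V) (h1 : c 1 ∈ e.source) :
    ∀ᶠ t in l, (e (P t 1)).2 = (e (P' t 1)).2 := by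
  have hPs : ∀ s, Filter.Tendsto (fun t => P t s) l (𝓝 (c s)) := fun s =>
    (hP s).comp (Filter.tendsto_id.prodMk (tendsto_const_nhds (x := s)))
  have hPs' : ∀ s, Filter.Tendsto (fun t => P' t s) l (𝓝 (c s)) := fun s =>
    (hP' s).comp (Filter.tendsto_id.prodMk (tendsto_const_nhds (x := s)))
  let A : I → Prop := fun s => ∀ e ∈ atlas (Model n) V, c s ∈ e.source →
    ∀ᶠ t in l, (e (P t s)).2 = (e (P' t s)).2
  have hA : ∀ s : I, ∀ e ∈ atlas (Model n) V, c s ∈ e.source →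
      (A s ↔ ∀ᶠ t in l, (e (P t s)).2 = (e (P' t s)).2) := fun s e he hs =>
    ⟨fun h => h e he hs, fun h e' he' hs' => hV.height_eq_transfer he he' hs hs' (hPs s) (hPs' s) h⟩
  -- The condition `A s` is locally constant in `s`: for times near `s` both families stay in one
  -- chart, where leafwise paths have constant height. The interval is connected.
  have key : A 0 ↔ A 1 := by
    refine isPreconnected_univ.induction₂ (fun x y => A x ↔ A y) (fun s _ => ?_)
      (fun _ _ _ _ _ _ h h' => h.trans h') (fun _ _ _ _ h => h.symm) (mem_univ _) (mem_univ _)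
    rw [nhdsWithin_univ]
    set e := chartAt (Model n) (c s)
    have hs : c s ∈ e.source := mem_chart_source _ _
    have hsn := e.open_source.mem_nhds hs
    have E := ((hP s).eventually hsn).and ((hP' s).eventually hsn)
    obtain ⟨T0, hT0, J, hJ, hTJ⟩ := Filter.eventually_prod_iff.1 E
    have hJ' := Filter.Eventually.and hJ (hc.continuousAt.eventually hsn)
    obtain ⟨J0, hJn, hJc, hJ0⟩ := exists_isPreconnected_nhds hJ'
    have hsJ := mem_of_mem_nhds hJn
    filter_upwards [hJn] with s' hs'
    rw [hA s e (chart_mem_atlas _ _) hs, hA s' e (chart_mem_atlas _ _) (hJ0 hs').2]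
    have : ∀ᶠ t in l, ((e (P t s)).2 = (e (P' t s)).2 ↔ (e (P t s')).2 = (e (P' t s')).2) := by
      filter_upwards [hT0, hl, hl'] with t ht h1 h2
      rw [h1.height_eq (chart_mem_atlas _ _) hJc
          (fun x hx => (hTJ ht (hJ0 hx).1).1) hsJ hs',
        h2.height_eq (chart_mem_atlas _ _) hJc
          (fun x hx => (hTJ ht (hJ0 hx).1).2) hsJ hs']
    exact Filter.eventually_congr this
  obtain ⟨e0, he0, hs0, h0⟩ := h0
  exact (hA 1 e he h1).1 (key.1 ((hA 0 e0 he0 hs0).2 h0))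

end LeafGeometry

/-! ### Transverse coordinates and the ambient flow -/

section Height

variable {n : ℕ} {V : Type*} [TopologicalSpace V] [ChartedSpace (Model n) V]
  [IsManifold 𝓘(ℝ, Model n) ∞ V]

theorem contMDiffAt_height {e : OpenPartialHomeomorph V (Model n)} (he : e ∈ atlas (Model n) V)
    {v : V} (hv : v ∈ e.source) :
    ContMDiffAt 𝓘(ℝ, Model n) 𝓘(ℝ, ℝ) ∞ (fun w => (e w).2) v :=
  ContMDiffAt.comp v (contDiff_snd (𝕜 := ℝ)).contMDiff.contMDiffAt
    (contMDiffAt_of_mem_maximalAtlas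
      (IsManifold.subset_maximalAtlas he : e ∈ IsManifold.maximalAtlas 𝓘(ℝ, Model n) ∞ V) hv)

theorem contMDiffAt_chart_symm {e : OpenPartialHomeomorph V (Model n)}
    (he : e ∈ atlas (Model n) V) {q : Model n} (hq : q ∈ e.target) :
    ContMDiffAt 𝓘(ℝ, Model n) 𝓘(ℝ, Model n) ∞ e.symm q :=
  (contMDiffOn_symm_of_mem_maximalAtlas
      (IsManifold.subset_maximalAtlas he :
        e ∈ IsManifold.maximalAtlas 𝓘(ℝ, Model n) ∞ V)).contMDiffAt (e.open_target.mem_nhds hq)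

/-- The differential of a real function on a manifold, as a real number. -/
noncomputable def differential {E : Type*} [NormedAddCommGroup E] [NormedSpace ℝ E] {X : Type*}
    [TopologicalSpace X] [ChartedSpace E X] (y : X → ℝ) (x : X) (v : TangentSpace 𝓘(ℝ, E) x) : ℝ :=
  mfderiv 𝓘(ℝ, E) 𝓘(ℝ, ℝ) y x v

/-- `leafTangent` refers to the preferred chart only. Any other height is a function of the
preferred one, and this function is smooth because it can be read along the transverse arc `j`; the
chain rule concludes. -/
theorem differential_height_eq_zero (hV : IsFoliatedAtlas n V)
    {e : OpenPartialHomeomorph V (Model n)} (he : e ∈ atlas (Model n) V) {v : V}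
    (hv : v ∈ e.source) {X : TangentSpace 𝓘(ℝ, Model n) v} (hX : X ∈ leafTangent n v) :
    differential (E := Model n) (fun w => (e w).2) v X = 0 := by
  set e' := chartAt (Model n) v with he'
  have hv' : v ∈ e'.source := mem_chart_source _ _
  have he'a : e' ∈ atlas (Model n) V := chart_mem_atlas _ _
  obtain ⟨h, hh⟩ := hV.exists_height_map he'a he hv' hv
  let j : ℝ → V := fun r => e'.symm ((e' v).1, r)
  have hj : ContMDiffAt 𝓘(ℝ, ℝ) 𝓘(ℝ, Model n) ∞ j (e' v).2 :=
    ContMDiffAt.comp (e' v).2 (contMDiffAt_chart_symm he'a (e'.map_source hv'))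
      ((contDiff_const.prodMk contDiff_id).contMDiff.contMDiffAt :
        ContMDiffAt 𝓘(ℝ, ℝ) 𝓘(ℝ, Model n) ∞ (fun r : ℝ => ((e' v).1, r)) (e' v).2)
  have hj0 : j (e' v).2 = v := e'.left_inv hv'
  have hk : ContMDiffAt 𝓘(ℝ, ℝ) 𝓘(ℝ, ℝ) ∞ (fun r => (e (j r)).2) (e' v).2 :=
    ContMDiffAt.comp (g := fun w => (e w).2) (f := j) (e' v).2
      (by rw [hj0]; exact contMDiffAt_height he hv) hj
  have hev : ∀ᶠ r in 𝓝 (e' v).2, (e (j r)).2 = h r := by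
    have h1 : Filter.Tendsto j (𝓝 (e' v).2) (𝓝 v) := by
      have := hj.continuousAt.tendsto
      rwa [hj0] at this
    have h2 : ∀ᶠ r in 𝓝 (e' v).2, ((e' v).1, r) ∈ e'.target :=
      (Continuous.prodMk_right (e' v).1).continuousAt.eventually
        (e'.open_target.mem_nhds (e'.map_source hv'))
    filter_upwards [h1.eventually hh, h2] with r hr hr2
    rw [hr]
    simp only [j]
    rw [e'.right_inv hr2]
  have hcomp : (fun w => (e w).2) =ᶠ[𝓝 v] (fun r => (e (j r)).2) ∘ fun w => (e' w).2 := by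
    filter_upwards [hh, (contMDiffAt_height he'a hv').continuousAt.eventually hev] with w h1 h2
    rw [h1, Function.comp_apply, h2]
  rw [differential, hcomp.mfderiv_eq, mfderiv_comp v (hk.mdifferentiableAt (by simp))
    ((contMDiffAt_height he'a hv').mdifferentiableAt (by simp))]
  have hX' : mfderiv 𝓘(ℝ, Model n) 𝓘(ℝ, ℝ) (fun w : V => (e' w).2) v X = 0 := hX
  change (mfderiv 𝓘(ℝ, ℝ) 𝓘(ℝ, ℝ) (fun r => (e (j r)).2) (e' v).2)
    (mfderiv 𝓘(ℝ, Model n) 𝓘(ℝ, ℝ) (fun w : V => (e' w).2) v X) = 0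
  rw [hX', map_zero]

theorem hasDerivAt_comp_curve {E : Type*} [NormedAddCommGroup E] [NormedSpace ℝ E] {X : Type*}
    [TopologicalSpace X] [ChartedSpace E X] {y : X → ℝ} {α : ℝ → X} {t : ℝ} {x : X} (hx : α t = x)
    (hy : MDifferentiableAt 𝓘(ℝ, E) 𝓘(ℝ, ℝ) y x)
    (hα : MDifferentiableAt 𝓘(ℝ, ℝ) 𝓘(ℝ, E) α t) :
    HasDerivAt (fun s => y (α s))
      (differential (E := E) y x (mfderiv 𝓘(ℝ, ℝ) 𝓘(ℝ, E) α t (1 : ℝ))) t := by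
  subst hx
  let L : ℝ →L[ℝ] ℝ :=
    (mfderiv 𝓘(ℝ, E) 𝓘(ℝ, ℝ) y (α t)).comp (mfderiv 𝓘(ℝ, ℝ) 𝓘(ℝ, E) α t)
  have h : HasFDerivAt (fun s => y (α s)) L t :=
    (hy.hasMFDerivAt.comp t hα.hasMFDerivAt).hasFDerivAt
  exact h.hasDerivAt

theorem IsTransverseFlow.contMDiff_orbit {φ : Flow ℝ V} (hφ : IsTransverseFlow n φ) (v : V) :
    ContMDiff 𝓘(ℝ, ℝ) 𝓘(ℝ, Model n) ∞ (fun t => φ t v) :=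
  hφ.smooth.comp (contMDiff_id.prodMk contMDiff_const)

theorem IsTransverseFlow.hasDerivAt_height {φ : Flow ℝ V} (hφ : IsTransverseFlow n φ)
    {e : OpenPartialHomeomorph V (Model n)} (he : e ∈ atlas (Model n) V) {v : V}
    (hv : v ∈ e.source) :
    HasDerivAt (fun s => (e (φ s v)).2)
      (differential (E := Model n) (fun w => (e w).2) v (generator φ v)) 0 := by
  exact hasDerivAt_comp_curve (t := 0) (α := fun s => φ s v) (y := fun w => (e w).2)
    (φ.map_zero_apply v) ((contMDiffAt_height he hv).mdifferentiableAt (by simp))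
    ((hφ.contMDiff_orbit v).mdifferentiable (by simp) 0)

/-- Near a point the flow carries plaques into plaques of the same chart. -/
theorem IsTransverseFlow.exists_height_eq (hV : IsFoliatedAtlas n V) {φ : Flow ℝ V}
    (hφ : IsTransverseFlow n φ) {e : OpenPartialHomeomorph V (Model n)}
    (he : e ∈ atlas (Model n) V) {v : V} (hv : v ∈ e.source) :
    ∃ W ∈ 𝓝 v, W ⊆ e.source ∧ ∀ᶠ s in 𝓝 (0 : ℝ), ∀ w ∈ W, ∀ w' ∈ W, (e w).2 = (e w').2 →
      (e (φ s w)).2 = (e (φ s w')).2 := by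
  have hc : ContinuousAt (fun x : ℝ × Model n => φ x.1 (e.symm x.2)) (0, e v) := by
    have h1 : ContinuousAt (fun x : ℝ × Model n => (x.1, e.symm x.2)) (0, e v) :=
      continuousAt_fst.prodMk (ContinuousAt.comp (g := e.symm) (f := Prod.snd)
        (e.continuousAt_symm (e.map_source hv)) continuousAt_snd)
    exact ContinuousAt.comp (g := fun x : ℝ × V => φ x.1 x.2) φ.cont'.continuousAt h1
  have h0 : (fun x : ℝ × Model n => φ x.1 (e.symm x.2)) (0, e v) = v := by
    simp [e.left_inv hv]
  have hev : ∀ᶠ x : ℝ × Model n in 𝓝 0 ×ˢ 𝓝 (e v), φ x.1 (e.symm x.2) ∈ e.source := by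
    rw [← nhds_prod_eq]
    exact hc.eventually (by rw [h0]; exact e.open_source.mem_nhds hv)
  obtain ⟨S, hS, Q, hQ, hSQ⟩ := Filter.eventually_prod_iff.1 hev
  obtain ⟨r, hr, hrQ⟩ := Metric.mem_nhds_iff.1
    (Filter.inter_mem hQ (e.open_target.mem_nhds (e.map_source hv)))
  refine ⟨e.source ∩ e ⁻¹' Metric.ball (e v) r, Filter.inter_mem (e.open_source.mem_nhds hv)
    ((e.continuousAt hv).preimage_mem_nhds (Metric.ball_mem_nhds _ hr)), inter_subset_left, ?_⟩
  filter_upwards [hS] with s hs w hw w' hw' hww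
  -- The segment between two points of a plaque is a leafwise path. The flow maps it to a leafwise
  -- path inside the chart, whose height is constant.
  let q : I → Model n := fun x => AffineMap.lineMap (e w) (e w') (x : ℝ)
  have hq : Continuous q := (AffineMap.lineMap_continuous).comp continuous_subtype_val
  have hqb : ∀ x, q x ∈ Metric.ball (e v) r := fun x =>
    (convex_ball (e v) r).lineMap_mem hw.2 hw'.2 x.2
  have hlw := hφ.map_leafwise s _ (hV.isLeafwise_symm_comp he hq (fun x => (hrQ (hqb x)).2)
    (by
      intro x x'
      simp [q, AffineMap.lineMap_apply, hww]))
  have := hlw.height_eq he isPreconnected_univ (fun x _ => hSQ hs (hrQ (hqb x)).1)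
    (mem_univ 0) (mem_univ 1)
  simpa [q, e.left_inv hw.1, e.left_inv hw'.1] using this

end Height

/-! ### The induced flow on the transversal -/

section InducedFlow

variable {B : Type*} [TopologicalSpace B] [ChartedSpace ℝ B]

/-- The inverse function theorem applied to the orbit of `b` read in a chart. The time `τ` serves as
the local coordinate on the transversal in all that follows. -/
theorem exists_flow_time [IsManifold 𝓘(ℝ, ℝ) ∞ B] {φb : Flow ℝ B}
    (hs : ContMDiff (𝓘(ℝ, ℝ).prod 𝓘(ℝ, ℝ)) 𝓘(ℝ, ℝ) ∞ (fun p : ℝ × B => φb p.1 p.2)) {b : B}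
    (hb : (generator φb b : TangentSpace 𝓘(ℝ, ℝ) b) ≠ 0) :
    ∃ τ : B → ℝ, ContMDiffAt 𝓘(ℝ, ℝ) 𝓘(ℝ, ℝ) ∞ τ b ∧ τ b = 0 ∧
      (∀ᶠ z in 𝓝 b, φb (τ z) b = z) ∧ ∀ᶠ t in 𝓝 0, τ (φb t b) = t := by
  set κ := chartAt ℝ b
  have hbs : b ∈ κ.source := mem_chart_source _ _
  have horb : ContMDiff 𝓘(ℝ, ℝ) 𝓘(ℝ, ℝ) ∞ (fun t => φb t b) :=
    hs.comp (contMDiff_id.prodMk contMDiff_const)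
  have hκ : ContMDiffAt 𝓘(ℝ, ℝ) 𝓘(ℝ, ℝ) ∞ κ b :=
    contMDiffAt_of_mem_maximalAtlas
      (IsManifold.chart_mem_maximalAtlas b : κ ∈ IsManifold.maximalAtlas 𝓘(ℝ, ℝ) ∞ B) hbs
  have hκs : ContMDiffAt 𝓘(ℝ, ℝ) 𝓘(ℝ, ℝ) ∞ κ.symm (κ b) :=
    (contMDiffOn_symm_of_mem_maximalAtlas
      (IsManifold.chart_mem_maximalAtlas b :
        κ ∈ IsManifold.maximalAtlas 𝓘(ℝ, ℝ) ∞ B)).contMDiffAt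
      (κ.open_target.mem_nhds (κ.map_source hbs))
  let f : ℝ → ℝ := fun t => κ (φb t b)
  have hf0 : f 0 = κ b := by simp [f]
  have hf : ContDiffAt ℝ ∞ f 0 :=
    (ContMDiffAt.comp (0 : ℝ) (by simpa using hκ) horb.contMDiffAt).contDiffAt
  have hd := hasDerivAt_comp_curve (t := 0) (α := fun s => φb s b) (y := κ)
    (φb.map_zero_apply b) (hκ.mdifferentiableAt (by simp))
    (horb.mdifferentiable (by simp) 0)
  set f' := differential (E := ℝ) κ b
    (mfderiv 𝓘(ℝ, ℝ) 𝓘(ℝ, ℝ) (fun s => φb s b) 0 (1 : ℝ)) with hf'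
  have hf'0 : f' ≠ 0 := by
    intro h0
    apply hb
    have h1 : MDifferentiableAt 𝓘(ℝ, ℝ) 𝓘(ℝ, ℝ) κ.symm (f 0) := by
      rw [hf0]; exact hκs.mdifferentiableAt (by simp)
    have h2 : (fun t => φb t b) =ᶠ[𝓝 0] fun t => κ.symm (f t) := by
      have : ∀ᶠ t in 𝓝 (0 : ℝ), φb t b ∈ κ.source :=
        horb.continuous.continuousAt.eventually
          (κ.open_source.mem_nhds (by simpa using hbs))
      filter_upwards [this] with t ht
      exact (κ.left_inv ht).symm
    have h3 : HasMFDerivAt 𝓘(ℝ, ℝ) 𝓘(ℝ, ℝ) f 0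
        (ContinuousLinearMap.toSpanSingleton ℝ f') := hd.hasFDerivAt.hasMFDerivAt
    have h4 := (h1.hasMFDerivAt.comp 0 h3)
    have h5 : mfderiv 𝓘(ℝ, ℝ) 𝓘(ℝ, ℝ) (fun t => φb t b) 0 = _ :=
      h2.mfderiv_eq.trans h4.mfderiv
    change (mfderiv 𝓘(ℝ, ℝ) 𝓘(ℝ, ℝ) (fun t => φb t b) 0) (1 : ℝ) = 0
    rw [h5]
    change (mfderiv 𝓘(ℝ, ℝ) 𝓘(ℝ, ℝ) κ.symm (f 0)) ((1 : ℝ) • f') = 0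
    rw [h0, smul_zero]
    exact map_zero (mfderiv 𝓘(ℝ, ℝ) 𝓘(ℝ, ℝ) κ.symm (f 0))
  have hst : HasStrictDerivAt f f' 0 := hf.hasStrictDerivAt' hd (by simp)
  have heq := hst.hasStrictFDerivAt_equiv hf'0
  let g := hst.localInverse f f' 0 hf'0
  have hg : ContDiffAt ℝ ∞ g (f 0) := hf.to_localInverse heq.hasFDerivAt (by simp)
  have hl : ∀ᶠ t in 𝓝 0, g (f t) = t := heq.eventually_left_inverse
  have hr : ∀ᶠ y in 𝓝 (f 0), f (g y) = y := heq.eventually_right_inverse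
  have hτ : ContMDiffAt 𝓘(ℝ, ℝ) 𝓘(ℝ, ℝ) ∞ (fun z => g (κ z)) b :=
    ContMDiffAt.comp b (by rw [← hf0]; exact hg.contMDiffAt) hκ
  have hτ0 : g (κ b) = 0 := by rw [← hf0]; exact hl.self_of_nhds
  refine ⟨fun z => g (κ z), hτ, hτ0, ?_, hl⟩
  have h1 : Filter.Tendsto (fun z => φb (g (κ z)) b) (𝓝 b) (𝓝 b) := by
    have := (horb.continuous.continuousAt (x := g (κ b))).tendsto.comp hτ.continuousAt.tendsto
    rw [hτ0, φb.map_zero_apply] at this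
    exact this
  have h2 : ∀ᶠ z in 𝓝 b, f (g (κ z)) = κ z :=
    (κ.continuousAt hbs).eventually (by rw [← hf0]; exact hr)
  filter_upwards [h2, h1.eventually (κ.open_source.mem_nhds hbs), κ.open_source.mem_nhds hbs]
    with z hz hz1 hz2
  exact κ.injOn hz1 hz2 hz

variable {n : ℕ} {V : Type*} [TopologicalSpace V] [ChartedSpace (Model n) V] {φ : Flow ℝ V}
  {ι : B → V} {φb : Flow ℝ B}

theorem IsInducedFlow.generator_ne_zero (hφ : IsTransverseFlow n φ) (h : IsInducedFlow n φ ι φb)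
    (b : B) : (generator φb b : TangentSpace 𝓘(ℝ, ℝ) b) ≠ 0 := by
  intro h0
  have := h.generator_eq b
  rw [h0, map_zero, zero_sub] at this
  exact hφ.transverse (ι b) ((Submodule.neg_mem_iff _).1 this)

variable [IsManifold 𝓘(ℝ, Model n) ∞ V]

/-- The generators of `φb` and `φ` at `ι b` differ by a vector tangent to the leaf, which the
differential of the height kills. So both flows change the height at the same speed. -/
theorem IsInducedFlow.hasDerivAt_height (hV : IsFoliatedAtlas n V)
    (hι : IsCompleteTransversal n ι) (h : IsInducedFlow n φ ι φb)
    {e : OpenPartialHomeomorph V (Model n)} (he : e ∈ atlas (Model n) V) {b : B}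
    (hb : ι b ∈ e.source) :
    HasDerivAt (fun s => (e (ι (φb s b))).2)
      (differential (E := Model n) (fun w => (e w).2) (ι b) (generator φ (ι b))) 0 := by
  have horb : ContMDiff 𝓘(ℝ, ℝ) 𝓘(ℝ, ℝ) ∞ (fun t => φb t b) :=
    h.smooth.comp (contMDiff_id.prodMk contMDiff_const)
  have h1 := hasDerivAt_comp_curve (t := 0) (α := fun s => ι (φb s b)) (y := fun w => (e w).2)
    (congrArg ι (φb.map_zero_apply b)) ((contMDiffAt_height he hb).mdifferentiableAt (by simp))
    ((hι.smooth.comp horb).mdifferentiable (by simp) 0)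
  have h2 : mfderiv 𝓘(ℝ, ℝ) 𝓘(ℝ, Model n) (fun s => ι (φb s b)) 0 (1 : ℝ) =
      mfderiv 𝓘(ℝ, ℝ) 𝓘(ℝ, Model n) ι b (generator φb b) := by
    have := (((hι.smooth.mdifferentiable (by simp) _).hasMFDerivAt).comp (0 : ℝ)
      (horb.mdifferentiable (by simp) 0).hasMFDerivAt).mfderiv
    change mfderiv 𝓘(ℝ, ℝ) 𝓘(ℝ, Model n) (ι ∘ fun t => φb t b) 0 (1 : ℝ) = _
    rw [this]
    change mfderiv 𝓘(ℝ, ℝ) 𝓘(ℝ, Model n) ι (φb 0 b) (generator φb b) = _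
    rw [φb.map_zero_apply]
  rw [h2] at h1
  have h3 : differential (E := Model n) (fun w => (e w).2) (ι b)
        (mfderiv 𝓘(ℝ, ℝ) 𝓘(ℝ, Model n) ι b (generator φb b)) -
      differential (E := Model n) (fun w => (e w).2) (ι b) (generator φ (ι b)) = 0 := by
    rw [← differential_height_eq_zero hV he hb (h.generator_eq b), differential, differential,
      differential, map_sub]
    rfl
  rw [← sub_eq_zero.1 h3]
  exact h1

/-- Moving along the induced flow on the transversal or along the ambient flow leads to the same
plaque. -/
theorem IsInducedFlow.eventually_height_eq (hV : IsFoliatedAtlas n V) (hφ : IsTransverseFlow n φ)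
    (hι : IsCompleteTransversal n ι) (h : IsInducedFlow n φ ι φb) (b : B) :
    ∀ᶠ t in 𝓝 (0 : ℝ), (chartAt (Model n) (ι b) (ι (φb t b))).2 =
      (chartAt (Model n) (ι b) (φ t (ι b))).2 := by
  set e := chartAt (Model n) (ι b) with hedef
  have he : e ∈ atlas (Model n) V := chart_mem_atlas _ _
  have hb : ι b ∈ e.source := mem_chart_source _ _
  obtain ⟨W, hW, hWs, hWe⟩ := hφ.exists_height_eq hV he hb
  set x0 := (e (ι b)).1
  set y0 := (e (ι b)).2
  let j : ℝ → V := fun r => e.symm (x0, r)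
  have hj : ContMDiffAt 𝓘(ℝ, ℝ) 𝓘(ℝ, Model n) ∞ j y0 :=
    ContMDiffAt.comp y0 (contMDiffAt_chart_symm he (e.map_source hb))
      ((contDiff_const.prodMk contDiff_id).contMDiff.contMDiffAt :
        ContMDiffAt 𝓘(ℝ, ℝ) 𝓘(ℝ, Model n) ∞ (fun r : ℝ => (x0, r)) y0)
  have hj0 : j y0 = ι b := e.left_inv hb
  let g : ℝ × ℝ → ℝ := fun p => (e (φ p.1 (j p.2))).2
  have hg : ContDiffAt ℝ ∞ g (0, y0) := by
    rw [← contMDiffAt_iff_contDiffAt]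
    have h1 : ContMDiffAt 𝓘(ℝ, ℝ × ℝ) (𝓘(ℝ, ℝ).prod 𝓘(ℝ, Model n)) ∞
        (fun p : ℝ × ℝ => (p.1, j p.2)) (0, y0) :=
      (contDiff_fst (𝕜 := ℝ)).contMDiff.contMDiffAt.prodMk
        (ContMDiffAt.comp (g := j) (f := Prod.snd) (0, y0) hj
          (contDiff_snd (𝕜 := ℝ)).contMDiff.contMDiffAt)
    have h2 : ContMDiffAt 𝓘(ℝ, ℝ × ℝ) 𝓘(ℝ, Model n) ∞
        (fun p : ℝ × ℝ => φ p.1 (j p.2)) (0, y0) :=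
      ContMDiffAt.comp (0, y0) hφ.smooth.contMDiffAt h1
    exact ContMDiffAt.comp (g := fun w => (e w).2) (0, y0)
      (contMDiffAt_height he (by simpa [hj0] using hb)) h2
  -- Since the flow permutes plaques, the speed of the height at a point depends only on the height
  -- of that point. `Y` is this function, computed on the transverse arc `j`.
  let Y : ℝ → ℝ := fun r => fderiv ℝ g (0, r) (1, 0)
  have hY : ContDiffAt ℝ 1 Y y0 := by
    have h1 : ContDiffAt ℝ 1 (fderiv ℝ g) (0, y0) := hg.fderiv_right (by norm_num; exact WithTop.coe_le_coe.2 le_top)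
    have h2 : ContDiffAt ℝ 1 (fun r => fderiv ℝ g (0, r)) y0 :=
      ContDiffAt.comp y0 h1 (contDiffAt_const.prodMk contDiffAt_id)
    exact h2.clm_apply contDiffAt_const
  obtain ⟨K, N, hN, hK⟩ := hY.exists_lipschitzOnWith
  have hjW : ∀ᶠ r in 𝓝 y0, j r ∈ W := hj.continuousAt.eventually (by rw [hj0]; exact hW)
  have hjy : ∀ᶠ r in 𝓝 y0, (e (j r)).2 = r := by
    have h2 : ∀ᶠ r in 𝓝 y0, (x0, r) ∈ e.target :=
      (Continuous.prodMk_right x0).continuousAt.eventually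
        (e.open_target.mem_nhds (e.map_source hb))
    filter_upwards [h2] with r hr
    simp only [j]
    rw [e.right_inv hr]
  have hgd : ∀ᶠ r in 𝓝 y0, HasDerivAt (fun s => g (s, r)) (Y r) 0 := by
    have h1 : ∀ᶠ p in 𝓝 (0, y0), DifferentiableAt ℝ g p :=
      ((hg.of_le (m := 1) (by exact mod_cast le_top)).eventually (by simp)).mono
        fun p hp => hp.differentiableAt (by simp)
    have h2 : ∀ᶠ r in 𝓝 y0, DifferentiableAt ℝ g (0, r) :=
      (Continuous.prodMk_right (0 : ℝ)).continuousAt.eventually h1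
    filter_upwards [h2] with r hr
    exact hr.hasFDerivAt.comp_hasDerivAt (0 : ℝ)
      ((hasDerivAt_id (0 : ℝ)).prodMk (hasDerivAt_const (0 : ℝ) r))
  have hvec : ∀ᶠ w in 𝓝 (ι b), w ∈ W ∧ (e w).2 ∈ N ∧
      differential (E := Model n) (fun w => (e w).2) w (generator φ w) = Y (e w).2 := by
    have hy := (contMDiffAt_height he hb).continuousAt
    filter_upwards [hW, hy.eventually hN, hy.eventually hjW, hy.eventually hjy, hy.eventually hgd]
      with w h1 h2 h3 h4 h5
    refine ⟨h1, h2, (hφ.hasDerivAt_height he (hWs h1)).unique (h5.congr_of_eventuallyEq ?_)⟩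
    filter_upwards [hWe] with s hs
    exact hs w h1 _ h3 h4.symm
  have horb : Continuous (fun t => φb t b) := φb.cont'.comp (Continuous.prodMk_left b)
  have hcu : Filter.Tendsto (fun t => ι (φb t b)) (𝓝 0) (𝓝 (ι b)) := by
    have := (hι.smooth.continuous.comp horb).tendsto 0
    simpa [Function.comp_def] using this
  have hcw : Filter.Tendsto (fun t => φ t (ι b)) (𝓝 0) (𝓝 (ι b)) := by
    have := (hφ.contMDiff_orbit (ι b)).continuous.tendsto 0
    simpa using this
  -- Both heights solve `y' = Y y` with the same initial value, and `Y` is Lipschitz near it.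
  refine ODE_solution_unique_of_eventually (v := fun _ => Y) (s := fun _ => N) (K := K)
    (Filter.Eventually.of_forall fun _ => hK) ?_ ?_ (by simp)
  · filter_upwards [hcu.eventually hvec] with t ht
    refine ⟨?_, ht.2.1⟩
    have h1 := h.hasDerivAt_height hV hι he (hWs ht.1)
    rw [ht.2.2] at h1
    have h2 := HasDerivAt.comp_sub_const (a := t) (x := t) (by rw [sub_self]; exact h1)
    refine h2.congr_of_eventuallyEq (Filter.Eventually.of_forall fun s => ?_)
    simp only
    rw [← φb.map_add, sub_add_cancel]
  · filter_upwards [hcw.eventually hvec] with t ht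
    refine ⟨?_, ht.2.1⟩
    have h1 := hφ.hasDerivAt_height he (hWs ht.1)
    rw [ht.2.2] at h1
    have h2 := HasDerivAt.comp_sub_const (a := t) (x := t) (by rw [sub_self]; exact h1)
    refine h2.congr_of_eventuallyEq (Filter.Eventually.of_forall fun s => ?_)
    simp only
    rw [← φ.map_add, sub_add_cancel]

end InducedFlow

/-! ### Moving the starting points of leafwise paths -/

section Correction

variable {n : ℕ} {V : Type*} [TopologicalSpace V] [ChartedSpace (Model n) V]

/-- The starting points of a family of leafwise paths can be moved within their plaques. -/
theorem IsFoliatedAtlas.exists_correction (hV : IsFoliatedAtlas n V) {P : ℝ → I → V}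
    (hPc : Continuous fun x : ℝ × I => P x.1 x.2) (hPl : ∀ t, IsLeafwise n (P t)) {α : ℝ → V}
    (hα : Continuous α) (h0 : α 0 = P 0 0) {e : OpenPartialHomeomorph V (Model n)}
    (he : e ∈ atlas (Model n) V) (hs : P 0 0 ∈ e.source)
    (hαe : ∀ᶠ t in 𝓝 0, (e (α t)).2 = (e (P t 0)).2) :
    ∃ P' : ℝ → I → V, (Continuous fun x : ℝ × I => P' x.1 x.2) ∧ (∀ t, IsLeafwise n (P' t)) ∧
      P' 0 = P 0 ∧ (∀ᶠ t in 𝓝 0, P' t 0 = α t) ∧ ∀ᶠ t in 𝓝 0, P' t 1 = P t 1 := by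
  obtain ⟨ρ, hρ, hρt⟩ := Metric.mem_nhds_iff.1 (e.open_target.mem_nhds (e.map_source hs))
  have ev1 : ∀ᶠ x : ℝ × I in 𝓝 0 ×ˢ 𝓝 0, P x.1 x.2 ∈ e.source ∧
      e (P x.1 x.2) ∈ Metric.ball (e (P 0 0)) (ρ / 2) := by
    rw [← nhds_prod_eq]
    have hc : ContinuousAt (fun x : ℝ × I => P x.1 x.2) (0, 0) := hPc.continuousAt
    exact (hc.eventually (e.open_source.mem_nhds hs)).and
      ((ContinuousAt.comp (g := e) (f := fun x : ℝ × I => P x.1 x.2) (x := (0, 0))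
        (e.continuousAt hs) hc).eventually
        (Metric.ball_mem_nhds _ (half_pos hρ)))
  obtain ⟨S, hS, Q, hQ, hSQ⟩ := Filter.eventually_prod_iff.1 ev1
  have hP0 : ContinuousAt (fun t => P t 0) 0 :=
    (hPc.comp (Continuous.prodMk_left (0 : I))).continuousAt
  have hαs : α 0 ∈ e.source := h0 ▸ hs
  have hd : ContinuousAt (fun t => (e (α t)).1 - (e (P t 0)).1) 0 :=
    (ContinuousAt.comp (g := fun v => (e v).1) (e.continuousAt hαs).fst hα.continuousAt).sub
      (ContinuousAt.comp (g := fun v => (e v).1) (f := fun t => P t 0) (x := 0)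
        (e.continuousAt hs).fst hP0)
  have ev2 : ∀ᶠ t in 𝓝 (0 : ℝ), S t ∧ α t ∈ e.source ∧ (e (α t)).2 = (e (P t 0)).2 ∧
      ‖(e (α t)).1 - (e (P t 0)).1‖ < ρ / 2 := by
    refine (Filter.Eventually.and hS ?_)
    refine (hα.continuousAt.eventually (e.open_source.mem_nhds hαs)).and (hαe.and ?_)
    exact hd.norm.eventually (Iio_mem_nhds (by simpa [h0] using half_pos hρ))
  obtain ⟨ε', hε', hεS⟩ := Metric.mem_nhds_iff.1 ev2
  obtain ⟨δ', hδ', hδQ⟩ := Metric.mem_nhds_iff.1 hQ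
  set ε := ε' / 2
  have hε : 0 < ε := half_pos hε'
  have hεε : ε < ε' := half_lt_self hε'
  -- Paths are changed on `[0, δ]` only; the bound `1 / 2` keeps the end point at time `1`
  -- untouched.
  set δ := min (δ' / 2) (1 / 2)
  have hδ : 0 < δ := lt_min (half_pos hδ') (by norm_num)
  have hδ1 : δ ≤ 1 / 2 := min_le_right _ _
  let δI : I := ⟨δ, hδ.le, hδ1.trans (by norm_num)⟩
  -- Clamping the parameter makes the construction continuous for all `t` without changing it near
  -- `0`.
  let κ : ℝ → ℝ := fun t => (projIcc (-ε) ε (by linarith) t : ℝ)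
  have hκc : Continuous κ := continuous_subtype_val.comp continuous_projIcc
  have hκ0 : κ 0 = 0 := by
    have : (0 : ℝ) ∈ Icc (-ε) ε := ⟨by linarith, hε.le⟩
    simp only [κ]
    rw [projIcc_of_mem _ this]
  have hκt : ∀ᶠ t in 𝓝 (0 : ℝ), κ t = t := by
    filter_upwards [Icc_mem_nhds (neg_lt_zero.2 hε) hε] with t ht
    simp only [κ]
    rw [projIcc_of_mem _ ht]
  have hκE : ∀ t, S (κ t) ∧ α (κ t) ∈ e.source ∧ (e (α (κ t))).2 = (e (P (κ t) 0)).2 ∧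
      ‖(e (α (κ t))).1 - (e (P (κ t) 0)).1‖ < ρ / 2 := fun t => by
    apply hεS
    rw [Metric.mem_ball, Real.dist_eq, sub_zero, abs_lt]
    have := (projIcc (-ε) ε (by linarith) t).2
    have h1 := this.1
    have h2 := this.2
    exact ⟨by simp only [κ]; linarith, by simp only [κ]; linarith⟩
  have hδE : ∀ s : I, Q (s ⊓ δI) := fun s => by
    apply hδQ
    rw [Metric.mem_ball, Subtype.dist_eq, Real.dist_eq]
    have h1 : ((s ⊓ δI : I) : ℝ) ≤ δ := inf_le_right (a := s) (b := δI)
    have h2 : δ ≤ δ' / 2 := min_le_left _ _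
    simp only [Icc.coe_zero, sub_zero]
    rw [abs_of_nonneg (s ⊓ δI : I).2.1]
    linarith
  have hQ0 : Q 0 := mem_of_mem_nhds hQ
  let d : ℝ → EuclideanSpace ℝ (Fin n) := fun t => (e (α (κ t))).1 - (e (P (κ t) 0)).1
  let r : I → ℝ := fun s => 1 - ((s ⊓ δI : I) : ℝ) / δ
  have hr : ∀ s, 0 ≤ r s ∧ r s ≤ 1 := fun s => by
    have h1 : ((s ⊓ δI : I) : ℝ) ≤ δ := inf_le_right (a := s) (b := δI)
    have h3 := (s ⊓ δI : I).2.1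
    simp only [r]
    exact ⟨sub_nonneg.2 ((div_le_one hδ).2 h1), by linarith [div_nonneg h3 hδ.le]⟩
  -- In the chart the path is shifted in the leaf directions by `d t` at time `0`, fading to nothing
  -- at time `δ`. The height is unchanged, so the new path stays leafwise.
  let q : ℝ → I → Model n := fun t s => e (P (κ t) (s ⊓ δI)) + (r s • d t, 0)
  have hsrc : ∀ t s, P (κ t) (s ⊓ δI) ∈ e.source := fun t s => (hSQ (hκE t).1 (hδE s)).1
  have hqt : ∀ t s, q t s ∈ e.target := fun t s => by
    apply hρt
    have h1 := (hSQ (hκE t).1 (hδE s)).2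
    rw [Metric.mem_ball, dist_eq_norm] at h1 ⊢
    have h2 : ‖((r s • d t, 0) : Model n)‖ < ρ / 2 := by
      rw [Prod.norm_mk, norm_zero, max_eq_left (norm_nonneg _), norm_smul, Real.norm_eq_abs,
        abs_of_nonneg (hr s).1]
      exact (mul_le_of_le_one_left (norm_nonneg _) (hr s).2).trans_lt (hκE t).2.2.2
    have h3 : q t s - e (P 0 0) = (e (P (κ t) (s ⊓ δI)) - e (P 0 0)) + (r s • d t, 0) := by
      simp only [q]; abel
    rw [h3]
    exact (norm_add_le _ _).trans_lt (by linarith)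
  have hPκ : Continuous fun x : ℝ × I => P (κ x.1) (x.2 ⊓ δI) :=
    hPc.comp ((hκc.comp continuous_fst).prodMk (continuous_snd.inf continuous_const))
  have hdc : Continuous d := by
    have h1 : Continuous fun t => e (α (κ t)) :=
      e.continuousOn.comp_continuous (hα.comp hκc) fun t => (hκE t).2.1
    have h2 : Continuous fun t => e (P (κ t) 0) :=
      e.continuousOn.comp_continuous (hPc.comp (hκc.prodMk continuous_const)) fun t =>
        (hSQ (hκE t).1 hQ0).1
    exact h1.fst.sub h2.fst
  have hrc : Continuous r :=
    continuous_const.sub ((continuous_subtype_val.comp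
      (continuous_id.inf continuous_const)).div_const _)
  have hqc : Continuous fun x : ℝ × I => q x.1 x.2 :=
    (e.continuousOn.comp_continuous hPκ fun x => hsrc x.1 x.2).add
      (((hrc.comp continuous_snd).smul (hdc.comp continuous_fst)).prodMk continuous_const)
  have hjoin : ∀ (t : ℝ) (s : I), (s : ℝ) = δ → e.symm (q t s) = P (κ t) s := fun t s hst => by
    have h1 : s = δI := Subtype.ext hst
    have h2 : r s = 0 := by simp [r, h1, δI, div_self hδ.ne']
    have h3 : s ⊓ δI = s := by rw [h1]; exact inf_idem _
    have h4 : q t s = e (P (κ t) s) := by simp [q, h2, h3]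
    rw [h4, e.left_inv]
    have := hsrc t s
    rwa [h3] at this
  refine ⟨fun t s => if (s : ℝ) ≤ δ then e.symm (q t s) else P (κ t) s, ?_, ?_, ?_, ?_, ?_⟩
  · refine Continuous.if_le ?_ ?_ (continuous_subtype_val.comp continuous_snd) continuous_const
      fun x hx => hjoin x.1 x.2 hx
    · exact e.symm.continuousOn.comp_continuous hqc fun x => hqt x.1 x.2
    · exact hPc.comp ((hκc.comp continuous_fst).prodMk continuous_snd)
  · intro t
    refine IsLeafwise.ite (hV.isLeafwise_symm_comp he
      (hqc.comp (Continuous.prodMk_right t)) (hqt t) ?_) (hPl (κ t)) (hjoin t)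
    intro s s'
    have h1 := ((hPl (κ t)).comp (g := fun s => s ⊓ δI)
      (continuous_id.inf continuous_const)).height_eq he isPreconnected_univ
      (fun s _ => hsrc t s) (mem_univ s) (mem_univ s')
    simpa [q] using h1
  · ext s
    have hd0 : d 0 = 0 := by simp [d, hκ0, h0]
    have h1 : q 0 s = e (P 0 (s ⊓ δI)) := by simp [q, hd0, hκ0]
    simp only [h1, hκ0]
    split_ifs with h
    · have h2 : s ⊓ δI = s := inf_eq_left.2 (show (s : ℝ) ≤ δ from h)
      have h3 := hsrc 0 s
      rw [hκ0] at h3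
      rw [e.left_inv h3, h2]
    · rfl
  · filter_upwards [hκt] with t ht
    have h1 : ((0 : I) : ℝ) ≤ δ := hδ.le
    rw [if_pos h1]
    have h2 : (0 : I) ⊓ δI = 0 := inf_eq_left.2 h1
    have h3 : r 0 = 1 := by
      simp only [r, h2]
      simp
    have hE := hκE t
    rw [ht] at hE
    have h4 : q t 0 = e (α t) := by
      refine Prod.ext ?_ ?_
      · simp [q, h3, d, ht]
      · simp [q, ht, hE.2.2.1]
    rw [h4, e.left_inv hE.2.1]
  · filter_upwards [hκt] with t ht
    have h1 : ¬ ((1 : I) : ℝ) ≤ δ := by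
      rw [Icc.coe_one]
      linarith
    rw [if_neg h1, ht]

end Correction

/-! ### Holonomy commutes with the flow; the topology of `H_B` -/

section HolonomyFlow

variable {n : ℕ} {V : Type*} [TopologicalSpace V] [ChartedSpace (Model n) V]
  {B : Type*} [TopologicalSpace B]

theorem LeafPath.ext_of_eq {ι : B → V} {c c' : LeafPath n ι} (hs : c.src = c'.src)
    (hr : c.rng = c'.rng) (hp : ∀ s, c.path s = c'.path s) : c = c' := by
  cases c
  cases c'
  dsimp only at hs hr
  subst hs hr
  congr
  ext s
  exact hp s

/-- The restriction of a family of leafwise paths to a smaller open set. -/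
def LeafPathFamily.restrict {ι : B → V} (F : LeafPathFamily n ι) (U : TopologicalSpace.Opens B) :
    LeafPathFamily n ι where
  dom := F.dom ⊓ U
  toPath z := F.toPath ⟨z, z.2.1⟩
  src_eq _ := F.src_eq _
  continuous_rng := F.continuous_rng.comp (continuous_subtype_val.subtype_mk _)
  continuous_path := F.continuous_path.comp
    (((continuous_subtype_val.comp continuous_fst).subtype_mk _).prodMk continuous_snd)

variable [ChartedSpace ℝ B]

/-- A complete transversal of a foliation with a transverse flow, with its induced flow. -/
structure IsTransverseSystem (n : ℕ) {V : Type*} [TopologicalSpace V] [ChartedSpace (Model n) V]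
    {B : Type*} [TopologicalSpace B] [ChartedSpace ℝ B] (φ : Flow ℝ V) (ι : B → V)
    (φb : Flow ℝ B) : Prop where
  foliated : IsFoliatedAtlas n V
  flow : IsTransverseFlow n φ
  transversal : IsCompleteTransversal n ι
  induced : IsInducedFlow n φ ι φb

variable {φ : Flow ℝ V} {ι : B → V} {φb : Flow ℝ B}

theorem IsTransverseSystem.exists_time [IsManifold 𝓘(ℝ, ℝ) ∞ B]
    (D : IsTransverseSystem n φ ι φb) (b : B) :
    ∃ τ : B → ℝ, ContMDiffAt 𝓘(ℝ, ℝ) 𝓘(ℝ, ℝ) ∞ τ b ∧ τ b = 0 ∧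
      (∀ᶠ z in 𝓝 b, φb (τ z) b = z) ∧ ∀ᶠ t in 𝓝 0, τ (φb t b) = t :=
  exists_flow_time D.induced.smooth (D.induced.generator_ne_zero D.flow b)

theorem tendsto_flow {X : Type*} [TopologicalSpace X] (ψ : Flow ℝ X) (x : X) :
    Filter.Tendsto (fun t => ψ t x) (𝓝 0) (𝓝 x) := by
  have := (ψ.cont'.comp (Continuous.prodMk_left x)).tendsto (0 : ℝ)
  simpa [Function.comp_def] using this

theorem continuous_orbit {X : Type*} [TopologicalSpace X] (ψ : Flow ℝ X) (x : X) :
    Continuous (fun t => ψ t x) := ψ.cont'.comp (Continuous.prodMk_left x)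

variable [IsManifold 𝓘(ℝ, Model n) ∞ V] [IsManifold 𝓘(ℝ, ℝ) ∞ B]

/-- Orbits are open in `B`, so local properties on `B` can be tested along the flow. -/
theorem IsTransverseSystem.nhds_eq (D : IsTransverseSystem n φ ι φb) (b : B) :
    𝓝 b = Filter.map (fun t => φb t b) (𝓝 0) := by
  obtain ⟨τ, hτ, hτ0, h1, h2⟩ := D.exists_time b
  refine le_antisymm ?_ (tendsto_flow φb b)
  have ht : Filter.Tendsto τ (𝓝 b) (𝓝 0) := hτ0 ▸ hτ.continuousAt.tendsto
  intro S hS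
  filter_upwards [ht.eventually hS, h1] with z hz hz1
  rwa [← hz1]

/-- On a small piece of the transversal each plaque has at most one point. -/
theorem IsTransverseSystem.eventually_eq_of_height_eq (D : IsTransverseSystem n φ ι φb) {b : B}
    {T : Type*} {l : Filter T} {β β' : T → B} (hβ : Filter.Tendsto β l (𝓝 b))
    (hβ' : Filter.Tendsto β' l (𝓝 b)) {e : OpenPartialHomeomorph V (Model n)}
    (he : e ∈ atlas (Model n) V) (hb : ι b ∈ e.source)
    (h : ∀ᶠ t in l, (e (ι (β t))).2 = (e (ι (β' t))).2) : ∀ᶠ t in l, β t = β' t := by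
  obtain ⟨τ, hτ, hτ0, h1, h2⟩ := D.exists_time b
  set e' := chartAt (Model n) (ι b)
  have he' : e' ∈ atlas (Model n) V := chart_mem_atlas _ _
  have hb' : ι b ∈ e'.source := mem_chart_source _ _
  have hιc := D.transversal.smooth.continuous
  have h' := D.foliated.height_eq_transfer he he' hb hb' (hιc.continuousAt.tendsto.comp hβ)
    (hιc.continuousAt.tendsto.comp hβ') h
  have horb : ContMDiff 𝓘(ℝ, ℝ) 𝓘(ℝ, ℝ) ∞ (fun t => φb t b) :=
    D.induced.smooth.comp (contMDiff_id.prodMk contMDiff_const)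
  -- By transversality the height along the orbit has nonzero derivative at time `0`, so it is
  -- injective for small times.
  let u : ℝ → ℝ := fun t => (e' (ι (φb t b))).2
  have hu : ContDiffAt ℝ ∞ u 0 :=
    (ContMDiffAt.comp (g := fun w => (e' w).2) (f := fun t => ι (φb t b)) (0 : ℝ)
      (contMDiffAt_height he' (by simpa using hb'))
      (D.transversal.smooth.comp horb).contMDiffAt).contDiffAt
  have hd := D.induced.hasDerivAt_height D.foliated D.transversal he' hb'
  have hne : differential (E := Model n) (fun w => (e' w).2) (ι b) (generator φ (ι b)) ≠ 0 :=
    fun h0 => D.flow.transverse (ι b) h0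
  have hst : HasStrictDerivAt u _ 0 := hu.hasStrictDerivAt' hd (by simp)
  have hl := (hst.hasStrictFDerivAt_equiv hne).eventually_left_inverse
  have ht : Filter.Tendsto τ (𝓝 b) (𝓝 0) := hτ0 ▸ hτ.continuousAt.tendsto
  have key : ∀ᶠ z in 𝓝 b, _ := (ht.eventually hl).and h1
  filter_upwards [h', hβ.eventually key, hβ'.eventually key] with t e1 e2 e3
  have : u (τ (β t)) = u (τ (β' t)) := by
    simp only [u, e2.2, e3.2]
    exact e1
  rw [← e2.2, ← e3.2, ← e2.1, ← e3.1, this]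

/-- Holonomy along a leafwise path commutes with the induced flow. -/
theorem IsTransverseSystem.holonomy_equivariant (D : IsTransverseSystem n φ ι φb)
    (c : LeafPath n ι) {T : Type*} {l : Filter T} {P : T → I → V} {β : T → B} {θ : T → ℝ}
    (hθ : Filter.Tendsto θ l (𝓝 0)) (hβ : Filter.Tendsto β l (𝓝 c.rng))
    (hP : ∀ s, Filter.Tendsto (fun x : T × I => P x.1 x.2) (l ×ˢ 𝓝 s) (𝓝 (c.path s)))
    (hl : ∀ᶠ t in l, IsLeafwise n (P t)) (h0 : ∀ᶠ t in l, P t 0 = ι (φb (θ t) c.src))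
    (h1 : ∀ᶠ t in l, P t 1 = ι (β t)) : ∀ᶠ t in l, β t = φb (θ t) c.rng := by
  have hP' : ∀ s, Filter.Tendsto (fun x : T × I => φ (θ x.1) (c.path x.2)) (l ×ˢ 𝓝 s)
      (𝓝 (c.path s)) := fun s => by
    have e1 : Filter.Tendsto (fun x : T × I => (θ x.1, c.path x.2)) (l ×ˢ 𝓝 s)
        (𝓝 (0, c.path s)) := by
      rw [nhds_prod_eq]
      exact (hθ.comp Filter.tendsto_fst).prodMk
        (c.path.continuous.continuousAt.tendsto.comp Filter.tendsto_snd)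
    have e2 : Filter.Tendsto (fun x : ℝ × V => φ x.1 x.2) (𝓝 (0, c.path s)) (𝓝 (c.path s)) := by
      have := φ.cont'.tendsto (0, c.path s)
      simpa only [Function.uncurry_def, φ.map_zero_apply] using this
    exact e2.comp e1
  set e := chartAt (Model n) (ι c.src)
  set e' := chartAt (Model n) (ι c.rng)
  have he' : e' ∈ atlas (Model n) V := chart_mem_atlas _ _
  -- `P` is compared with the translates of `c` by the ambient flow. The two families start on the
  -- same plaques, hence end on the same plaques, and a small transversal meets each of these at
  -- most once.
  have h2 := D.foliated.transport c.path.continuous hP hP' hl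
    (Filter.Eventually.of_forall fun t => D.flow.map_leafwise (θ t) _ c.leafwise)
    ⟨e, chart_mem_atlas _ _, by rw [c.path.source]; exact mem_chart_source _ _, by
      filter_upwards [h0, hθ.eventually (D.induced.eventually_height_eq D.foliated D.flow
        D.transversal c.src)] with t e1 e2
      rw [e1, c.path.source]
      exact e2⟩ he' (by rw [c.path.target]; exact mem_chart_source _ _)
  refine D.eventually_eq_of_height_eq hβ ((tendsto_flow φb c.rng).comp hθ) he'
    (mem_chart_source _ _) ?_
  filter_upwards [h1, h2, hθ.eventually (D.induced.eventually_height_eq D.foliated D.flow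
        D.transversal c.rng)] with t e1 e2 e3
  rw [← e1, e2, c.path.target]
  exact e3.symm

theorem IsTransverseSystem.family_equivariant (D : IsTransverseSystem n φ ι φb)
    (F : LeafPathFamily n ι) (z₀ : F.dom) {τ : B → ℝ} (hτ : ContinuousAt τ (z₀ : B))
    (hτ0 : τ z₀ = 0) (h1 : ∀ᶠ z in 𝓝 (z₀ : B), φb (τ z) z₀ = z) :
    ∀ᶠ z : F.dom in 𝓝 z₀, (F.toPath z).rng = φb (τ z) (F.toPath z₀).rng := by
  have hv : Filter.Tendsto (Subtype.val : F.dom → B) (𝓝 z₀) (𝓝 (z₀ : B)) :=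
    continuous_subtype_val.continuousAt
  refine D.holonomy_equivariant (F.toPath z₀) (P := fun z => (F.toPath z).path)
    (β := fun z => (F.toPath z).rng) (θ := fun z : F.dom => τ z) ?_ ?_ ?_ ?_ ?_ ?_
  · have := hτ.tendsto.comp hv
    rwa [hτ0] at this
  · exact F.continuous_rng.continuousAt
  · intro s
    rw [← nhds_prod_eq]
    exact F.continuous_path.continuousAt (x := (z₀, s))
  · exact Filter.Eventually.of_forall fun z => (F.toPath z).leafwise
  · filter_upwards [hv.eventually h1] with z hz
    rw [Path.source, F.src_eq, F.src_eq, hz]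
  · exact Filter.Eventually.of_forall fun z => (F.toPath z).path.target

theorem IsTransverseSystem.family_rng_flow (D : IsTransverseSystem n φ ι φb)
    (F : LeafPathFamily n ι) (z₀ : F.dom) :
    ∀ᶠ t in 𝓝 (0 : ℝ), ∃ h : φb t z₀ ∈ F.dom,
      (F.toPath ⟨φb t z₀, h⟩).rng = φb t (F.toPath z₀).rng := by
  obtain ⟨τ, hτ, hτ0, h1, h2⟩ := D.exists_time (z₀ : B)
  have h3 := D.family_equivariant F z₀ hτ.continuousAt hτ0 h1
  rw [nhds_subtype_eq_comap, Filter.eventually_comap] at h3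
  filter_upwards [(tendsto_flow φb (z₀ : B)).eventually h3, h2,
    (tendsto_flow φb (z₀ : B)).eventually (F.dom.isOpen.mem_nhds z₀.2)] with t e1 e2 e3
  refine ⟨e3, ?_⟩
  rw [e1 ⟨_, e3⟩ rfl, e2]

/-- The ambient flow carries `c` to nearby leaves, and both ends of the translates are then moved
within plaques onto the transversal. The member of the family at `z` is the translate by the time `τ
z`. -/
theorem IsTransverseSystem.exists_family (D : IsTransverseSystem n φ ι φb) (c : LeafPath n ι) :
    ∃ (F : LeafPathFamily n ι) (hc : c.src ∈ F.dom), F.toPath ⟨c.src, hc⟩ = c := by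
  have hιc := D.transversal.smooth.continuous
  have hα : ∀ b : B, Continuous fun t => ι (φb t b) := fun b => hιc.comp (continuous_orbit φb b)
  obtain ⟨P₁, hc₁, hl₁, h01, hs₁, ht₁⟩ := D.foliated.exists_correction
    (P := fun t s => φ t (c.path s)) (α := fun t => ι (φb t c.src))
    (φ.cont'.comp (continuous_fst.prodMk (c.path.continuous.comp continuous_snd)))
    (fun t => D.flow.map_leafwise t _ c.leafwise) (hα c.src) (by simp)
    (e := chartAt (Model n) (ι c.src)) (chart_mem_atlas _ _) (by simp)
    (by simpa using D.induced.eventually_height_eq D.foliated D.flow D.transversal c.src)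
  -- Reversing the paths turns the end into the start, so the same correction applies. `P₂` runs
  -- backwards and is reversed again in the family.
  obtain ⟨P₂, hc₂, hl₂, h02, hs₂, ht₂⟩ := D.foliated.exists_correction
    (P := fun t s => P₁ t (unitInterval.symm s)) (α := fun t => ι (φb t c.rng))
    (hc₁.comp (continuous_fst.prodMk (unitInterval.continuous_symm.comp continuous_snd)))
    (fun t => (hl₁ t).comp unitInterval.continuous_symm) (hα c.rng) (by simp [h01])
    (e := chartAt (Model n) (ι c.rng)) (chart_mem_atlas _ _) (by simp [h01])
    (by
      filter_upwards [ht₁, D.induced.eventually_height_eq D.foliated D.flow D.transversal c.rng]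
        with t e1 e2
      rw [e2, unitInterval.symm_zero, e1, c.path.target])
  obtain ⟨τ, hτ, hτ0, h1, h2⟩ := D.exists_time c.src
  have hτt : Filter.Tendsto τ (𝓝 c.src) (𝓝 0) := hτ0 ▸ hτ.continuousAt.tendsto
  have hev : ∀ᶠ z in 𝓝 c.src, ContinuousAt τ z ∧ P₂ (τ z) 1 = ι z ∧
      P₂ (τ z) 0 = ι (φb (τ z) c.rng) := by
    -- Smoothness of finite order at a point spreads to a neighbourhood; this makes `τ` continuous
    -- on an open set.
    have e1 : ∀ᶠ z in 𝓝 c.src, ContMDiffAt 𝓘(ℝ, ℝ) 𝓘(ℝ, ℝ) 1 τ z :=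
      (contMDiffAt_iff_contMDiffAt_nhds (by simp)).1
        (hτ.of_le (by exact mod_cast (le_top : (1 : ℕ∞) ≤ ⊤)))
    filter_upwards [e1, h1, hτt.eventually hs₁, hτt.eventually ht₂, hτt.eventually hs₂]
      with z f1 f2 f3 f4 f5
    refine ⟨f1.continuousAt, ?_, f5⟩
    rw [f4, unitInterval.symm_one, f3, f2]
  obtain ⟨N, hN, hNo, hcN⟩ := mem_nhds_iff.1 hev
  have hτc : Continuous fun z : N => τ z :=
    continuous_iff_continuousAt.2 fun z => (hN z.2).1.comp continuous_subtype_val.continuousAt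
  let F : LeafPathFamily n ι :=
    { dom := ⟨N, hNo⟩
      toPath := fun z =>
        { src := z
          rng := φb (τ z) c.rng
          path :=
            { toFun := fun s => P₂ (τ z) (unitInterval.symm s)
              continuous_toFun := hc₂.comp
                (continuous_const.prodMk unitInterval.continuous_symm)
              source' := by rw [unitInterval.symm_zero]; exact (hN z.2).2.1
              target' := by rw [unitInterval.symm_one]; exact (hN z.2).2.2 }
          leafwise := (hl₂ (τ z)).comp unitInterval.continuous_symm }
      src_eq := fun z => rfl
      continuous_rng := (continuous_orbit φb c.rng).comp hτc
      continuous_path := hc₂.comp ((hτc.comp continuous_fst).prodMk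
        (unitInterval.continuous_symm.comp continuous_snd)) }
  refine ⟨F, hcN, LeafPath.ext_of_eq rfl ?_ fun s => ?_⟩
  · change φb (τ c.src) c.rng = c.rng
    rw [hτ0, φb.map_zero_apply]
  · change P₂ (τ c.src) (unitInterval.symm s) = c.path s
    rw [hτ0, h02]
    simp [h01]

/-- The holonomy germs of both paths are expressed by the flow and the common end points alone. A
map that represents one germ therefore represents the other on a smaller domain. -/
theorem IsTransverseSystem.holonomy_subset (D : IsTransverseSystem n φ ι φb) {c c' : LeafPath n ι}
    (hs : c.src = c'.src) (hr : c.rng = c'.rng) : c.holonomy ⊆ c'.holonomy := by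
  rintro h ⟨F, hF, hFc, hh⟩
  obtain ⟨F', hF', hFc'⟩ := D.exists_family c'
  obtain ⟨τ, hτ, hτ0, h1, -⟩ := D.exists_time c.src
  have e1 := D.family_equivariant F ⟨c.src, hF⟩ hτ.continuousAt hτ0 h1
  have e2 := D.family_equivariant F' ⟨c.src, hs ▸ hF'⟩ hτ.continuousAt hτ0 h1
  have hFc'' : F'.toPath ⟨c.src, hs ▸ hF'⟩ = c' := by
    refine Eq.trans ?_ hFc'
    congr 2
  rw [nhds_subtype_eq_comap, Filter.eventually_comap] at e1 e2
  obtain ⟨N, hN, hNo, hcN⟩ :=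
    mem_nhds_iff.1 ((e1.and e2).and (F.dom.isOpen.mem_nhds hF))
  refine ⟨F'.restrict ⟨N, hNo⟩, ⟨hF', hs ▸ hcN⟩, hFc', fun z => ?_⟩
  obtain ⟨⟨f1, f2⟩, f3⟩ := hN z.2.2
  change (F'.toPath ⟨z, z.2.1⟩).rng = h z
  rw [f2 ⟨z, z.2.1⟩ rfl, ← hh ⟨z, f3⟩, f1 ⟨z, f3⟩ rfl, hFc, hFc'', hr]

theorem IsTransverseSystem.toArrow_eq (D : IsTransverseSystem n φ ι φb) {c c' : LeafPath n ι}
    (hs : c.src = c'.src) (hr : c.rng = c'.rng) : c.toArrow = c'.toArrow :=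
  Quotient.sound (Prod.ext hs (Prod.ext hr
    ((D.holonomy_subset hs hr).antisymm (D.holonomy_subset hs.symm hr.symm))))

/-- An arrow of the holonomy groupoid is determined by its source and its range. -/
theorem IsTransverseSystem.arrow_ext (D : IsTransverseSystem n φ ι φb) {γ γ' : Arrow n ι}
    (hs : γ.src = γ'.src) (hr : γ.rng = γ'.rng) : γ = γ' := by
  induction γ using Quotient.inductionOn
  induction γ' using Quotient.inductionOn
  exact D.toArrow_eq hs hr

theorem exists_toArrow_eq (γ : Arrow n ι) : ∃ c : LeafPath n ι, c.toArrow = γ :=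
  Quotient.exists_rep γ

theorem exists_arrow_iff {b b' : B} :
    (∃ γ : Arrow n ι, γ.src = b ∧ γ.rng = b') ↔ SameLeaf n (ι b) (ι b') := by
  constructor
  · rintro ⟨γ, rfl, rfl⟩
    obtain ⟨c, rfl⟩ := exists_toArrow_eq γ
    exact ⟨c.path, c.leafwise⟩
  · rintro ⟨c, hc⟩
    exact ⟨LeafPath.toArrow ⟨b, b', c, hc⟩, rfl, rfl⟩

theorem Arrow.sameLeaf (γ : Arrow n ι) : SameLeaf n (ι γ.src) (ι γ.rng) :=
  exists_arrow_iff.1 ⟨γ, rfl, rfl⟩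

/-- For small `t` the two points lie on one plaque: correcting the start of the constant paths at `φ
t (ι b)` yields leafwise paths between them. -/
theorem IsTransverseSystem.eventually_sameLeaf (D : IsTransverseSystem n φ ι φb) (b : B) :
    ∀ᶠ t in 𝓝 (0 : ℝ), SameLeaf n (ι (φb t b)) (φ t (ι b)) := by
  obtain ⟨P, hc, hl, h0, hs, ht⟩ := D.foliated.exists_correction
    (P := fun t _ => φ t (ι b)) (α := fun t => ι (φb t b))
    (φ.cont'.comp (continuous_fst.prodMk continuous_const))
    (fun t => isLeafwise_const _)
    (D.transversal.smooth.continuous.comp (continuous_orbit φb b)) (by simp)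
    (e := chartAt (Model n) (ι b)) (chart_mem_atlas _ _) (by simp)
    (D.induced.eventually_height_eq D.foliated D.flow D.transversal b)
  filter_upwards [hs, ht] with t e1 e2
  exact ⟨⟨⟨P t, (hl t).1⟩, e1, e2⟩, hl t⟩

/-- The statement is locally constant in `t`, by the case of small times at the point `φb x b` and
because the flow preserves the leaf relation. It holds at `0`, and `ℝ` is connected. -/
theorem IsTransverseSystem.sameLeaf_flow (D : IsTransverseSystem n φ ι φb) (b : B) (t : ℝ) :
    SameLeaf n (ι (φb t b)) (φ t (ι b)) := by
  let A : ℝ → Prop := fun t => SameLeaf n (ι (φb t b)) (φ t (ι b))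
  have key : A 0 ↔ A t := by
    refine isPreconnected_univ.induction₂ (fun x y => A x ↔ A y) (fun x _ => ?_)
      (fun _ _ _ _ _ _ h h' => h.trans h') (fun _ _ _ _ h => h.symm) (mem_univ _) (mem_univ _)
    rw [nhdsWithin_univ]
    have h1 : Filter.Tendsto (fun y : ℝ => y - x) (𝓝 x) (𝓝 0) := by
      have : Continuous fun y : ℝ => y - x := by fun_prop
      simpa using this.tendsto x
    filter_upwards [h1.eventually (D.eventually_sameLeaf (φb x b))] with y hy
    rw [← φb.map_add, sub_add_cancel] at hy
    have h2 : SameLeaf n (φ (y - x) (ι (φb x b))) (φ (y - x) (φ x (ι b))) ↔ A x :=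
      D.flow.sameLeaf_iff _
    rw [← φ.map_add, sub_add_cancel] at h2
    rw [← h2]
    exact ⟨fun h => hy.trans h, fun h => hy.symm.trans h⟩
  refine key.1 ?_
  simp only [A, φb.map_zero_apply, φ.map_zero_apply]
  exact SameLeaf.refl _

theorem IsTransverseSystem.exists_arrow_flow (D : IsTransverseSystem n φ ι φb) (t : ℝ)
    (γ : Arrow n ι) : ∃ δ : Arrow n ι, δ.src = φb t γ.src ∧ δ.rng = φb t γ.rng :=
  exists_arrow_iff.2 (((D.sameLeaf_flow _ t).trans (D.flow.sameLeaf t γ.sameLeaf)).trans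
    (D.sameLeaf_flow _ t).symm)

/-- The arrow obtained from `γ` by moving source and range along the flow. -/
noncomputable def IsTransverseSystem.move (D : IsTransverseSystem n φ ι φb) (t : ℝ)
    (γ : Arrow n ι) : Arrow n ι := (D.exists_arrow_flow t γ).choose

theorem IsTransverseSystem.src_move (D : IsTransverseSystem n φ ι φb) (t : ℝ) (γ : Arrow n ι) :
    (D.move t γ).src = φb t γ.src := (D.exists_arrow_flow t γ).choose_spec.1

theorem IsTransverseSystem.rng_move (D : IsTransverseSystem n φ ι φb) (t : ℝ) (γ : Arrow n ι) :
    (D.move t γ).rng = φb t γ.rng := (D.exists_arrow_flow t γ).choose_spec.2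

theorem IsTransverseSystem.move_zero (D : IsTransverseSystem n φ ι φb) (γ : Arrow n ι) :
    D.move 0 γ = γ :=
  D.arrow_ext (by rw [D.src_move, φb.map_zero_apply]) (by rw [D.rng_move, φb.map_zero_apply])

theorem IsTransverseSystem.move_add (D : IsTransverseSystem n φ ι φb) (s t : ℝ) (γ : Arrow n ι) :
    D.move (s + t) γ = D.move s (D.move t γ) :=
  D.arrow_ext (by rw [D.src_move, D.src_move, D.src_move, φb.map_add])
    (by rw [D.rng_move, D.rng_move, D.rng_move, φb.map_add])

theorem IsTransverseSystem.eventually_move_eq (D : IsTransverseSystem n φ ι φb)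
    (F : LeafPathFamily n ι) (z₀ : F.dom) :
    ∀ᶠ t in 𝓝 (0 : ℝ), ∃ h : φb t z₀ ∈ F.dom,
      (F.toPath ⟨φb t z₀, h⟩).toArrow = D.move t (F.toPath z₀).toArrow := by
  filter_upwards [D.family_rng_flow F z₀] with t ⟨h, ht⟩
  refine ⟨h, D.arrow_ext ?_ ?_⟩
  · rw [D.src_move]
    change (F.toPath ⟨φb t z₀, h⟩).src = φb t (F.toPath z₀).src
    rw [F.src_eq, F.src_eq]
  · rw [D.rng_move]
    exact ht

/-- Near each of its members a family of paths consists, as classes, of translates of that member by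
the flow. So the basic open sets are open in this sense, and conversely a family through `γ` can be
restricted until it lies in `U`. -/
theorem IsTransverseSystem.isOpen_arrow_iff (D : IsTransverseSystem n φ ι φb)
    {U : Set (Arrow n ι)} :
    IsOpen U ↔ ∀ γ ∈ U, ∀ᶠ t in 𝓝 (0 : ℝ), D.move t γ ∈ U := by
  constructor
  · intro hU
    change TopologicalSpace.GenerateOpen _ U at hU
    induction hU with
    | basic S hS =>
      obtain ⟨F, rfl⟩ := hS
      rintro _ ⟨z, rfl⟩
      filter_upwards [D.eventually_move_eq F z] with t ⟨h, ht⟩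
      exact ⟨_, ht⟩
    | univ => simp
    | inter s t _ _ hs ht =>
      exact fun γ hγ => (hs γ hγ.1).and (ht γ hγ.2)
    | sUnion S _ hS =>
      rintro γ ⟨s, hs, hγ⟩
      filter_upwards [hS s hs γ hγ] with t ht
      exact ⟨s, hs, ht⟩
  · intro hU
    refine isOpen_iff_forall_mem_open.2 fun γ hγ => ?_
    obtain ⟨c, rfl⟩ := exists_toArrow_eq γ
    obtain ⟨F, hF, hFc⟩ := D.exists_family c
    obtain ⟨τ, hτ, hτ0, h1, -⟩ := D.exists_time c.src
    have hτt : Filter.Tendsto τ (𝓝 c.src) (𝓝 0) := hτ0 ▸ hτ.continuousAt.tendsto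
    have e1 := D.family_equivariant F ⟨c.src, hF⟩ hτ.continuousAt hτ0 h1
    rw [nhds_subtype_eq_comap, Filter.eventually_comap] at e1
    obtain ⟨N, hN, hNo, hcN⟩ := mem_nhds_iff.1 ((e1.and h1).and (hτt.eventually (hU _ hγ)))
    refine ⟨range fun z => ((F.restrict ⟨N, hNo⟩).toPath z).toArrow, ?_,
      TopologicalSpace.isOpen_generateFrom_of_mem ⟨_, rfl⟩, ⟨⟨c.src, hF, hcN⟩, ?_⟩⟩
    · rintro _ ⟨z, rfl⟩
      obtain ⟨⟨f1, f2⟩, f3⟩ := hN z.2.2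
      suffices h : ((F.restrict ⟨N, hNo⟩).toPath z).toArrow = D.move (τ z) c.toArrow by
        exact Set.mem_of_eq_of_mem h f3
      refine D.arrow_ext ?_ ?_
      · rw [D.src_move]
        change (F.toPath ⟨z, z.2.1⟩).src = φb (τ z) c.src
        rw [F.src_eq, f2]
      · rw [D.rng_move]
        change (F.toPath ⟨z, z.2.1⟩).rng = φb (τ z) c.rng
        rw [f1 ⟨z, z.2.1⟩ rfl, hFc]
    · change (F.toPath ⟨c.src, hF⟩).toArrow = c.toArrow
      rw [hFc]

theorem IsTransverseSystem.nhds_arrow (D : IsTransverseSystem n φ ι φb) (γ : Arrow n ι) :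
    𝓝 γ = Filter.map (fun t => D.move t γ) (𝓝 0) := by
  apply le_antisymm
  · intro S hS
    obtain ⟨W, hW, hWo, h0⟩ := mem_nhds_iff.1 (Filter.mem_map.1 hS)
    refine mem_nhds_iff.2 ⟨(fun t => D.move t γ) '' W, ?_, ?_, ⟨0, h0, D.move_zero γ⟩⟩
    · rintro _ ⟨t, ht, rfl⟩
      exact hW ht
    · rw [D.isOpen_arrow_iff]
      rintro _ ⟨t, ht, rfl⟩
      have h1 : Filter.Tendsto (fun s : ℝ => s + t) (𝓝 0) (𝓝 t) := by
        have : Continuous fun s : ℝ => s + t := by fun_prop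
        simpa using this.tendsto 0
      filter_upwards [h1.eventually (hWo.mem_nhds ht)] with s hs
      exact ⟨s + t, hs, D.move_add s t γ⟩
  · intro S hS
    obtain ⟨U, hU, hUo, h0⟩ := mem_nhds_iff.1 hS
    filter_upwards [D.isOpen_arrow_iff.1 hUo γ h0] with t ht using hU ht

theorem IsTransverseSystem.continuous_move (D : IsTransverseSystem n φ ι φb) :
    Continuous (Function.uncurry D.move) := by
  refine continuous_iff_continuousAt.2 fun ⟨t, γ⟩ => ?_
  -- Arrows near `γ` are `D.move p.2 γ`. Moving one of them by `p.1` is the same as moving `D.move t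
  -- γ` by `p.1 + p.2 - t`.
  have h1 : Filter.Tendsto (fun p : ℝ × ℝ => p.1 + p.2 - t) (𝓝 t ×ˢ 𝓝 0) (𝓝 0) := by
    have : Continuous fun p : ℝ × ℝ => p.1 + p.2 - t := by fun_prop
    simpa [nhds_prod_eq] using this.tendsto (t, 0)
  rw [ContinuousAt, nhds_prod_eq, D.nhds_arrow γ, ← Filter.map_id (f := 𝓝 t),
    Filter.prod_map_map_eq, Filter.tendsto_map'_iff]
  change Filter.Tendsto _ _ (𝓝 (D.move t γ))
  rw [D.nhds_arrow (D.move t γ)]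
  refine (Filter.tendsto_map.comp h1).congr fun p => ?_
  simp only [Function.comp_apply, id, Function.uncurry]
  rw [← D.move_add, ← D.move_add, sub_add_cancel]

end HolonomyFlow

/-! ### The abstract setting: relations with a lifted flow -/

/-- A flow with open orbits and without small periods. -/
structure IsRotationFlow {B : Type*} [TopologicalSpace B] (φ : Flow ℝ B) : Prop where
  nhds_eq : ∀ b, 𝓝 b = Filter.map (fun t => φ t b) (𝓝 0)
  free : ∀ b, ∀ᶠ t in 𝓝 (0 : ℝ), φ t b = b → t = 0

/-- An equivalence relation on `B`, with its space of arrows `A`, and a lift of a flow on `B` to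
`A` whose orbits are open in `A`. -/
structure IsFlowRelation {A B : Type*} [TopologicalSpace A] [TopologicalSpace B] (φ : Flow ℝ B)
    (Ψ : Flow ℝ A) (s r : A → B) : Prop where
  rotation : IsRotationFlow φ
  nhds_arrow : ∀ γ, 𝓝 γ = Filter.map (fun t => Ψ t γ) (𝓝 0)
  src_flow : ∀ t γ, s (Ψ t γ) = φ t (s γ)
  rng_flow : ∀ t γ, r (Ψ t γ) = φ t (r γ)
  ext : ∀ γ δ, s γ = s δ → r γ = r δ → γ = δ
  refl : ∀ b, ∃ γ, s γ = b ∧ r γ = b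
  symm : ∀ γ, ∃ δ, s δ = r γ ∧ r δ = s γ
  trans : ∀ γ δ, s γ = r δ → ∃ ε, s ε = s δ ∧ r ε = r γ
  countable : ∀ b, {γ | r γ = b}.Countable

/-! ### `H_B` as a flow relation; smoothness along orbits -/

section HolonomyRelation

variable {n : ℕ} {V : Type*} [TopologicalSpace V] [ChartedSpace (Model n) V]
  {B : Type*} [TopologicalSpace B] [ChartedSpace ℝ B]
  {φ : Flow ℝ V} {ι : B → V} {φb : Flow ℝ B}
  [IsManifold 𝓘(ℝ, Model n) ∞ V] [IsManifold 𝓘(ℝ, ℝ) ∞ B]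

/-- The lift of the induced flow to the holonomy groupoid. -/
noncomputable def IsTransverseSystem.arrowFlow (D : IsTransverseSystem n φ ι φb) :
    Flow ℝ (Arrow n ι) where
  toFun := D.move
  cont' := D.continuous_move
  map_add' := D.move_add
  map_zero' := D.move_zero

theorem IsTransverseSystem.src_arrowFlow (D : IsTransverseSystem n φ ι φb) (t : ℝ)
    (γ : Arrow n ι) : (D.arrowFlow t γ).src = φb t γ.src := D.src_move t γ

theorem IsTransverseSystem.rng_arrowFlow (D : IsTransverseSystem n φ ι φb) (t : ℝ)
    (γ : Arrow n ι) : (D.arrowFlow t γ).rng = φb t γ.rng := D.rng_move t γ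

/-- The orbit of `γ` is an admissible curve in the definition of `liftedFlow`, and the end points
leave no choice to any other curve. -/
theorem IsTransverseSystem.liftedFlow_eq (D : IsTransverseSystem n φ ι φb) (t : ℝ)
    (γ : Arrow n ι) : liftedFlow φb t γ = D.arrowFlow t γ := by
  have h : ∃ Γ : C(ℝ, Arrow n ι), Γ 0 = γ ∧
      ∀ u, (Γ u).src = φb u γ.src ∧ (Γ u).rng = φb u γ.rng :=
    ⟨⟨fun u => D.arrowFlow u γ, continuous_orbit _ γ⟩, D.arrowFlow.map_zero_apply γ,
      fun u => ⟨D.src_arrowFlow u γ, D.rng_arrowFlow u γ⟩⟩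
  rw [liftedFlow, dif_pos h]
  refine D.arrow_ext ?_ ?_
  · rw [(h.choose_spec.2 t).1, D.src_arrowFlow]
  · rw [(h.choose_spec.2 t).2, D.rng_arrowFlow]

theorem IsTransverseSystem.isComp_iff (D : IsTransverseSystem n φ ι φb) {γ δ ε : Arrow n ι} :
    IsComp γ δ ε ↔ γ.src = δ.rng ∧ ε.src = δ.src ∧ ε.rng = γ.rng := by
  constructor
  · rintro ⟨p, q, w, h, rfl, rfl, rfl, h1, h2, -⟩
    exact ⟨h.symm, h1, h2⟩
  · rintro ⟨h1, h2, h3⟩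
    obtain ⟨p, rfl⟩ := exists_toArrow_eq γ
    obtain ⟨q, rfl⟩ := exists_toArrow_eq δ
    have h : q.rng = p.src := h1.symm
    have hl : IsLeafwise n (p.path.cast (congrArg ι h) rfl) := p.leafwise
    refine ⟨p, q, ⟨q.src, p.rng, q.path.trans (p.path.cast (congrArg ι h) rfl),
      q.leafwise.trans hl⟩, h, rfl, rfl, D.arrow_ext h2.symm h3.symm, rfl, rfl, fun s => rfl⟩

/-- Leafwise paths from `ι b` to the transversal form a second countable space. Their end point is
locally constant, by equivariance of holonomy with flow time `0`, so it takes only countably many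
values. -/
theorem IsTransverseSystem.countable_leaf [CompactSpace V] [CompactSpace B]
    (D : IsTransverseSystem n φ ι φb) (b : B) : {b' : B | SameLeaf n (ι b) (ι b')}.Countable := by
  have : SecondCountableTopology V := ChartedSpace.secondCountable_of_sigmaCompact (Model n) V
  have : SecondCountableTopology B := ChartedSpace.secondCountable_of_sigmaCompact ℝ B
  let X := {x : C(I, V) × B // IsLeafwise n x.1 ∧ x.1 0 = ι b ∧ x.1 1 = ι x.2}
  have : SecondCountableTopology X := TopologicalSpace.Subtype.secondCountableTopology _
  let f : X → B := fun x => x.1.2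
  have hf : Continuous f := continuous_snd.comp continuous_subtype_val
  have hloc : ∀ x₀ : X, ∀ᶠ x in 𝓝 x₀, f x = f x₀ := by
    intro x₀
    let c : LeafPath n ι := ⟨b, x₀.1.2, ⟨x₀.1.1, x₀.2.2.1, x₀.2.2.2⟩, x₀.2.1⟩
    have := D.holonomy_equivariant c (l := 𝓝 x₀) (P := fun x s => x.1.1 s) (β := f)
      (θ := fun _ => 0) tendsto_const_nhds hf.continuousAt ?_ ?_ ?_ ?_
    · filter_upwards [this] with x hx
      rw [hx, φb.map_zero_apply]
    · intro s
      rw [← nhds_prod_eq]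
      have hc : Continuous fun x : X × I => x.1.1.1 x.2 :=
        ((continuous_fst.comp (continuous_subtype_val.comp continuous_fst)).eval continuous_snd)
      exact hc.tendsto (x₀, s)
    · exact Filter.Eventually.of_forall fun x => x.2.1
    · refine Filter.Eventually.of_forall fun x => ?_
      rw [φb.map_zero_apply]
      exact x.2.2.1
    · exact Filter.Eventually.of_forall fun x => x.2.2.2
  have hfo : ∀ a, IsOpen (f ⁻¹' {a}) := fun a => isOpen_iff_mem_nhds.2 fun x hx => by
    filter_upwards [hloc x] with y hy
    exact hy.trans hx
  have hd : (range f).PairwiseDisjoint fun a => f ⁻¹' {a} := fun a _ a' _ haa =>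
    (Set.disjoint_singleton.2 haa).preimage f
  have hcount := hd.countable_of_isOpen (fun a _ => hfo a) (by
    rintro _ ⟨x, rfl⟩
    exact ⟨x, rfl⟩)
  refine hcount.mono fun b' hb' => ?_
  obtain ⟨c, hc⟩ := hb'
  let x : X := ⟨(⟨c, c.continuous⟩, b'), hc, c.source, c.target⟩
  exact ⟨x, rfl⟩

theorem IsTransverseSystem.isRotationFlow (D : IsTransverseSystem n φ ι φb) :
    IsRotationFlow φb where
  nhds_eq := D.nhds_eq
  free b := by
    obtain ⟨τ, -, hτ0, -, h2⟩ := D.exists_time b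
    filter_upwards [h2] with t ht hb
    rw [← ht, hb, hτ0]

theorem IsTransverseSystem.isFlowRelation [CompactSpace V] [CompactSpace B]
    (D : IsTransverseSystem n φ ι φb) :
    IsFlowRelation φb D.arrowFlow (Arrow.src : Arrow n ι → B) Arrow.rng where
  rotation := D.isRotationFlow
  nhds_arrow := D.nhds_arrow
  src_flow := D.src_move
  rng_flow := D.rng_move
  ext _ _ := D.arrow_ext
  refl b := exists_arrow_iff.2 (SameLeaf.refl _)
  symm γ := exists_arrow_iff.2 γ.sameLeaf.symm
  trans γ δ h := exists_arrow_iff.2 (δ.sameLeaf.trans (h ▸ γ.sameLeaf))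
  countable b := by
    refine Set.MapsTo.countable_of_injOn (f := Arrow.src) (t := {b' | SameLeaf n (ι b) (ι b')})
      (fun γ hγ => ?_) (fun γ hγ δ hδ h => D.arrow_ext h (hγ.trans hδ.symm)) (D.countable_leaf b)
    have := γ.sameLeaf.symm
    rw [show γ.rng = b from hγ] at this
    exact this

/-- Étale charts from families and charts from orbits of the lifted flow differ by the time
coordinate on the transversal, which is smooth in both directions. -/
theorem IsTransverseSystem.smoothOnG_iff (D : IsTransverseSystem n φ ι φb)
    {f : CrossedProduct n ι → ℂ} :
    SmoothOnG n ι f ↔ ∀ γ, ContDiff ℝ ∞ fun p : ℝ × ℝ => f (D.arrowFlow p.1 γ, p.2) := by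
  constructor
  · intro hf γ
    rw [← contMDiff_iff_contDiff]
    rintro ⟨t₀, u₀⟩
    obtain ⟨c, hc⟩ := exists_toArrow_eq (D.arrowFlow t₀ γ)
    obtain ⟨F, hF, hFc⟩ := D.exists_family c
    classical
    -- Only times near `t₀` matter; the other branch is an arbitrary value.
    let z : ℝ → F.dom := fun t => if h : φb (t - t₀) c.src ∈ F.dom then ⟨_, h⟩ else ⟨c.src, hF⟩
    have hsub : Filter.Tendsto (fun t : ℝ => t - t₀) (𝓝 t₀) (𝓝 0) := by
      have : Continuous fun t : ℝ => t - t₀ := by fun_prop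
      simpa using this.tendsto t₀
    have hev := D.eventually_move_eq F ⟨c.src, hF⟩
    have hz : ∀ᶠ t in 𝓝 t₀, (z t : B) = φb (t - t₀) c.src ∧
        (F.toPath (z t)).toArrow = D.arrowFlow t γ := by
      filter_upwards [hsub.eventually hev] with t ⟨h, ht⟩
      have hzt : z t = ⟨_, h⟩ := dif_pos h
      rw [hzt]
      refine ⟨rfl, ht.trans ?_⟩
      rw [hFc, hc]
      change D.move (t - t₀) (D.move t₀ γ) = D.move t γ
      rw [← D.move_add, sub_add_cancel]
    have hzs : ContMDiffAt 𝓘(ℝ, ℝ) 𝓘(ℝ, ℝ) ∞ z t₀ := by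
      rw [← ContMDiffAt.subtypeVal_comp_iff]
      have h1 : ContMDiff 𝓘(ℝ, ℝ) 𝓘(ℝ, ℝ) ∞ fun t : ℝ => φb (t - t₀) c.src :=
        D.induced.smooth.comp
          ((contDiff_id.sub contDiff_const).contMDiff.prodMk contMDiff_const)
      exact h1.contMDiffAt.congr_of_eventuallyEq (hz.mono fun t ht => ht.1)
    have h2 : ContMDiffAt 𝓘(ℝ, ℝ × ℝ) (𝓘(ℝ, ℝ).prod 𝓘(ℝ, ℝ)) ∞
        (fun p : ℝ × ℝ => (z p.1, p.2)) (t₀, u₀) :=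
      (ContMDiffAt.comp (g := z) (f := Prod.fst) (t₀, u₀) hzs
        (contDiff_fst (𝕜 := ℝ)).contMDiff.contMDiffAt).prodMk
        (contDiff_snd (𝕜 := ℝ)).contMDiff.contMDiffAt
    have h3 := ContMDiffAt.comp (t₀, u₀) (hf F).contMDiffAt h2
    refine h3.congr_of_eventuallyEq ?_
    have h4 : Filter.Tendsto (Prod.fst : ℝ × ℝ → ℝ) (𝓝 (t₀, u₀)) (𝓝 t₀) := continuousAt_fst
    filter_upwards [h4.eventually hz] with p hp
    simp only [Function.comp_apply]
    rw [hp.2]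
  · rintro hf F ⟨z₀, u₀⟩
    obtain ⟨τ, hτ, hτ0, h1, -⟩ := D.exists_time (z₀ : B)
    have h2 := D.family_equivariant F z₀ hτ.continuousAt hτ0 h1
    have h3 : ContMDiffAt (𝓘(ℝ, ℝ).prod 𝓘(ℝ, ℝ)) 𝓘(ℝ, ℝ × ℝ) ∞
        (fun p : F.dom × ℝ => (τ p.1, p.2)) (z₀, u₀) := by
      have h4 : ContMDiffAt (𝓘(ℝ, ℝ).prod 𝓘(ℝ, ℝ)) 𝓘(ℝ, ℝ) ∞
          (fun p : F.dom × ℝ => τ p.1) (z₀, u₀) :=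
        ContMDiffAt.comp (g := fun z : F.dom => τ z) (f := Prod.fst) (z₀, u₀)
          (contMDiffAt_subtype_iff.2 hτ) contMDiffAt_fst
      exact h4.prodMk_space contMDiffAt_snd
    have h5 := ContMDiffAt.comp (z₀, u₀) (hf (F.toPath z₀).toArrow).contMDiff.contMDiffAt h3
    refine h5.congr_of_eventuallyEq ?_
    have h6 : Filter.Tendsto (Prod.fst : F.dom × ℝ → F.dom) (𝓝 (z₀, u₀)) (𝓝 z₀) :=
      continuousAt_fst
    have h7 : Filter.Tendsto (fun p : F.dom × ℝ => (p.1 : B)) (𝓝 (z₀, u₀)) (𝓝 (z₀ : B)) :=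
      continuous_subtype_val.continuousAt.tendsto.comp h6
    filter_upwards [h6.eventually h2, h7.eventually h1] with p hp hp'
    simp only [Function.comp_apply]
    congr 2
    refine D.arrow_ext ?_ ?_
    · rw [D.src_arrowFlow]
      change (F.toPath p.1).src = φb (τ p.1) (F.toPath z₀).src
      rw [F.src_eq, F.src_eq, hp']
    · rw [D.rng_arrowFlow]
      exact hp

theorem IsTransverseSystem.contDiff_orbit (D : IsTransverseSystem n φ ι φb) {ξ : B → ℂ}
    (hξ : ContMDiff 𝓘(ℝ, ℝ) 𝓘(ℝ, ℂ) ∞ ξ) (b : B) : ContDiff ℝ ∞ fun t => ξ (φb t b) :=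
  (hξ.comp (D.induced.smooth.comp (contMDiff_id.prodMk contMDiff_const))).contDiff

theorem IsTransverseSystem.contMDiff_of_orbit (D : IsTransverseSystem n φ ι φb) {ξ : B → ℂ}
    (hξ : ∀ b, ContDiff ℝ ∞ fun t => ξ (φb t b)) : ContMDiff 𝓘(ℝ, ℝ) 𝓘(ℝ, ℂ) ∞ ξ := by
  intro b
  obtain ⟨τ, hτ, hτ0, h1, -⟩ := D.exists_time b
  refine (ContMDiffAt.comp b (hξ b).contMDiff.contMDiffAt hτ).congr_of_eventuallyEq ?_
  filter_upwards [h1] with z hz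
  simp only [Function.comp_apply]
  rw [hz]

theorem IsTransverseSystem.contMDiff_kernel (D : IsTransverseSystem n φ ι φb) {k : B × B → ℂ}
    (hk : ∀ b b', ContDiff ℝ ∞ fun p : ℝ × ℝ => k (φb p.1 b, φb p.2 b')) :
    ContMDiff (𝓘(ℝ, ℝ).prod 𝓘(ℝ, ℝ)) 𝓘(ℝ, ℂ) ∞ k := by
  rintro ⟨b, b'⟩
  obtain ⟨τ, hτ, hτ0, h1, -⟩ := D.exists_time b
  obtain ⟨τ', hτ', hτ0', h1', -⟩ := D.exists_time b'
  have h3 : ContMDiffAt (𝓘(ℝ, ℝ).prod 𝓘(ℝ, ℝ)) 𝓘(ℝ, ℝ × ℝ) ∞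
      (fun p : B × B => (τ p.1, τ' p.2)) (b, b') :=
    (ContMDiffAt.comp (g := τ) (f := Prod.fst) (b, b') hτ contMDiffAt_fst).prodMk_space
      (ContMDiffAt.comp (g := τ') (f := Prod.snd) (b, b') hτ' contMDiffAt_snd)
  refine (ContMDiffAt.comp (b, b') (hk b b').contMDiff.contMDiffAt h3).congr_of_eventuallyEq ?_
  have h6 : Filter.Tendsto (Prod.fst : B × B → B) (𝓝 (b, b')) (𝓝 b) := continuousAt_fst
  have h7 : Filter.Tendsto (Prod.snd : B × B → B) (𝓝 (b, b')) (𝓝 b') := continuousAt_snd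
  filter_upwards [h6.eventually h1, h7.eventually h1'] with p hp hp'
  simp only [Function.comp_apply]
  rw [hp, hp']

end HolonomyRelation

/-! ### Components, periods, coordinates and Lebesgue measure -/

section RotationFlow

variable {B : Type*} [TopologicalSpace B] {φ : Flow ℝ B}

theorem tendsto_add_right (t : ℝ) : Filter.Tendsto (fun s : ℝ => s + t) (𝓝 0) (𝓝 t) := by
  have : Continuous fun s : ℝ => s + t := by fun_prop
  simpa using this.tendsto 0

theorem isOpen_image_orbit {X : Type*} [TopologicalSpace X] {ψ : Flow ℝ X}
    (h : ∀ x, 𝓝 x = Filter.map (fun t => ψ t x) (𝓝 0)) (x : X) {W : Set ℝ} (hW : IsOpen W) :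
    IsOpen ((fun t => ψ t x) '' W) := by
  refine isOpen_iff_mem_nhds.2 ?_
  rintro _ ⟨t, ht, rfl⟩
  rw [h (ψ t x)]
  refine Filter.mem_map.2 ?_
  filter_upwards [(tendsto_add_right t).eventually (hW.mem_nhds ht)] with s hs
  exact ⟨s + t, hs, ψ.map_add s t x⟩

/-- An orbit is connected and open. Its complement is a union of orbits, so it is also closed. -/
theorem IsRotationFlow.connectedComponent_eq (h : IsRotationFlow φ) (b : B) :
    connectedComponent b = range fun t => φ t b := by
  apply Subset.antisymm
  · have ho : IsOpen (range fun t => φ t b) := by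
      rw [← image_univ]
      exact isOpen_image_orbit h.nhds_eq b isOpen_univ
    have hc : IsClosed (range fun t => φ t b) := by
      rw [← isOpen_compl_iff, isOpen_iff_mem_nhds]
      intro x hx
      rw [h.nhds_eq x]
      refine Filter.mem_map.2 (Filter.Eventually.of_forall fun t => ?_)
      rintro ⟨s, hs⟩
      refine hx ⟨-t + s, ?_⟩
      change φ s b = φ t x at hs
      change φ (-t + s) b = x
      rw [φ.map_add, hs, ← φ.map_add, neg_add_cancel, φ.map_zero_apply]
    exact IsClopen.connectedComponent_subset ⟨hc, ho⟩ ⟨0, φ.map_zero_apply b⟩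
  · exact (isPreconnected_range (continuous_orbit φ b)).subset_connectedComponent
      ⟨0, φ.map_zero_apply b⟩

theorem IsRotationFlow.coe_eq_coe (h : IsRotationFlow φ) {b b' : B} :
    (b : ConnectedComponents B) = b' ↔ ∃ t, φ t b' = b := by
  rw [ConnectedComponents.coe_eq_coe', h.connectedComponent_eq]
  rfl

theorem IsRotationFlow.coe_flow (h : IsRotationFlow φ) (t : ℝ) (b : B) :
    (φ t b : ConnectedComponents B) = b := h.coe_eq_coe.2 ⟨t, rfl⟩

theorem IsRotationFlow.finite_components [CompactSpace B] (h : IsRotationFlow φ) :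
    Finite (ConnectedComponents B) := by
  have : DiscreteTopology (ConnectedComponents B) := by
    rw [discreteTopology_iff_isOpen_singleton]
    intro C
    obtain ⟨b, rfl⟩ := ConnectedComponents.surjective_coe C
    rw [← ConnectedComponents.isQuotientMap_coe.isOpen_preimage]
    have : ((↑) : B → ConnectedComponents B) ⁻¹' {(b : ConnectedComponents B)} =
        (fun t => φ t b) '' univ := by
      ext x
      simp only [mem_preimage, mem_singleton_iff, image_univ]
      exact h.coe_eq_coe
    rw [this]
    exact isOpen_image_orbit h.nhds_eq b isOpen_univ
  exact finite_of_compact_of_discrete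

/-- The stabilizer of `b` is a subgroup of `ℝ` in which zero is isolated, hence cyclic. Compactness
of the orbit makes it nontrivial. -/
theorem IsRotationFlow.exists_period [CompactSpace B] (h : IsRotationFlow φ) (b : B) :
    ∃ p : ℝ, 0 < p ∧ ∀ t, φ t b = b ↔ ∃ m : ℤ, t = m * p := by
  let S : AddSubgroup ℝ :=
    { carrier := {t | φ t b = b}
      add_mem' := fun {s t} hs ht => by
        change φ (s + t) b = b
        rw [φ.map_add, ht, hs]
      zero_mem' := φ.map_zero_apply b
      neg_mem' := fun {t} ht => by
        change φ (-t) b = b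
        have ht' : φ t b = b := ht
        rw [← ht', ← φ.map_add, neg_add_cancel, φ.map_zero_apply, ht'] }
  have hS : ∀ t, t ∈ S ↔ φ t b = b := fun t => Iff.rfl
  obtain ⟨a, ha, hfree⟩ := Metric.mem_nhds_iff.1 (h.free b)
  obtain ⟨c, hc⟩ := AddSubgroup.cyclic_of_isolated_zero (H := S) ha (by
    rw [Set.disjoint_left]
    intro t ht ht'
    have := hfree (a := t) (by
      rw [Metric.mem_ball, Real.dist_eq, sub_zero, abs_of_pos ht'.1]
      exact ht'.2) ht
    exact ht'.1.ne' this)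
  have hc' : ∀ t, φ t b = b ↔ ∃ m : ℤ, t = m * c := fun t => by
    rw [← hS, hc, AddSubgroup.mem_closure_singleton]
    simp only [zsmul_eq_mul, eq_comm]
  -- Otherwise the orbit map is injective. One of the increasing open arcs of times `(-N, N)` covers
  -- the compact orbit, and so contains the point at time `N`, a contradiction.
  have hc0 : c ≠ 0 := by
    rintro rfl
    have hcomp : IsCompact (range fun t => φ t b) := by
      rw [← h.connectedComponent_eq]
      exact isClosed_connectedComponent.isCompact
    obtain ⟨N, hN⟩ := hcomp.elim_directed_cover (fun N : ℕ => (fun t => φ t b) '' Ioo (-(N : ℝ)) N)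
      (fun N => isOpen_image_orbit h.nhds_eq b isOpen_Ioo) (by
        rintro _ ⟨t, rfl⟩
        obtain ⟨N, hN⟩ := exists_nat_gt |t|
        exact mem_iUnion.2 ⟨N, t, abs_lt.1 hN, rfl⟩)
      (directed_of_isDirected_le fun i j hij => image_mono (Ioo_subset_Ioo
        (neg_le_neg (by exact_mod_cast hij)) (by exact_mod_cast hij)))
    obtain ⟨t, ht, hte⟩ := hN ⟨(N : ℝ), rfl⟩
    change φ t b = φ N b at hte
    have h1 : φ (-t + N) b = b := by
      rw [φ.map_add, ← hte, ← φ.map_add, neg_add_cancel, φ.map_zero_apply]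
    obtain ⟨m, hm⟩ := (hc' _).1 h1
    rw [mul_zero] at hm
    linarith [ht.2]
  refine ⟨|c|, abs_pos.2 hc0, fun t => (hc' t).trans ?_⟩
  rcases abs_choice c with hh | hh <;> rw [hh]
  constructor
  · rintro ⟨m, rfl⟩
    exact ⟨-m, by push_cast; ring⟩
  · rintro ⟨m, rfl⟩
    exact ⟨-m, by push_cast; ring⟩

theorem periodAt_eq {b : B} {p : ℝ} (hp : 0 < p) (h : ∀ t, φ t b = b ↔ ∃ m : ℤ, t = m * p) :
    periodAt φ b = p := by
  refine IsLeast.csInf_eq ⟨⟨hp, (h p).2 ⟨1, by simp⟩⟩, ?_⟩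
  rintro t ⟨ht, htb⟩
  obtain ⟨m, rfl⟩ := (h t).1 htb
  have h0 : (0 : ℝ) < m := pos_of_mul_pos_left ht hp.le
  have h1 : (1 : ℤ) ≤ m := by exact_mod_cast h0
  have h2 : (1 : ℝ) ≤ m := by exact_mod_cast h1
  nlinarith

theorem IsRotationFlow.periodAt_pos [CompactSpace B] (h : IsRotationFlow φ) (b : B) :
    0 < periodAt φ b := by
  obtain ⟨p, hp, hpb⟩ := h.exists_period b
  rwa [periodAt_eq hp hpb]

theorem IsRotationFlow.flow_eq_self_iff [CompactSpace B] (h : IsRotationFlow φ) (b : B) (t : ℝ) :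
    φ t b = b ↔ ∃ m : ℤ, t = m * periodAt φ b := by
  obtain ⟨p, hp, hpb⟩ := h.exists_period b
  rw [periodAt_eq hp hpb]
  exact hpb t

theorem flow_flow_eq_iff {X : Type*} [TopologicalSpace X] (ψ : Flow ℝ X) (s t : ℝ) (x y : X) :
    ψ s (ψ t x) = ψ s y ↔ ψ t x = y := by
  constructor
  · intro h
    have := congrArg (ψ (-s)) h
    rwa [← ψ.map_add, neg_add_cancel, ψ.map_zero_apply, ← ψ.map_add, neg_add_cancel,
      ψ.map_zero_apply] at this
  · rintro rfl
    rfl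

theorem flow_comm {X : Type*} [TopologicalSpace X] (ψ : Flow ℝ X) (s t : ℝ) (x : X) :
    ψ s (ψ t x) = ψ t (ψ s x) := by
  rw [← ψ.map_add, ← ψ.map_add, add_comm]

theorem flow_eq_flow_iff {X : Type*} [TopologicalSpace X] (ψ : Flow ℝ X) (s t : ℝ) (x : X) :
    ψ s x = ψ t x ↔ ψ (s - t) x = x := by
  have : ψ s x = ψ t (ψ (s - t) x) := by rw [← ψ.map_add, add_sub_cancel]
  rw [this, flow_flow_eq_iff]

theorem periodAt_flow (t : ℝ) (b : B) : periodAt φ (φ t b) = periodAt φ b := by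
  unfold periodAt
  congr 1
  ext s
  simp only [mem_ofPred_eq]
  rw [flow_comm, flow_flow_eq_iff]

variable {base : ConnectedComponents B → B} (hbase : ∀ C, (base C : ConnectedComponents B) = C)

include hbase

theorem IsRotationFlow.isLeast_coordinate [CompactSpace B] (h : IsRotationFlow φ)
    (C : ConnectedComponents B) {t : ℝ} (ht : t ∈ Ico 0 (periodAt φ (base C))) :
    coordinate φ base (φ t (base C)) = t := by
  have hC : ((φ t (base C) : B) : ConnectedComponents B) = C := by rw [h.coe_flow, hbase]
  unfold coordinate
  rw [hC]
  refine IsLeast.csInf_eq ⟨⟨ht.1, rfl⟩, ?_⟩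
  rintro s ⟨hs, hst⟩
  rw [flow_eq_flow_iff, h.flow_eq_self_iff] at hst
  obtain ⟨m, hm⟩ := hst
  have hp := h.periodAt_pos (base C)
  by_contra hlt
  push Not at hlt
  have h1 : (m : ℝ) < 0 := by
    by_contra h0
    push Not at h0
    nlinarith
  have h2 : (m : ℝ) ≤ -1 := by
    have : m < 0 := by exact_mod_cast h1
    exact_mod_cast (by omega : m ≤ -1)
  nlinarith [ht.2]

theorem IsRotationFlow.exists_mem_Ico [CompactSpace B] (h : IsRotationFlow φ) (b : B) :
    ∃ t ∈ Ico 0 (periodAt φ (base b)), φ t (base b) = b := by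
  obtain ⟨t, ht⟩ := h.coe_eq_coe.1 (hbase b).symm
  have hp := h.periodAt_pos (base b)
  refine ⟨toIcoMod hp 0 t, by simpa using toIcoMod_mem_Ico hp 0 t, ?_⟩
  conv_rhs => rw [← ht]
  rw [flow_eq_flow_iff, h.flow_eq_self_iff]
  refine ⟨-toIcoDiv hp 0 t, ?_⟩
  rw [toIcoMod]
  push_cast
  simp

theorem IsRotationFlow.coordinate_mem [CompactSpace B] (h : IsRotationFlow φ) (b : B) :
    coordinate φ base b ∈ Ico 0 (periodAt φ (base b)) := by
  obtain ⟨t, ht, htb⟩ := h.exists_mem_Ico hbase b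
  have := h.isLeast_coordinate hbase b ht
  rw [htb] at this
  rwa [this]

theorem IsRotationFlow.flow_coordinate [CompactSpace B] (h : IsRotationFlow φ) (b : B) :
    φ (coordinate φ base b) (base b) = b := by
  obtain ⟨t, ht, htb⟩ := h.exists_mem_Ico hbase b
  have := h.isLeast_coordinate hbase b ht
  rw [htb] at this
  rw [this, htb]

theorem IsRotationFlow.periodAt_base [CompactSpace B] (h : IsRotationFlow φ) (b : B) :
    periodAt φ (base b) = periodAt φ b := by
  conv_rhs => rw [← h.flow_coordinate hbase b, periodAt_flow]

variable [T2Space B] [CompactSpace B] [MeasurableSpace B] [BorelSpace B]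

theorem IsRotationFlow.measurable_coordinate (h : IsRotationFlow φ) :
    Measurable (coordinate φ base) := by
  have := h.finite_components
  refine measurable_of_Iio fun a => ?_
  -- The coordinate jumps at base-points, so sublevel sets are not open; each is a finite union of
  -- open arcs together with their initial points.
  have key : coordinate φ base ⁻¹' Iio a = ⋃ C : ConnectedComponents B,
      (fun t => φ t (base C)) '' Ico 0 (min a (periodAt φ (base C))) := by
    ext b
    simp only [mem_preimage, mem_Iio, mem_iUnion]
    constructor
    · intro hb
      have h1 := h.coordinate_mem hbase b
      exact ⟨b, _, ⟨h1.1, lt_min hb h1.2⟩, h.flow_coordinate hbase b⟩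
    · rintro ⟨C, t, ⟨ht0, ht⟩, rfl⟩
      simp only
      rw [h.isLeast_coordinate hbase C ⟨ht0, (lt_min_iff.1 ht).2⟩]
      exact (lt_min_iff.1 ht).1
  rw [key]
  refine MeasurableSet.iUnion fun C => ?_
  rcases le_or_gt (min a (periodAt φ (base C))) 0 with hle | hlt
  · rw [Ico_eq_empty (not_lt.2 hle), image_empty]
    exact MeasurableSet.empty
  · rw [← Ioo_insert_left hlt, image_insert_eq]
    exact (isOpen_image_orbit h.nhds_eq _ isOpen_Ioo).measurableSet.insert _

theorem IsRotationFlow.lintegral_lebesgue [Fintype (ConnectedComponents B)] {F : B → ℝ≥0∞}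
    (hF : Measurable F) : ∫⁻ b, F b ∂(lebesgue φ base) =
      ∑ C, ∫⁻ t in Ico 0 (periodAt φ (base C)), F (φ t (base C)) := by
  unfold lebesgue
  rw [lintegral_sum_measure, tsum_fintype]
  refine Finset.sum_congr rfl fun C _ => ?_
  rw [lintegral_map hF (continuous_orbit φ _).measurable]

theorem IsRotationFlow.isFiniteMeasure_lebesgue (h : IsRotationFlow φ) :
    IsFiniteMeasure (lebesgue φ base) := by
  have := h.finite_components
  have := Fintype.ofFinite (ConnectedComponents B)
  refine ⟨?_⟩
  rw [lebesgue, Measure.sum_apply _ MeasurableSet.univ, tsum_fintype]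
  refine ENNReal.sum_lt_top.2 fun C _ => ?_
  rw [Measure.map_apply (continuous_orbit φ _).measurable MeasurableSet.univ]
  simp

theorem integral_lebesgue [Fintype (ConnectedComponents B)] {F : B → ℂ} (hF : Continuous F) :
    ∫ b, F b ∂(lebesgue φ base) =
      ∑ C, ∫ t in Ico 0 (periodAt φ (base C)), F (φ t (base C)) := by
  unfold lebesgue
  rw [Measure.sum_fintype, integral_finsetSum_measure]
  · refine Finset.sum_congr rfl fun C _ => ?_
    rw [integral_map (continuous_orbit φ _).measurable.aemeasurable
      hF.measurable.stronglyMeasurable.aestronglyMeasurable]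
  · intro C _
    have : IsFiniteMeasure (Measure.map (fun t => φ t (base C))
        (volume.restrict (Ico 0 (periodAt φ (base C))))) := by
      refine ⟨?_⟩
      rw [Measure.map_apply (continuous_orbit φ _).measurable MeasurableSet.univ]
      simp
    obtain ⟨M, hM⟩ := isCompact_univ.exists_bound_of_continuousOn hF.continuousOn
    exact Integrable.of_bound hF.measurable.stronglyMeasurable.aestronglyMeasurable M
      (Filter.Eventually.of_forall fun b => hM b (mem_univ b))

end RotationFlow

/-! ### Smooth dependence of integrals on parameters -/

section ParametricIntegral

/-- The integral is the value at `0` of the convolution of `g p` with the constant `1`, and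
convolutions depend smoothly on parameters when the supports lie in a fixed compact set. -/
theorem contDiffOn_integral_of_support {P : Type*} [NormedAddCommGroup P] [NormedSpace ℝ P]
    {g : P → ℝ → ℂ} {U : Set P} (hU : IsOpen U) {k : Set ℝ} (hk : IsCompact k)
    (hgs : ∀ p, ∀ x, p ∈ U → x ∉ k → g p x = 0)
    (hg : ContDiff ℝ ∞ (Function.uncurry g)) : ContDiffOn ℝ ∞ (fun p => ∫ x, g p x) U := by
  have h1 := contDiffOn_convolution_right_with_param (n := ⊤) (μ := (volume : Measure ℝ))
    (ContinuousLinearMap.lsmul ℝ ℝ : ℝ →L[ℝ] ℂ →L[ℝ] ℂ) (f := fun _ : ℝ => (1 : ℝ)) hU hk hgs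
    (continuous_const.locallyIntegrable) hg.contDiffOn
  have h2 : ContDiffOn ℝ ∞ (fun p : P => (p, (0 : ℝ))) U := by fun_prop
  refine (h1.comp h2 fun p hp => ⟨hp, mem_univ _⟩).congr fun p _ => ?_
  simp only [Function.comp_apply, MeasureTheory.convolution, ContinuousLinearMap.lsmul_apply, one_smul, zero_sub]
  exact (integral_neg_eq_self (g p) volume).symm

end ParametricIntegral

/-! ### The convolution algebra and its actions -/

section FlowRelation

open scoped Pointwise

variable {A B : Type*} [TopologicalSpace A] [TopologicalSpace B] {φ : Flow ℝ B} {Ψ : Flow ℝ A}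
  {s r : A → B}

theorem flow_neg_flow {X : Type*} [TopologicalSpace X] (ψ : Flow ℝ X) (t : ℝ) (x : X) :
    ψ (-t) (ψ t x) = x := by rw [← ψ.map_add, neg_add_cancel, ψ.map_zero_apply]

theorem flow_flow_neg {X : Type*} [TopologicalSpace X] (ψ : Flow ℝ X) (t : ℝ) (x : X) :
    ψ t (ψ (-t) x) = x := by rw [← ψ.map_add, add_neg_cancel, ψ.map_zero_apply]

theorem flow_injective {X : Type*} [TopologicalSpace X] (ψ : Flow ℝ X) (t : ℝ) :
    Function.Injective (ψ t) := fun x y h => by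
  rw [← flow_neg_flow ψ t x, h, flow_neg_flow]

/-- The set swept out by a set of points under the flow during a set of times. -/
def sweep {X : Type*} [TopologicalSpace X] (ψ : Flow ℝ X) (J : Set ℝ) (K : Set X) : Set X :=
  (fun p : ℝ × X => ψ p.1 p.2) '' (J ×ˢ K)

theorem isCompact_sweep {X : Type*} [TopologicalSpace X] (ψ : Flow ℝ X) {J : Set ℝ} {K : Set X}
    (hJ : IsCompact J) (hK : IsCompact K) : IsCompact (sweep ψ J K) :=
  (hJ.prod hK).image ψ.cont'

theorem mem_sweep {X : Type*} [TopologicalSpace X] {ψ : Flow ℝ X} {J : Set ℝ} {K : Set X} {t : ℝ}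
    {x : X} (ht : t ∈ J) (hx : x ∈ K) : ψ t x ∈ sweep ψ J K := ⟨(t, x), ⟨ht, hx⟩, rfl⟩

namespace IsFlowRelation

variable (h : IsFlowRelation φ Ψ s r)

include h

theorem continuous_src : Continuous s := by
  refine continuous_iff_continuousAt.2 fun γ => ?_
  rw [ContinuousAt, h.nhds_arrow γ, Filter.tendsto_map'_iff]
  exact (tendsto_flow φ (s γ)).congr fun t => (h.src_flow t γ).symm

theorem continuous_rng : Continuous r := by
  refine continuous_iff_continuousAt.2 fun γ => ?_
  rw [ContinuousAt, h.nhds_arrow γ, Filter.tendsto_map'_iff]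
  exact (tendsto_flow φ (r γ)).congr fun t => (h.rng_flow t γ).symm

theorem t2Space [T2Space B] : T2Space A :=
  T2Space.of_injective_continuous (f := fun γ => (s γ, r γ))
    (fun γ δ hh => h.ext γ δ (congrArg Prod.fst hh) (congrArg Prod.snd hh))
    (h.continuous_src.prodMk h.continuous_rng)

/-- A fibre of `r` is closed, and discrete because a nearby arrow is a translate by a small time,
which freeness forces to be `0`. This makes the sums over arrows finite. -/
theorem finite_fiber [T2Space B] {K : Set A} (hK : IsCompact K) (b : B) :
    (K ∩ {γ | r γ = b}).Finite := by
  have key : ∀ γ ∈ K, {δ | r δ = b → δ = γ} ∈ 𝓝 γ := fun γ _ => by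
    by_cases hγ : r γ = b
    · rw [h.nhds_arrow γ]
      refine Filter.mem_map.2 ?_
      filter_upwards [h.rotation.free b] with t ht
      intro htb
      rw [h.rng_flow, hγ] at htb
      rw [ht htb]
      exact Ψ.map_zero_apply γ
    · filter_upwards [h.continuous_rng.continuousAt.eventually (isOpen_ne.mem_nhds hγ)] with δ hδ hb
      exact absurd hb hδ
  obtain ⟨t, -, ht⟩ := hK.elim_nhds_subcover _ key
  refine t.finite_toSet.subset fun δ hδ => ?_
  obtain ⟨γ, hγ, hγδ⟩ := mem_iUnion₂.1 (ht hδ.1)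
  rw [show δ = γ from hγδ hδ.2]
  exact hγ

theorem exists_div {γ₁ γ : A} (hr : r γ₁ = r γ) : ∃ δ, s δ = s γ ∧ r δ = s γ₁ := by
  obtain ⟨γ', h1, h2⟩ := h.symm γ₁
  obtain ⟨δ, h3, h4⟩ := h.trans γ' γ (h1.trans hr)
  exact ⟨δ, h3, h4.trans h2⟩

end IsFlowRelation

open Classical in
/-- The arrow `γ₁⁻¹ γ`, for arrows `γ₁` and `γ` with the same range. -/
noncomputable def ldiv (s r : A → B) (γ₁ γ : A) : A :=
  if h : ∃ δ, s δ = s γ ∧ r δ = s γ₁ then h.choose else γ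

namespace IsFlowRelation

variable (h : IsFlowRelation φ Ψ s r)

include h

theorem src_ldiv {γ₁ γ : A} (hr : r γ₁ = r γ) : s (ldiv s r γ₁ γ) = s γ := by
  rw [ldiv, dif_pos (h.exists_div hr)]
  exact (h.exists_div hr).choose_spec.1

theorem rng_ldiv {γ₁ γ : A} (hr : r γ₁ = r γ) : r (ldiv s r γ₁ γ) = s γ₁ := by
  rw [ldiv, dif_pos (h.exists_div hr)]
  exact (h.exists_div hr).choose_spec.2

end IsFlowRelation

/-- Functions on `A × ℝ` which are smooth along the orbits and have compact support. -/
structure IsTest (Ψ : Flow ℝ A) (f : A × ℝ → ℂ) : Prop where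
  smooth : ∀ γ, ContDiff ℝ ∞ fun p : ℝ × ℝ => f (Ψ p.1 γ, p.2)
  compact : HasCompactSupport f

/-- The arrows that occur in the support of a function on `A × ℝ`. -/
def arrowSupport (f : A × ℝ → ℂ) : Set A := Prod.fst '' tsupport f

/-- The times that occur in the support of a function on `A × ℝ`. -/
def timeSupport (f : A × ℝ → ℂ) : Set ℝ := Prod.snd '' tsupport f

theorem mem_arrowSupport {f : A × ℝ → ℂ} {γ : A} {t : ℝ} (h : f (γ, t) ≠ 0) :
    γ ∈ arrowSupport f := ⟨(γ, t), subset_tsupport f h, rfl⟩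

theorem mem_timeSupport {f : A × ℝ → ℂ} {γ : A} {t : ℝ} (h : f (γ, t) ≠ 0) :
    t ∈ timeSupport f := ⟨(γ, t), subset_tsupport f h, rfl⟩

namespace IsTest

variable {f : A × ℝ → ℂ} (hf : IsTest Ψ f)

include hf

theorem isCompact_arrowSupport : IsCompact (arrowSupport f) :=
  hf.compact.isCompact.image continuous_fst

theorem isCompact_timeSupport : IsCompact (timeSupport f) :=
  hf.compact.isCompact.image continuous_snd

theorem continuous (h : IsFlowRelation φ Ψ s r) : Continuous f := by
  refine continuous_iff_continuousAt.2 fun ⟨γ, t⟩ => ?_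
  have h1 := (hf.smooth γ).continuous.tendsto (0, t)
  simp only [Ψ.map_zero_apply] at h1
  rw [ContinuousAt, nhds_prod_eq, h.nhds_arrow γ, ← Filter.map_id (f := 𝓝 t),
    Filter.prod_map_map_eq, Filter.tendsto_map'_iff, ← nhds_prod_eq]
  exact h1

theorem continuous_time (h : IsFlowRelation φ Ψ s r) (γ : A) : Continuous fun t => f (γ, t) :=
  (hf.continuous h).comp (Continuous.prodMk_right γ)

end IsTest

/-- The action of functions on `A × ℝ` on functions on a space `Z` over `B`. -/
noncomputable def act (r : A → B) {Z : Type*} (a : Z → B) (D : A → ℝ → Z → Z) (f : A × ℝ → ℂ)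
    (ξ : Z → ℂ) (z : Z) : ℂ :=
  ∑' γ : {γ // r γ = a z}, ∫ t, f (γ, t) * ξ (D γ t z)

/-- A space `Z` over `B` with an action of the crossed product groupoid: `D γ t z` is the point
`(γ, t)⁻¹ z`. -/
structure IsGroupoidAction (φ : Flow ℝ B) (Ψ : Flow ℝ A) (s r : A → B) {Z : Type*} (a : Z → B)
    (D : A → ℝ → Z → Z) : Prop where
  anchor : ∀ γ t z, r γ = a z → a (D γ t z) = φ t (s γ)
  -- When `γ = γ₁ δ`, the product `(γ₁, u) (Ψ u δ, t - u)` is `(γ, t)`.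
  comp : ∀ γ₁ γ δ u t z, r γ₁ = a z → r γ = a z → s δ = s γ → r δ = s γ₁ →
    D (Ψ u δ) (t - u) (D γ₁ u z) = D γ t z

theorem act_eq_sum {Z : Type*} {a : Z → B} {D : A → ℝ → Z → Z} {f : A × ℝ → ℂ} {ξ : Z → ℂ} {z : Z}
    (S : Finset A) (hS : ∀ γ ∈ S, r γ = a z)
    (h0 : ∀ γ, r γ = a z → γ ∉ S → ∀ t, f (γ, t) * ξ (D γ t z) = 0) :
    act r a D f ξ z = ∑ γ ∈ S, ∫ t, f (γ, t) * ξ (D γ t z) := by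
  unfold act
  refine (tsum_subtype {γ | r γ = a z} (fun γ => ∫ t, f (γ, t) * ξ (D γ t z))).trans ?_
  rw [tsum_eq_sum (s := S)]
  · refine Finset.sum_congr rfl fun γ hγ => ?_
    rw [indicator_of_mem (show γ ∈ {γ | r γ = a z} from hS γ hγ)]
  · intro γ hγ
    by_cases hr : r γ = a z
    · rw [indicator_of_mem (show γ ∈ {γ | r γ = a z} from hr)]
      simp only [h0 γ hr hγ, integral_zero]
    · exact indicator_of_notMem (show γ ∉ {γ | r γ = a z} from hr) _

/-- The left action of the crossed product groupoid on its arrows. -/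
noncomputable def translate (Ψ : Flow ℝ A) (s r : A → B) (γ : A) (u : ℝ) (x : A × ℝ) : A × ℝ :=
  (Ψ u (ldiv s r γ x.1), x.2 - u)

/-- Convolution, as an instance of the action on functions. -/
noncomputable def conv (Ψ : Flow ℝ A) (s r : A → B) (f g : A × ℝ → ℂ) : A × ℝ → ℂ :=
  act r (fun x : A × ℝ => r x.1) (translate Ψ s r) f g

namespace IsFlowRelation

variable [T2Space B] (h : IsFlowRelation φ Ψ s r)

include h

theorem isGroupoidAction_base : IsGroupoidAction φ Ψ s r (fun b => b) fun γ t _ => φ t (s γ) where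
  anchor _ _ _ _ := rfl
  comp γ₁ γ δ u t z _ _ h1 _ := by rw [h.src_flow, h1, ← φ.map_add, sub_add_cancel]

theorem isGroupoidAction_translate :
    IsGroupoidAction φ Ψ s r (fun x : A × ℝ => r x.1) (translate Ψ s r) where
  anchor γ t x hr := by rw [translate, h.rng_flow, h.rng_ldiv hr]
  comp γ₁ γ δ u t x h1 h2 h3 h4 := by
    have e1 : r (Ψ u δ) = r (Ψ u (ldiv s r γ₁ x.1)) := by
      rw [h.rng_flow, h.rng_flow, h.rng_ldiv h1, h4]
    refine Prod.ext (h.ext _ _ ?_ ?_) ?_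
    · simp only [translate]
      rw [h.src_flow, h.src_ldiv e1, h.src_flow, h.src_ldiv h1, h.src_flow, h.src_ldiv h2,
        ← φ.map_add, sub_add_cancel]
    · simp only [translate]
      rw [h.rng_flow, h.rng_ldiv e1, h.src_flow, h3, h.rng_flow, h.rng_ldiv h2,
        ← φ.map_add, sub_add_cancel]
    · simp only [translate]
      ring

theorem conv_eq_sum {f g : A × ℝ → ℂ} (hf : IsTest Ψ f) (γ : A) (t : ℝ) :
    conv Ψ s r f g (γ, t) = ∑ γ₁ ∈ (h.finite_fiber hf.isCompact_arrowSupport (r γ)).toFinset,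
      ∫ u, f (γ₁, u) * g (Ψ u (ldiv s r γ₁ γ), t - u) := by
  refine act_eq_sum _ (fun γ₁ hγ => ?_) fun γ₁ hr hγ u => ?_
  · simp only [Set.Finite.mem_toFinset] at hγ
    exact hγ.2
  · by_contra hne
    refine hγ ?_
    simp only [Set.Finite.mem_toFinset]
    exact ⟨mem_arrowSupport (left_ne_zero_of_mul hne), hr⟩

/-- The convolution algebra is associative, and it acts on functions on every space with an action
of the groupoid. -/
theorem act_conv {f g : A × ℝ → ℂ} (hf : IsTest Ψ f) (hg : IsTest Ψ g) {Z : Type*} {a : Z → B}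
    {D : A → ℝ → Z → Z} (hD : IsGroupoidAction φ Ψ s r a D) {ξ : Z → ℂ} (z : Z)
    (hξ : ∀ γ, r γ = a z → Continuous fun t => ξ (D γ t z)) :
    act r a D (conv Ψ s r f g) ξ z = act r a D f (act r a D g ξ) z := by
  classical
  set b := a z with hb
  let S₁ := (h.finite_fiber hf.isCompact_arrowSupport b).toFinset
  have hS₁ : ∀ γ, γ ∈ S₁ ↔ γ ∈ arrowSupport f ∧ r γ = b := fun γ => by simp [S₁]
  let K := sweep Ψ (-timeSupport f) (arrowSupport g)
  have hK : IsCompact K := isCompact_sweep Ψ hf.isCompact_timeSupport.neg hg.isCompact_arrowSupport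
  -- These are the products `γ = γ₁ δ` that can contribute. There are finitely many `γ₁`, for each
  -- of them finitely many `δ` in `K`, and the pair determines `γ`.
  have hfin : {γ | r γ = b ∧ ∃ γ₁ ∈ S₁, ldiv s r γ₁ γ ∈ K}.Finite := by
    have : {γ | r γ = b ∧ ∃ γ₁ ∈ S₁, ldiv s r γ₁ γ ∈ K} =
        ⋃ γ₁ ∈ S₁, {γ | r γ = b ∧ ldiv s r γ₁ γ ∈ K} := by
      ext γ
      simp only [mem_iUnion, mem_ofPred_eq, exists_prop]
      tauto
    rw [this]
    refine S₁.finite_toSet.biUnion fun γ₁ hγ₁ => ?_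
    have hr₁ : r γ₁ = b := ((hS₁ γ₁).1 hγ₁).2
    refine Set.Finite.of_finite_image (f := ldiv s r γ₁)
      ((h.finite_fiber hK (s γ₁)).subset ?_) ?_
    · rintro _ ⟨γ, ⟨hγ, hγK⟩, rfl⟩
      exact ⟨hγK, h.rng_ldiv (hr₁.trans hγ.symm)⟩
    · rintro γ ⟨hγ, -⟩ γ' ⟨hγ', -⟩ he
      refine h.ext _ _ ?_ (hγ.trans hγ'.symm)
      rw [← h.src_ldiv (hr₁.trans hγ.symm), he, h.src_ldiv (hr₁.trans hγ'.symm)]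
  let S := hfin.toFinset
  have hS : ∀ γ, γ ∈ S ↔ r γ = b ∧ ∃ γ₁ ∈ S₁, ldiv s r γ₁ γ ∈ K := fun γ => by simp [S]
  have hmemK : ∀ {γ₁ δ : A} {u t : ℝ}, f (γ₁, u) ≠ 0 → g (Ψ u δ, t) ≠ 0 → δ ∈ K :=
    fun {γ₁ δ u t} h1 h2 => by
      have := mem_sweep (ψ := Ψ) (J := -timeSupport f) (t := -u)
        (by simpa using mem_timeSupport h1) (mem_arrowSupport h2)
      rwa [flow_neg_flow] at this
  let G : A → A → ℝ → ℝ → ℂ := fun γ₁ γ u t =>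
    f (γ₁, u) * g (Ψ u (ldiv s r γ₁ γ), t - u) * ξ (D γ t z)
  have hGc : ∀ γ₁ γ, r γ = b → Continuous (Function.uncurry (G γ₁ γ)) := fun γ₁ γ hγ => by
    have h1 : Continuous fun p : ℝ × ℝ => f (γ₁, p.1) :=
      (hf.continuous_time h γ₁).comp continuous_fst
    have h2 : Continuous fun p : ℝ × ℝ => g (Ψ p.1 (ldiv s r γ₁ γ), p.2 - p.1) :=
      (hg.continuous h).comp (((continuous_orbit Ψ _).comp continuous_fst).prodMk
        (continuous_snd.sub continuous_fst))
    exact (h1.mul h2).mul ((hξ γ hγ).comp continuous_snd)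
  have hGs : ∀ γ₁ γ, HasCompactSupport (Function.uncurry (G γ₁ γ)) := fun γ₁ γ => by
    refine HasCompactSupport.intro (K := timeSupport f ×ˢ (timeSupport g + timeSupport f))
      (hf.isCompact_timeSupport.prod (hg.isCompact_timeSupport.add hf.isCompact_timeSupport)) ?_
    rintro ⟨u, t⟩ hut
    by_contra hne
    have h1 := left_ne_zero_of_mul hne
    have h2 := mem_timeSupport (left_ne_zero_of_mul h1)
    exact hut ⟨h2, ⟨t - u, mem_timeSupport (right_ne_zero_of_mul h1), u, h2, sub_add_cancel t u⟩⟩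
  have hGi : ∀ γ₁ γ, r γ = b → Integrable (Function.uncurry (G γ₁ γ)) (volume.prod volume) :=
    fun γ₁ γ hγ => (hGc γ₁ γ hγ).integrable_of_hasCompactSupport (hGs γ₁ γ)
  have hL : act r a D (conv Ψ s r f g) ξ z = ∑ γ ∈ S, ∑ γ₁ ∈ S₁, ∫ t, ∫ u, G γ₁ γ u t := by
    rw [act_eq_sum S (fun γ hγ => ((hS γ).1 hγ).1)]
    · refine Finset.sum_congr rfl fun γ hγ => ?_
      have hrγ := ((hS γ).1 hγ).1
      rw [← integral_finsetSum]
      · refine integral_congr_ae (Filter.Eventually.of_forall fun t => ?_)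
        simp only
        rw [h.conv_eq_sum hf, hrγ, Finset.sum_mul]
        refine Finset.sum_congr rfl fun γ₁ _ => ?_
        rw [← integral_mul_const]
      · intro γ₁ _
        exact (hGi γ₁ γ hrγ).integral_prod_right
    · intro γ hrγ hγ t
      rw [h.conv_eq_sum hf, Finset.sum_eq_zero, zero_mul]
      intro γ₁ hγ₁
      rw [hrγ] at hγ₁
      refine integral_eq_zero_of_ae (Filter.Eventually.of_forall fun u => ?_)
      by_contra hne
      exact hγ ((hS γ).2 ⟨hrγ, γ₁, hγ₁,
        hmemK (left_ne_zero_of_mul hne) (right_ne_zero_of_mul hne)⟩)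
  have hR : act r a D f (act r a D g ξ) z = ∑ γ₁ ∈ S₁, ∑ γ ∈ S, ∫ u, ∫ t, G γ₁ γ u t := by
    rw [act_eq_sum S₁ (fun γ hγ => ((hS₁ γ).1 hγ).2)]
    · refine Finset.sum_congr rfl fun γ₁ hγ₁ => ?_
      have hr₁ := ((hS₁ γ₁).1 hγ₁).2
      rw [← integral_finsetSum]
      · refine integral_congr_ae (Filter.Eventually.of_forall fun u => ?_)
        simp only
        by_cases hfu : f (γ₁, u) = 0
        · simp [G, hfu]
        -- The inner sum runs over arrows with range `φ u (s γ₁)`. The relevant ones are `Ψ u (γ₁⁻¹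
        -- γ)` with `γ` in `S`; the shift of `t` by `u` then matches the two integrands.
        rw [act_eq_sum (S.image fun γ => Ψ u (ldiv s r γ₁ γ)), Finset.sum_image, Finset.mul_sum]
        · refine Finset.sum_congr rfl fun γ hγ => ?_
          have hrγ := ((hS γ).1 hγ).1
          rw [← integral_sub_right_eq_self _ u, ← integral_const_mul]
          refine integral_congr_ae (Filter.Eventually.of_forall fun t => ?_)
          simp only [G]
          rw [hD.comp γ₁ γ _ u t z hr₁ hrγ (h.src_ldiv (hr₁.trans hrγ.symm))
            (h.rng_ldiv (hr₁.trans hrγ.symm)), mul_assoc]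
        · intro γ hγ γ' hγ' he
          have hrγ := ((hS γ).1 hγ).1
          have hrγ' := ((hS γ').1 hγ').1
          refine h.ext _ _ ?_ (hrγ.trans hrγ'.symm)
          rw [← h.src_ldiv (hr₁.trans hrγ.symm), flow_injective Ψ u he,
            h.src_ldiv (hr₁.trans hrγ'.symm)]
        · intro γ' hγ'
          obtain ⟨γ, hγ, rfl⟩ := Finset.mem_image.1 hγ'
          have hrγ := ((hS γ).1 hγ).1
          rw [hD.anchor γ₁ u z hr₁, h.rng_flow, h.rng_ldiv (hr₁.trans hrγ.symm)]
        · intro γ' hrγ' hγ' t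
          by_contra hne
          refine hγ' ?_
          rw [hD.anchor γ₁ u z hr₁] at hrγ'
          obtain ⟨γ, e1, e2⟩ := h.trans γ₁ (Ψ (-u) γ') (by
            rw [h.rng_flow, hrγ', flow_neg_flow])
          have e3 : r γ₁ = r γ := e2.symm
          have e4 : ldiv s r γ₁ γ = Ψ (-u) γ' := h.ext _ _ (by rw [h.src_ldiv e3, e1])
            (by rw [h.rng_ldiv e3, h.rng_flow, hrγ', flow_neg_flow])
          refine Finset.mem_image.2 ⟨γ, (hS γ).2 ⟨e2.trans hr₁, γ₁, hγ₁, ?_⟩, ?_⟩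
          · rw [e4]
            refine hmemK hfu (t := t) ?_
            rw [flow_flow_neg]
            exact left_ne_zero_of_mul hne
          · simp only [e4, flow_flow_neg]
      · intro γ hγ
        exact (hGi γ₁ γ ((hS γ).1 hγ).1).integral_prod_left
    · intro γ₁ hr₁ hγ₁ u
      by_contra hne
      exact hγ₁ ((hS₁ γ₁).2 ⟨mem_arrowSupport (left_ne_zero_of_mul hne), hr₁⟩)
  rw [hL, hR, Finset.sum_comm]
  refine Finset.sum_congr rfl fun γ₁ _ => Finset.sum_congr rfl fun γ hγ => ?_
  exact (integral_integral_swap (hGi γ₁ γ ((hS γ).1 hγ).1)).symm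

/-- The arrows with range `φ (w p) b` are the translates by `w p` of those with range `b`. For `p`
near `p₀` only finitely many of the latter matter, so the action is a fixed finite sum of integrals
with parameter. -/
theorem contDiff_act {f : A × ℝ → ℂ} (hf : IsTest Ψ f) {Z : Type*} {a : Z → B}
    {D : A → ℝ → Z → Z} {ξ : Z → ℂ} {P : Type*} [NormedAddCommGroup P] [NormedSpace ℝ P]
    {w : P → ℝ} (hw : ContDiff ℝ ∞ w) {z : P → Z} {b : B} (hz : ∀ p, a (z p) = φ (w p) b)
    (hξ : ∀ γ, r γ = b → ContDiff ℝ ∞ fun q : P × ℝ => ξ (D (Ψ (w q.1) γ) q.2 (z q.1))) :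
    ContDiff ℝ ∞ fun p => act r a D f ξ (z p) := by
  classical
  refine contDiff_iff_contDiffAt.2 fun p₀ => ?_
  let U := w ⁻¹' Ioo (w p₀ - 1) (w p₀ + 1)
  have hU : IsOpen U := isOpen_Ioo.preimage hw.continuous
  have hpU : p₀ ∈ U := ⟨by linarith, by linarith⟩
  let K := sweep Ψ (Icc (-(w p₀ + 1)) (-(w p₀ - 1))) (arrowSupport f)
  have hK : IsCompact K := isCompact_sweep Ψ isCompact_Icc hf.isCompact_arrowSupport
  let S := (h.finite_fiber hK b).toFinset
  have hS : ∀ γ, γ ∈ S ↔ γ ∈ K ∧ r γ = b := fun γ => by simp [S]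
  have key : ∀ p ∈ U, act r a D f ξ (z p) =
      ∑ γ ∈ S, ∫ t, f (Ψ (w p) γ, t) * ξ (D (Ψ (w p) γ) t (z p)) := by
    intro p hp
    rw [act_eq_sum (S.image (Ψ (w p))), Finset.sum_image]
    · exact fun γ _ γ' _ he => flow_injective Ψ _ he
    · intro γ' hγ'
      obtain ⟨γ, hγ, rfl⟩ := Finset.mem_image.1 hγ'
      rw [h.rng_flow, hz, ((hS γ).1 hγ).2]
    · intro γ' hγ' hγS t
      by_contra hne
      refine hγS (Finset.mem_image.2 ⟨Ψ (-w p) γ', (hS _).2 ⟨?_, ?_⟩, flow_flow_neg Ψ _ _⟩)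
      · exact mem_sweep ⟨by linarith [hp.2], by linarith [hp.1]⟩
          (mem_arrowSupport (left_ne_zero_of_mul hne))
      · rw [h.rng_flow, hγ', hz, flow_neg_flow]
  have hsm : ContDiffOn ℝ ∞ (fun p => ∑ γ ∈ S,
      ∫ t, f (Ψ (w p) γ, t) * ξ (D (Ψ (w p) γ) t (z p))) U := by
    refine ContDiffOn.sum fun γ hγ => contDiffOn_integral_of_support hU hf.isCompact_timeSupport
      (g := fun p t => f (Ψ (w p) γ, t) * ξ (D (Ψ (w p) γ) t (z p))) ?_ ?_
    · intro p t _ ht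
      by_contra hne
      exact ht (mem_timeSupport (left_ne_zero_of_mul hne))
    · refine ContDiff.mul ?_ (hξ γ ((hS γ).1 hγ).2)
      exact (hf.smooth γ).comp ((hw.comp contDiff_fst).prodMk contDiff_snd)
  refine (hsm.contDiffAt (hU.mem_nhds hpU)).congr_of_eventuallyEq ?_
  filter_upwards [hU.mem_nhds hpU] with p hp using key p hp

/-- Composition is continuous on the closed set of composable pairs. This bounds the support of a
convolution product. -/
theorem isCompact_comp {K K' : Set A} (hK : IsCompact K) (hK' : IsCompact K') :
    ∃ M : Set A, IsCompact M ∧ ∀ γ ∈ K, ∀ δ ∈ K', ∀ ε, s γ = r δ → s ε = s δ → r ε = r γ →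
      ε ∈ M := by
  have := h.t2Space
  let Q : Set (A × A) := {p | s p.1 = r p.2}
  have hQ : IsClosed Q := isClosed_eq (h.continuous_src.comp continuous_fst)
    (h.continuous_rng.comp continuous_snd)
  have hex : ∀ p : A × A, ∃ ε, p ∈ Q → s ε = s p.2 ∧ r ε = r p.1 := fun p => by
    by_cases hp : p ∈ Q
    · obtain ⟨ε, hε⟩ := h.trans p.1 p.2 hp
      exact ⟨ε, fun _ => hε⟩
    · exact ⟨p.1, fun hp' => absurd hp' hp⟩
  choose m hm using hex
  have hmc : ContinuousOn m Q := by
    rintro ⟨γ, δ⟩ hp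
    rw [ContinuousWithinAt, Filter.tendsto_def]
    intro S hS
    rw [h.nhds_arrow] at hS
    have h1 : ∀ᶠ x : ℝ × ℝ in 𝓝 0 ×ˢ 𝓝 0, φ (x.1 - x.2) (s γ) = s γ → x.1 - x.2 = 0 := by
      have : Filter.Tendsto (fun x : ℝ × ℝ => x.1 - x.2) (𝓝 0 ×ˢ 𝓝 0) (𝓝 0) := by
        have : Continuous fun x : ℝ × ℝ => x.1 - x.2 := by fun_prop
        simpa [nhds_prod_eq] using this.tendsto (0, 0)
      exact this.eventually (h.rotation.free (s γ))
    have h2 : ∀ᶠ x : ℝ × ℝ in 𝓝 0 ×ˢ 𝓝 0, Ψ x.1 (m (γ, δ)) ∈ S :=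
      Filter.tendsto_fst.eventually (Filter.mem_map.1 hS)
    refine mem_nhdsWithin_iff_eventually.2 ?_
    rw [nhds_prod_eq, h.nhds_arrow γ, h.nhds_arrow δ, Filter.prod_map_map_eq, Filter.eventually_map]
    filter_upwards [h1, h2] with x e1 e2 hxQ
    have e3 : φ x.1 (s γ) = φ x.2 (r δ) := by
      rw [← h.src_flow, ← h.rng_flow]
      exact hxQ
    -- By freeness, two factors moved by small times remain composable only if the times agree; the
    -- product then moves by the same time.
    have e4 : x.2 = x.1 := by
      rw [← show s γ = r δ from hp, flow_eq_flow_iff] at e3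
      linarith [e1 e3]
    have e5 : m (Ψ x.1 γ, Ψ x.2 δ) = Ψ x.1 (m (γ, δ)) := by
      have f1 := hm _ hxQ
      have f2 := hm _ hp
      refine h.ext _ _ ?_ ?_
      · rw [f1.1, h.src_flow, h.src_flow, f2.1, e4]
      · rw [f1.2, h.rng_flow, h.rng_flow, f2.2]
    rw [mem_preimage, e5]
    exact e2
  refine ⟨m '' (Q ∩ K ×ˢ K'), ((hK.prod hK').inter_left hQ).image_of_continuousOn
    (hmc.mono inter_subset_left), fun γ hγ δ hδ ε h1 h2 h3 => ?_⟩
  have h4 := hm (γ, δ) h1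
  exact ⟨(γ, δ), ⟨h1, hγ, hδ⟩, h.ext _ _ (h4.1.trans h2.symm) (h4.2.trans h3.symm)⟩

theorem isTest_conv {f g : A × ℝ → ℂ} (hf : IsTest Ψ f) (hg : IsTest Ψ g) :
    IsTest Ψ (conv Ψ s r f g) where
  smooth γ := by
    refine h.contDiff_act hf (w := fun p : ℝ × ℝ => p.1) contDiff_fst (b := r γ)
      (z := fun p : ℝ × ℝ => (Ψ p.1 γ, p.2)) (fun p => h.rng_flow _ _) fun γ₁ hγ₁ => ?_
    -- Division of arrows commutes with the flow, so `g` is evaluated along the single orbit of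
    -- `γ₁⁻¹ γ`.
    have h1 : (fun q : (ℝ × ℝ) × ℝ => g (translate Ψ s r (Ψ q.1.1 γ₁) q.2 (Ψ q.1.1 γ, q.1.2))) =
        fun q => g (Ψ (q.2 + q.1.1) (ldiv s r γ₁ γ), q.1.2 - q.2) := by
      ext q
      simp only [translate]
      congr 2
      have e1 : r (Ψ q.1.1 γ₁) = r (Ψ q.1.1 γ) := by rw [h.rng_flow, h.rng_flow, hγ₁]
      refine h.ext _ _ ?_ ?_
      · rw [h.src_flow, h.src_ldiv e1, h.src_flow, h.src_flow, h.src_ldiv hγ₁, φ.map_add]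
      · rw [h.rng_flow, h.rng_ldiv e1, h.src_flow, h.rng_flow, h.rng_ldiv hγ₁, φ.map_add]
    rw [h1]
    exact (hg.smooth (ldiv s r γ₁ γ)).comp ((contDiff_snd.add (contDiff_fst.comp contDiff_fst)).prodMk
      ((contDiff_snd.comp contDiff_fst).sub contDiff_snd))
  compact := by
    have := h.t2Space
    obtain ⟨M, hM, hM'⟩ := h.isCompact_comp hf.isCompact_arrowSupport
      (isCompact_sweep Ψ hf.isCompact_timeSupport.neg hg.isCompact_arrowSupport)
    refine HasCompactSupport.intro (K := M ×ˢ (timeSupport g + timeSupport f))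
      (hM.prod (hg.isCompact_timeSupport.add hf.isCompact_timeSupport)) ?_
    rintro ⟨γ, t⟩ hγt
    rw [h.conv_eq_sum hf]
    refine Finset.sum_eq_zero fun γ₁ hγ₁ => ?_
    refine integral_eq_zero_of_ae (Filter.Eventually.of_forall fun u => ?_)
    by_contra hne
    have h1 := left_ne_zero_of_mul hne
    have h2 := right_ne_zero_of_mul hne
    simp only [Set.Finite.mem_toFinset] at hγ₁
    have hr : r γ₁ = r γ := hγ₁.2
    refine hγt ⟨hM' γ₁ (mem_arrowSupport h1) (ldiv s r γ₁ γ) ?_ γ (h.rng_ldiv hr).symm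
      (h.src_ldiv hr).symm hr.symm,
      ⟨t - u, mem_timeSupport h2, u, mem_timeSupport h1, sub_add_cancel t u⟩⟩
    have := mem_sweep (ψ := Ψ) (J := -timeSupport f) (t := -u)
      (by simpa using mem_timeSupport h1) (mem_arrowSupport h2)
    rwa [flow_neg_flow] at this

end IsFlowRelation

end FlowRelation

/-! ### The kernel of the operator -/

section Kernel

open scoped Pointwise

variable {A B : Type*} [TopologicalSpace A] [TopologicalSpace B] {φ : Flow ℝ B} {Ψ : Flow ℝ A}
  {s r : A → B}

theorem IsRotationFlow.continuous_of_orbit {Y : Type*} [TopologicalSpace Y] (h : IsRotationFlow φ)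
    {ξ : B → Y} (hξ : ∀ b, Continuous fun t => ξ (φ t b)) : Continuous ξ := by
  refine continuous_iff_continuousAt.2 fun b => ?_
  rw [ContinuousAt, h.nhds_eq b, Filter.tendsto_map'_iff]
  simpa [Function.comp_def] using (hξ b).tendsto 0

/-- The arrows of the crossed product with range `b` and source `b'`. -/
def arrowsBetween (φ : Flow ℝ B) (s r : A → B) (b b' : B) : Set (A × ℝ) :=
  {g | r g.1 = b ∧ φ g.2 (s g.1) = b'}

/-- The kernel of the operator by which a function on the crossed product acts. -/
noncomputable def kernel (φ : Flow ℝ B) (s r : A → B) (f : A × ℝ → ℂ) (b b' : B) : ℂ :=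
  ∑' g : arrowsBetween φ s r b b', f g

theorem kernel_eq_sum {f : A × ℝ → ℂ} {b b' : B} (S : Finset (A × ℝ))
    (hS : ∀ g ∈ S, g ∈ arrowsBetween φ s r b b')
    (h0 : ∀ g ∈ arrowsBetween φ s r b b', g ∉ S → f g = 0) :
    kernel φ s r f b b' = ∑ g ∈ S, f g := by
  unfold kernel
  rw [tsum_subtype, tsum_eq_sum (s := S)]
  · exact Finset.sum_congr rfl fun g hg => indicator_of_mem (hS g hg) _
  · intro g hg
    by_cases hr : g ∈ arrowsBetween φ s r b b'
    · rw [indicator_of_mem hr, h0 g hr hg]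
    · exact indicator_of_notMem hr _

theorem kernel_smul (c : ℂ) (f : A × ℝ → ℂ) (b b' : B) :
    kernel φ s r (c • f) b b' = c * kernel φ s r f b b' := by
  unfold kernel
  rw [← tsum_mul_left]
  rfl

namespace IsFlowRelation

variable [T2Space B] (h : IsFlowRelation φ Ψ s r)

include h

theorem continuous_target : Continuous fun g : A × ℝ => φ g.2 (s g.1) :=
  φ.cont'.comp (continuous_snd.prodMk (h.continuous_src.comp continuous_fst))

theorem isClosed_arrowsBetween (b b' : B) : IsClosed (arrowsBetween φ s r b b') :=
  (isClosed_eq (h.continuous_rng.comp continuous_fst) continuous_const).inter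
    (isClosed_eq h.continuous_target continuous_const)

theorem nhds_prod_arrow (g : A × ℝ) :
    𝓝 g = Filter.map (fun p : ℝ × ℝ => (Ψ p.1 g.1, p.2 + g.2)) (𝓝 0 ×ˢ 𝓝 0) := by
  have h1 : 𝓝 g.2 = Filter.map (fun w : ℝ => w + g.2) (𝓝 0) := by
    rw [map_add_right_nhds, zero_add]
  rw [nhds_prod_eq, h.nhds_arrow, h1, Filter.prod_map_map_eq]

theorem finite_arrowsBetween {K : Set (A × ℝ)} (hK : IsCompact K) (b b' : B) :
    (K ∩ arrowsBetween φ s r b b').Finite := by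
  have key : ∀ g ∈ K, {g' | g' ∈ arrowsBetween φ s r b b' → g' = g} ∈ 𝓝 g := fun g _ => by
    by_cases hg : g ∈ arrowsBetween φ s r b b'
    · rw [h.nhds_prod_arrow g]
      refine Filter.mem_map.2 ?_
      filter_upwards [Filter.prod_mem_prod (h.rotation.free b) (h.rotation.free b')] with p hp
      rintro ⟨h1, h2⟩
      simp only [h.rng_flow, h.src_flow, hg.1] at h1 h2
      have e1 := hp.1 h1
      rw [e1, φ.map_zero_apply, φ.map_add, hg.2] at h2
      have e2 := hp.2 h2
      simp only [e1, e2, Ψ.map_zero_apply, zero_add]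
    · filter_upwards [(h.isClosed_arrowsBetween b b').isOpen_compl.mem_nhds hg] with g' h1 h2
      exact absurd h2 h1
  obtain ⟨t, -, ht⟩ := hK.elim_nhds_subcover _ key
  refine t.finite_toSet.subset fun δ hδ => ?_
  obtain ⟨γ, hγ, hγδ⟩ := mem_iUnion₂.1 (ht hδ.1)
  rw [show δ = γ from hγδ hδ.2]
  exact hγ

/-- This moves the dependence of the kernel on its two points into the argument of `f`, with a fixed
index set of arrows. -/
theorem flow_mem_arrowsBetween {b b' : B} {g : A × ℝ} (u v : ℝ) :
    (Ψ u g.1, g.2 + v - u) ∈ arrowsBetween φ s r (φ u b) (φ v b') ↔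
      g ∈ arrowsBetween φ s r b b' := by
  simp only [arrowsBetween, mem_ofPred_eq, h.rng_flow, h.src_flow]
  refine and_congr ⟨fun e => flow_injective φ u e, fun e => by rw [e]⟩ ?_
  rw [← φ.map_add, sub_add_cancel, add_comm, φ.map_add]
  exact ⟨fun e => flow_injective φ v e, fun e => by rw [e]⟩

theorem kernel_flow {f : A × ℝ → ℂ} {b b' : B} (u v : ℝ) (S : Finset (A × ℝ))
    (hS : ∀ g ∈ S, g ∈ arrowsBetween φ s r b b')
    (h0 : ∀ g ∈ arrowsBetween φ s r b b', g ∉ S → f (Ψ u g.1, g.2 + v - u) = 0) :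
    kernel φ s r f (φ u b) (φ v b') = ∑ g ∈ S, f (Ψ u g.1, g.2 + v - u) := by
  classical
  have hinj : Function.Injective fun g : A × ℝ => (Ψ u g.1, g.2 + v - u) := fun g g' e => by
    have e1 := flow_injective Ψ u (congrArg Prod.fst e)
    have e2 := congrArg Prod.snd e
    exact Prod.ext e1 (by simpa using e2)
  rw [kernel_eq_sum (S.image fun g => (Ψ u g.1, g.2 + v - u)),
    Finset.sum_image fun g _ g' _ e => hinj e]
  · intro g hg
    obtain ⟨g', hg', rfl⟩ := Finset.mem_image.1 hg
    exact (h.flow_mem_arrowsBetween u v).2 (hS g' hg')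
  · intro g hg hgS
    have e : g = (Ψ u (Ψ (-u) g.1), (g.2 - v + u) + v - u) := by
      rw [flow_flow_neg]
      exact Prod.ext rfl (by simp only; ring)
    rw [e] at hg
    have h1 := (h.flow_mem_arrowsBetween (g := (Ψ (-u) g.1, g.2 - v + u)) u v).1 hg
    rw [e]
    refine h0 (Ψ (-u) g.1, g.2 - v + u) h1 fun h2 => hgS ?_
    rw [e]
    exact Finset.mem_image_of_mem (fun g : A × ℝ => (Ψ u g.1, g.2 + v - u)) h2

/-- Near given times, the kernel along the orbits is a fixed finite sum. -/
theorem exists_kernel_flow {f : A × ℝ → ℂ} (hf : IsTest Ψ f) (b b' : B) {J J' : Set ℝ}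
    (hJ : IsCompact J) (hJ' : IsCompact J') :
    ∃ S : Finset (A × ℝ), (∀ g ∈ S, g ∈ arrowsBetween φ s r b b') ∧
      (∀ g ∈ arrowsBetween φ s r b b', g ∉ S → ∀ u ∈ J, ∀ v ∈ J', f (Ψ u g.1, g.2 + v - u) = 0) ∧
      ∀ u ∈ J, ∀ v ∈ J', kernel φ s r f (φ u b) (φ v b') = ∑ g ∈ S, f (Ψ u g.1, g.2 + v - u) := by
  let K := sweep Ψ (-J) (arrowSupport f) ×ˢ (timeSupport f + J + -J')
  have hK : IsCompact K := (isCompact_sweep Ψ hJ.neg hf.isCompact_arrowSupport).prod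
    ((hf.isCompact_timeSupport.add hJ).add hJ'.neg)
  have h0 : ∀ g ∈ arrowsBetween φ s r b b', g ∉ (h.finite_arrowsBetween hK b b').toFinset →
      ∀ u ∈ J, ∀ v ∈ J', f (Ψ u g.1, g.2 + v - u) = 0 := by
    intro g hg hgS u hu v hv
    by_contra hne
    refine hgS ?_
    simp only [Set.Finite.mem_toFinset]
    refine ⟨⟨?_, ?_⟩, hg⟩
    · have := mem_sweep (ψ := Ψ) (J := -J) (t := -u) (by simpa using hu) (mem_arrowSupport hne)
      rwa [flow_neg_flow] at this
    · exact ⟨_, ⟨_, mem_timeSupport hne, u, hu, rfl⟩, -v, by simpa using hv, by simp⟩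
  have hS : ∀ g ∈ (h.finite_arrowsBetween hK b b').toFinset, g ∈ arrowsBetween φ s r b b' :=
    fun g hg => by
      simp only [Set.Finite.mem_toFinset] at hg
      exact hg.2
  exact ⟨_, hS, h0, fun u hu v hv => h.kernel_flow u v _ hS fun g hg hgS => h0 g hg hgS u hu v hv⟩

theorem contDiff_kernel {f : A × ℝ → ℂ} (hf : IsTest Ψ f) (b b' : B) :
    ContDiff ℝ ∞ fun p : ℝ × ℝ => kernel φ s r f (φ p.1 b) (φ p.2 b') := by
  refine contDiff_iff_contDiffAt.2 fun p₀ => ?_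
  obtain ⟨S, -, -, hS⟩ := h.exists_kernel_flow hf b b'
    (isCompact_Icc (a := p₀.1 - 1) (b := p₀.1 + 1)) (isCompact_Icc (a := p₀.2 - 1) (b := p₀.2 + 1))
  have hsm : ContDiff ℝ ∞ fun p : ℝ × ℝ => ∑ g ∈ S, f (Ψ p.1 g.1, g.2 + p.2 - p.1) :=
    ContDiff.sum fun g _ => (hf.smooth g.1).comp
      (contDiff_fst.prodMk ((contDiff_const.add contDiff_snd).sub contDiff_fst))
  refine hsm.contDiffAt.congr_of_eventuallyEq ?_
  filter_upwards [(isOpen_Ioo (a := p₀.1 - 1) (b := p₀.1 + 1)).prod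
    (isOpen_Ioo (a := p₀.2 - 1) (b := p₀.2 + 1)) |>.mem_nhds
      (x := p₀) ⟨⟨by linarith, by linarith⟩, ⟨by linarith, by linarith⟩⟩] with p hp
  exact hS p.1 (Ioo_subset_Icc_self hp.1) p.2 (Ioo_subset_Icc_self hp.2)

theorem kernel_add {f g : A × ℝ → ℂ} (hf : IsTest Ψ f) (hg : IsTest Ψ g) (b b' : B) :
    kernel φ s r (f + g) b b' = kernel φ s r f b b' + kernel φ s r g b b' := by
  classical
  have key : ∀ {f}, IsTest Ψ f → Summable fun x : arrowsBetween φ s r b b' => f x := fun {f} hf => by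
    refine summable_of_hasFiniteSupport ?_
    refine Set.Finite.of_finite_image (f := Subtype.val)
      ((h.finite_arrowsBetween hf.compact.isCompact b b').subset ?_) Subtype.val_injective.injOn
    rintro _ ⟨x, hx, rfl⟩
    exact ⟨subset_tsupport f hx, x.2⟩
  exact (key hf).tsum_add (key hg)

end IsFlowRelation

end Kernel

/-! ### Unfolding the circles: sums over periods -/

section Coordinates

variable {A B : Type*} [TopologicalSpace A] [TopologicalSpace B] {φ : Flow ℝ B} {Ψ : Flow ℝ A}
  {s r : A → B} {base : ConnectedComponents B → B}

theorem hasSum_integral_periods {p : ℝ} (hp : 0 < p) (c : ℝ) {F : ℝ → ℂ} (hF : Integrable F) :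
    HasSum (fun m : ℤ => ∫ u in Ico 0 p, F (m * p - c + u)) (∫ t, F t) := by
  have h1 := hasSum_integral_iUnion (μ := volume) (f := F)
    (s := fun m : ℤ => Ico (-c + m • p) (-c + (m + 1) • p)) (fun m => measurableSet_Ico)
    (pairwise_disjoint_Ico_add_zsmul (-c) p) hF.integrableOn
  rw [iUnion_Ico_add_zsmul hp, setIntegral_univ] at h1
  refine Eq.mp (congrArg (fun G => HasSum G _) (funext fun m => ?_)) h1
  symm
  rw [← integral_indicator measurableSet_Ico, ← integral_indicator measurableSet_Ico,
    ← integral_add_left_eq_self (indicator (Ico (-c + m • p) (-c + (m + 1) • p)) F) (m * p - c)]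
  refine integral_congr_ae (Filter.Eventually.of_forall fun u => ?_)
  simp only [indicator_apply, mem_Ico, zsmul_eq_mul, Int.cast_add, Int.cast_one]
  refine if_congr ⟨fun hu => ⟨?_, ?_⟩, fun hu => ⟨?_, ?_⟩⟩ rfl rfl <;> linarith [hu.1, hu.2]

theorem exists_finset_periods {p : ℝ} (hp : 0 < p) {J : Set ℝ} (hJ : IsCompact J) :
    ∃ M : Finset ℤ, ∀ m ∉ M, ∀ x ∈ Ioo (-p) p, m * p + x ∉ J := by
  obtain ⟨R, hR⟩ := hJ.isBounded.exists_norm_le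
  -- If `m * p + x` lies in `J` and `|x| < p`, then `|m| * p < R + p`.
  obtain ⟨N, hN⟩ := exists_nat_gt (R / p + 1)
  refine ⟨Finset.Icc (-N) N, fun m hm x hx hmx => hm ?_⟩
  have h1 := hR _ hmx
  rw [Real.norm_eq_abs, abs_le] at h1
  have h2 : R + p < N * p := by
    have := mul_lt_mul_of_pos_right hN hp
    rwa [add_mul, div_mul_cancel₀ _ hp.ne', one_mul] at this
  have h3 : (m : ℝ) < N := lt_of_mul_lt_mul_right (by linarith [hx.1]) hp.le
  have h4 : (-N : ℝ) < m := lt_of_mul_lt_mul_right (by linarith [hx.2]) hp.le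
  rw [Finset.mem_Icc]
  constructor
  · have : ((-N : ℤ) : ℝ) < m := by push_cast; exact h4
    exact_mod_cast this.le
  · have : (m : ℝ) < (N : ℤ) := by push_cast; exact h3
    exact_mod_cast this.le

namespace IsFlowRelation

variable [T2Space B] [CompactSpace B] (h : IsFlowRelation φ Ψ s r)
  (hbase : ∀ C, (base C : ConnectedComponents B) = C)

include h hbase

/-- In coordinates the condition on the source of `(γ, t)` is a congruence modulo the period. Its
solutions are indexed by the integer of the trace formula. -/
theorem target_eq_iff {γ : A} {C : ConnectedComponents B} (hγ : (s γ : ConnectedComponents B) = C)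
    (t u : ℝ) : φ t (s γ) = φ u (base C) ↔
      ∃ m : ℤ, t = m * periodAt φ (base C) - coordinate φ base (s γ) + u := by
  have h1 := h.rotation.flow_coordinate hbase (s γ)
  rw [hγ] at h1
  conv_lhs => rw [← h1, ← φ.map_add, flow_eq_flow_iff, h.rotation.flow_eq_self_iff]
  exact exists_congr fun m => ⟨fun e => by linarith, fun e => by linarith⟩

theorem source_mem {g : A × ℝ} {b : B} {C : ConnectedComponents B} {u : ℝ}
    (hg : g ∈ arrowsBetween φ s r b (φ u (base C))) : (s g.1 : ConnectedComponents B) = C := by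
  rw [← h.rotation.coe_flow g.2, hg.2, h.rotation.coe_flow, hbase]

theorem kernel_eq_sum_periods {f : A × ℝ → ℂ} {b : B} (C : ConnectedComponents B) (u : ℝ)
    (S : Finset A) (M : Finset ℤ)
    (hS : ∀ γ ∈ S, r γ = b ∧ (s γ : ConnectedComponents B) = C)
    (h0 : ∀ γ, r γ = b → (s γ : ConnectedComponents B) = C → ∀ m : ℤ, (γ ∉ S ∨ m ∉ M) →
      f (γ, m * periodAt φ (base C) - coordinate φ base (s γ) + u) = 0) :
    kernel φ s r f b (φ u (base C)) =
      ∑ γ ∈ S, ∑ m ∈ M, f (γ, m * periodAt φ (base C) - coordinate φ base (s γ) + u) := by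
  classical
  have hp := h.rotation.periodAt_pos (base C)
  let e : A × ℤ → A × ℝ := fun x =>
    (x.1, x.2 * periodAt φ (base C) - coordinate φ base (s x.1) + u)
  have he : Function.Injective e := fun x y hxy => by
    have e1 : x.1 = y.1 := (Prod.ext_iff.1 hxy).1
    have e2 := (Prod.ext_iff.1 hxy).2
    simp only [e, e1] at e2
    have e3 : (x.2 : ℝ) = y.2 := mul_right_cancel₀ hp.ne' (by linarith)
    exact Prod.ext e1 (by exact_mod_cast e3)
  rw [kernel_eq_sum ((S ×ˢ M).image e), Finset.sum_image he.injOn,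
    Finset.sum_product]
  · intro g hg
    obtain ⟨x, hx, rfl⟩ := Finset.mem_image.1 hg
    have h1 := hS x.1 (Finset.mem_product.1 hx).1
    exact ⟨h1.1, (h.target_eq_iff hbase h1.2 _ _).2 ⟨x.2, rfl⟩⟩
  · rintro ⟨γ, t⟩ hg hgS
    have hC := h.source_mem hbase hg
    obtain ⟨m, hm⟩ := (h.target_eq_iff hbase hC t u).1 hg.2
    simp only at hm hC
    rw [hm]
    refine h0 γ hg.1 hC m ?_
    by_contra hcon
    push Not at hcon
    exact hgS (Finset.mem_image.2 ⟨(γ, m), Finset.mem_product.2 hcon, Prod.ext rfl hm.symm⟩)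

theorem coordinate_mem_Ioo {γ : A} {C : ConnectedComponents B}
    (hγ : (s γ : ConnectedComponents B) = C) {u : ℝ} (hu : u ∈ Ico 0 (periodAt φ (base C))) :
    u - coordinate φ base (s γ) ∈ Ioo (-periodAt φ (base C)) (periodAt φ (base C)) := by
  have h1 := h.rotation.coordinate_mem hbase (s γ)
  rw [hγ] at h1
  exact ⟨by linarith [hu.1, h1.2], by linarith [hu.2, h1.1]⟩

variable [MeasurableSpace B] [BorelSpace B]

/-- For each `γ` the line of times is cut into periods, each of which runs once around the circle of
`s γ`. Collecting the values of `f` above one point of that circle gives the kernel. -/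
theorem act_eq_integral {f : A × ℝ → ℂ} (hf : IsTest Ψ f) {ξ : B → ℂ} (hξ : Continuous ξ) (b : B) :
    act r (fun b => b) (fun γ t _ => φ t (s γ)) f ξ b =
      ∫ b', kernel φ s r f b b' * ξ b' ∂(lebesgue φ base) := by
  classical
  have := h.rotation.finite_components
  have := Fintype.ofFinite (ConnectedComponents B)
  have hkc : Continuous (kernel φ s r f b) := h.rotation.continuous_of_orbit fun b' => by
    have := (h.contDiff_kernel hf b b').continuous.comp (Continuous.prodMk_right (0 : ℝ))
    simpa [Function.comp_def, φ.map_zero_apply] using this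
  rw [show ∫ b', kernel φ s r f b b' * ξ b' ∂(lebesgue φ base) = _ from
    integral_lebesgue hbase (hkc.mul hξ)]
  let S := (h.finite_fiber hf.isCompact_arrowSupport b).toFinset
  have hS : ∀ γ, γ ∈ S ↔ γ ∈ arrowSupport f ∧ r γ = b := fun γ => by simp [S]
  rw [act_eq_sum S (fun γ hγ => ((hS γ).1 hγ).2) fun γ hγ hγS t => by
    by_contra hne
    exact hγS ((hS γ).2 ⟨mem_arrowSupport (left_ne_zero_of_mul hne), hγ⟩)]
  -- Arrows are grouped by the circle that contains their source.
  rw [← Finset.sum_fiberwise S (fun γ => (s γ : ConnectedComponents B))]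
  refine Finset.sum_congr rfl fun C _ => ?_
  have hp := h.rotation.periodAt_pos (base C)
  obtain ⟨M, hM⟩ := exists_finset_periods hp hf.isCompact_timeSupport
  have hc1 : ∀ γ (m : ℤ) (c : ℝ), Continuous fun u =>
      f (γ, m * periodAt φ (base C) - c + u) * ξ (φ u (base C)) := fun γ m c =>
    ((hf.continuous_time h γ).comp (continuous_const.add continuous_id)).mul
      (hξ.comp (continuous_orbit φ _))
  have hint : ∀ γ (m : ℤ) (c : ℝ), IntegrableOn (fun u =>
      f (γ, m * periodAt φ (base C) - c + u) * ξ (φ u (base C))) (Ico 0 (periodAt φ (base C))) :=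
    fun γ m c => ((hc1 γ m c).integrableOn_Icc).mono_set Ico_subset_Icc_self
  calc ∑ γ ∈ S with (s γ : ConnectedComponents B) = C, ∫ t, f (γ, t) * ξ (φ t (s γ))
      = ∑ γ ∈ S with (s γ : ConnectedComponents B) = C, ∑ m ∈ M,
        ∫ u in Ico 0 (periodAt φ (base C)),
          f (γ, m * periodAt φ (base C) - coordinate φ base (s γ) + u) * ξ (φ u (base C)) := by
        refine Finset.sum_congr rfl fun γ hγ => ?_
        have hγC := (Finset.mem_filter.1 hγ).2
        have hi : Integrable fun t => f (γ, t) * ξ (φ t (s γ)) := by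
          refine ((hf.continuous_time h γ).mul
            (hξ.comp (continuous_orbit φ _))).integrable_of_hasCompactSupport ?_
          refine HasCompactSupport.intro hf.isCompact_timeSupport fun t ht => ?_
          by_contra hne
          exact ht (mem_timeSupport (left_ne_zero_of_mul hne))
        have h1 := hasSum_integral_periods hp (coordinate φ base (s γ)) hi
        have h2 : ∀ (m : ℤ) (u : ℝ), φ (m * periodAt φ (base C) - coordinate φ base (s γ) + u) (s γ)
            = φ u (base C) := fun m u => (h.target_eq_iff hbase hγC _ _).2 ⟨m, rfl⟩
        simp only [h2] at h1
        refine h1.unique (hasSum_sum_of_ne_finset_zero fun m hm => ?_)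
        refine setIntegral_eq_zero_of_forall_eq_zero fun u hu => ?_
        by_contra hne
        have h3 := mem_timeSupport (left_ne_zero_of_mul hne)
        rw [sub_add_eq_add_sub, add_sub_assoc] at h3
        exact hM m hm _ (h.coordinate_mem_Ioo hbase hγC hu) h3
    _ = ∫ u in Ico 0 (periodAt φ (base C)), ∑ γ ∈ S with (s γ : ConnectedComponents B) = C,
        ∑ m ∈ M, f (γ, m * periodAt φ (base C) - coordinate φ base (s γ) + u) *
          ξ (φ u (base C)) := by
        rw [integral_finsetSum _ fun γ _ => integrable_finsetSum _ fun m _ => hint γ m _]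
        refine Finset.sum_congr rfl fun γ _ => ?_
        rw [integral_finsetSum _ fun m _ => hint γ m _]
    _ = _ := by
        refine setIntegral_congr_fun measurableSet_Ico fun u hu => ?_
        rw [h.kernel_eq_sum_periods hbase C u (S.filter fun γ => (s γ : ConnectedComponents B) = C) M,
          Finset.sum_mul]
        · exact Finset.sum_congr rfl fun γ _ => (Finset.sum_mul _ _ _).symm
        · intro γ hγ
          have := Finset.mem_filter.1 hγ
          exact ⟨((hS γ).1 this.1).2, this.2⟩
        · intro γ hγ hγC m hm
          by_contra hne
          rcases hm with hm | hm
          · exact hm (Finset.mem_filter.2 ⟨(hS γ).2 ⟨mem_arrowSupport hne, hγ⟩, hγC⟩)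
          · have h3 := mem_timeSupport hne
            rw [sub_add_eq_add_sub, add_sub_assoc] at h3
            exact hM m hm _ (h.coordinate_mem_Ioo hbase hγC hu) h3

end IsFlowRelation

end Coordinates

/-! ### Sums of Lebesgue measures on curves -/

section CurveMeasure

variable {X J : Type*} [TopologicalSpace X] [MeasurableSpace X] [BorelSpace X]

/-- The sum of the Lebesgue measures on a family of parametrized curves. -/
noncomputable def curveMeasure (c : J → ℝ → X) (p : J → ℝ) : Measure X :=
  Measure.sum fun j => (volume.restrict (Ico 0 (p j))).map (c j)

theorem integrable_curveMeasure [Countable J] {c : J → ℝ → X} (hc : ∀ j, Continuous (c j))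
    {p : J → ℝ} {F : X → ℂ} (hF : Measurable F) {R : ℝ} (hR : ∀ x, ‖F x‖ ≤ R) (S : Finset J)
    (h0 : ∀ j ∉ S, ∀ t ∈ Ico 0 (p j), F (c j t) = 0) :
    Integrable F (curveMeasure c p) ∧
      ∫ x, F x ∂(curveMeasure c p) = ∑ j ∈ S, ∫ t in Ico 0 (p j), F (c j t) := by
  have hb : ∀ j, IntegrableOn (fun t => F (c j t)) (Ico 0 (p j)) := fun j =>
    Measure.integrableOn_of_bounded (M := R) (by simp)
      (hF.comp (hc j).measurable).aestronglyMeasurable (Filter.Eventually.of_forall fun t => hR _)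
  have hm : ∀ j, ∫ x, F x ∂((volume.restrict (Ico 0 (p j))).map (c j)) =
      ∫ t in Ico 0 (p j), F (c j t) := fun j =>
    integral_map (hc j).measurable.aemeasurable hF.aestronglyMeasurable
  have h1 : Integrable F (curveMeasure c p) := by
    refine integrable_sum_measure (fun j => ?_) ?_
    · rw [integrable_map_measure hF.aestronglyMeasurable (hc j).measurable.aemeasurable]
      exact hb j
    · refine summable_of_ne_finset_zero (s := S) fun j hj => ?_
      rw [integral_map (hc j).measurable.aemeasurable hF.norm.aestronglyMeasurable]
      exact setIntegral_eq_zero_of_forall_eq_zero fun t ht => by rw [h0 j hj t ht, norm_zero]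
  refine ⟨h1, ?_⟩
  unfold curveMeasure at h1 ⊢
  rw [integral_sum_measure h1, tsum_eq_sum (s := S)]
  · exact Finset.sum_congr rfl fun j _ => hm j
  · intro j hj
    rw [hm j]
    exact setIntegral_eq_zero_of_forall_eq_zero (h0 j hj)

theorem mem_support_curveMeasure {c : J → ℝ → X} (hc : ∀ j, Continuous (c j)) {p : J → ℝ} (j : J)
    {t : ℝ} (ht : t ∈ Ico 0 (p j)) : c j t ∈ (curveMeasure c p).support := by
  rw [Measure.mem_support_iff_forall]
  intro U hU
  obtain ⟨W, hWU, hW, hxW⟩ := mem_nhds_iff.1 hU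
  refine lt_of_lt_of_le ?_ (measure_mono hWU)
  refine lt_of_lt_of_le ?_ (Measure.le_iff'.1 (Measure.le_sum _ j) W)
  rw [Measure.map_apply (hc j).measurable hW.measurableSet,
    Measure.restrict_apply (hW.preimage (hc j)).measurableSet]
  obtain ⟨ε, hε, hεW⟩ := Metric.isOpen_iff.1 (hW.preimage (hc j)) t hxW
  -- Only times after `t` are used, since `t` may be the left end `0`.
  have h1 : Ioo t (min (t + ε) (p j)) ⊆ c j ⁻¹' W ∩ Ico 0 (p j) := fun x hx => by
    have h2 := lt_min_iff.1 hx.2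
    refine ⟨hεW ?_, ht.1.trans hx.1.le, h2.2⟩
    rw [Metric.mem_ball, Real.dist_eq, abs_of_pos (by linarith [hx.1])]
    linarith [h2.1]
  refine lt_of_lt_of_le ?_ (measure_mono h1)
  rw [Real.volume_Ioo, ENNReal.ofReal_pos, sub_pos]
  exact lt_min (by linarith) ht.2

theorem support_curveMeasure_subset {c : J → ℝ → X} (hc : ∀ j, Continuous (c j)) {p : J → ℝ}
    {Z : Set X} (hZ : IsClosed Z) (hcZ : ∀ j t, c j t ∈ Z) : (curveMeasure c p).support ⊆ Z := by
  refine Measure.support_subset_of_isClosed hZ ?_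
  rw [mem_ae_iff, curveMeasure, Measure.sum_apply _ hZ.measurableSet.compl, ENNReal.tsum_eq_zero]
  intro j
  rw [Measure.map_apply (hc j).measurable hZ.measurableSet.compl]
  have : c j ⁻¹' Zᶜ = ∅ := by
    ext t
    simpa using hcZ j t
  rw [this, measure_empty]

end CurveMeasure

/-! ### The trace formula and the measure on the isotropy -/

section Trace

variable {A B : Type*} [TopologicalSpace A] [TopologicalSpace B] {φ : Flow ℝ B} {Ψ : Flow ℝ A}
  {s r : A → B} {base : ConnectedComponents B → B}

/-- The trace of the operator with the kernel of `f`. -/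
noncomputable def kernelTrace [MeasurableSpace B] (φ : Flow ℝ B) (s r : A → B)
    (base : ConnectedComponents B → B) (f : A × ℝ → ℂ) : ℂ :=
  ∫ b, kernel φ s r f b b ∂(lebesgue φ base)

/-- The curves that fill the isotropy of the crossed product. -/
def isotropyCurve (φ : Flow ℝ B) (Ψ : Flow ℝ A) (s r : A → B)
    (base : ConnectedComponents B → B)
    (j : Σ C, arrowsBetween φ s r (base C) (base C)) (t : ℝ) : A × ℝ := (Ψ t j.2.1.1, j.2.1.2)

/-- The measure on the crossed product that represents the trace. -/
noncomputable def isotropyMeasure [MeasurableSpace A] (φ : Flow ℝ B) (Ψ : Flow ℝ A) (s r : A → B)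
    (base : ConnectedComponents B → B) : Measure (A × ℝ) :=
  curveMeasure (isotropyCurve φ Ψ s r base) fun j => periodAt φ (base j.1)

theorem continuous_isotropyCurve
    (j : Σ C, arrowsBetween φ s r (base C) (base C)) :
    Continuous (isotropyCurve φ Ψ s r base j) :=
  (continuous_orbit Ψ _).prodMk continuous_const

namespace IsFlowRelation

variable [T2Space B] [CompactSpace B] (h : IsFlowRelation φ Ψ s r)
  (hbase : ∀ C, (base C : ConnectedComponents B) = C)

include h

theorem isClosed_isotropy : IsClosed {g : A × ℝ | φ g.2 (s g.1) = r g.1} :=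
  isClosed_eq h.continuous_target (h.continuous_rng.comp continuous_fst)

/-- Moving the arrow along its open orbit at fixed time preserves the isotropy, and freeness
excludes other times close to `g.2`. The whole orbit of `g.1` can serve as `U`. -/
theorem isotropy_slice {g : A × ℝ} (hg : φ g.2 (s g.1) = r g.1) :
    ∃ U ∈ 𝓝 g.1, ∃ T ∈ 𝓝 g.2, {g : A × ℝ | φ g.2 (s g.1) = r g.1} ∩ U ×ˢ T = U ×ˢ {g.2} := by
  refine ⟨range fun t => Ψ t g.1, ?_, (fun w : ℝ => w - g.2) ⁻¹' {w | φ w (r g.1) = r g.1 → w = 0},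
    ?_, ?_⟩
  · rw [h.nhds_arrow]
    exact Filter.mem_map.2 (Filter.Eventually.of_forall fun t => ⟨t, rfl⟩)
  · have h1 : Filter.Tendsto (fun w : ℝ => w - g.2) (𝓝 g.2) (𝓝 0) := by
      have : Continuous fun w : ℝ => w - g.2 := by fun_prop
      simpa using this.tendsto g.2
    exact h1 (h.rotation.free (r g.1))
  · ext ⟨γ, w⟩
    simp only [mem_inter_iff, mem_prod, mem_range, mem_ofPred_eq, mem_singleton_iff, mem_preimage]
    constructor
    · rintro ⟨h1, ⟨t, rfl⟩, h2⟩
      refine ⟨⟨t, rfl⟩, ?_⟩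
      rw [h.src_flow, h.rng_flow, flow_comm, flow_flow_eq_iff] at h1
      rw [← hg, ← φ.map_add, sub_add_cancel] at h2
      exact sub_eq_zero.1 (h2 (h1.trans hg.symm))
    · rintro ⟨⟨t, rfl⟩, rfl⟩
      refine ⟨?_, ⟨t, rfl⟩, fun _ => sub_self _⟩
      rw [h.src_flow, h.rng_flow, flow_comm, flow_flow_eq_iff, hg]

include hbase

theorem exists_base (γ : A) : ∃ C, ∃ δ, r δ = base C ∧ ∃ t ∈ Ico 0 (periodAt φ (base C)),
    Ψ t δ = γ := by
  refine ⟨r γ, Ψ (-coordinate φ base (r γ)) γ, ?_, _, h.rotation.coordinate_mem hbase (r γ),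
    flow_flow_neg Ψ _ _⟩
  rw [h.rng_flow, ← flow_flow_eq_iff φ (coordinate φ base (r γ)), ← φ.map_add, add_neg_cancel,
    φ.map_zero_apply, h.rotation.flow_coordinate hbase]

/-- Every arrow lies on the orbit of an arrow with range a base-point, and there are countably many
of these. So `A` is an open quotient of countably many lines. -/
theorem secondCountableTopology : SecondCountableTopology A := by
  have := h.rotation.finite_components
  have hc : ∀ C, Countable {γ // r γ = base C} := fun C => (h.countable (base C)).to_subtype
  let q : (Σ _ : (Σ C, {γ // r γ = base C}), ℝ) → A := fun x => Ψ x.2 x.1.2.1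
  have hq : Continuous q := continuous_sigma fun j => continuous_orbit Ψ j.2.1
  have ho : IsOpenMap q := isOpenMap_sigma.2 fun j W hW =>
    isOpen_image_orbit h.nhds_arrow j.2.1 hW
  have hs : Function.Surjective q := fun γ => by
    obtain ⟨C, δ, hδ, t, -, ht⟩ := h.exists_base hbase γ
    exact ⟨⟨⟨C, δ, hδ⟩, t⟩, ht⟩
  exact (ho.isQuotientMap hq hs).secondCountableTopology ho

variable [MeasurableSpace A] [BorelSpace A] [MeasurableSpace B] [BorelSpace B]

omit hbase [MeasurableSpace B] [BorelSpace B] [CompactSpace B] in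
theorem count_restrict_flow (t : ℝ) (b : B) {T : Set A} (hT : MeasurableSet T) :
    Measure.count.restrict {γ | r γ = φ t b} T =
      ∑' γ : {γ // r γ = b}, T.indicator 1 (Ψ t γ) := by
  have := h.t2Space
  have hcl : IsClosed {γ | r γ = φ t b} := isClosed_eq h.continuous_rng continuous_const
  rw [Measure.restrict_apply hT, ← lintegral_indicator_one (hT.inter hcl.measurableSet),
    lintegral_count, inter_comm, ← indicator_indicator,
    ← tsum_subtype {γ | r γ = φ t b} (T.indicator 1)]
  let e : {γ // r γ = b} ≃ {γ | r γ = φ t b} :=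
    { toFun := fun γ => ⟨Ψ t γ.1, by rw [mem_ofPred_eq, h.rng_flow, γ.2]⟩
      invFun := fun γ => ⟨Ψ (-t) γ.1, by
        rw [h.rng_flow, show r γ.1 = φ t b from γ.2, flow_neg_flow]⟩
      left_inv := fun γ => Subtype.ext (flow_neg_flow Ψ t γ.1)
      right_inv := fun γ => Subtype.ext (flow_flow_neg Ψ t γ.1) }
  exact (e.tsum_eq fun γ => T.indicator (1 : A → ℝ≥0∞) γ.1).symm

/-- Needed to evaluate `Measure.bind`. On the circle of `base C` the flow identifies all fibres of
`r` with the fibre over the base-point, so the count becomes a countable sum of indicators that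
depend measurably on the coordinate. -/
theorem measurable_count_restrict :
    Measurable fun b => Measure.count.restrict {γ : A | r γ = b} := by
  have := h.rotation.finite_components
  have hc : ∀ C, Countable {γ // r γ = base C} := fun C => (h.countable (base C)).to_subtype
  refine Measure.measurable_of_measurable_coe _ fun T hT => ?_
  have key : ∀ b : B, Measure.count.restrict {γ : A | r γ = b} T =
      ∑' C, (connectedComponent (base C)).indicator (fun b => ∑' γ : {γ // r γ = base C},
        T.indicator (1 : A → ℝ≥0∞) (Ψ (coordinate φ base b) γ)) b := fun b => by
    rw [tsum_eq_single (b : ConnectedComponents B), indicator_of_mem,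
      ← h.count_restrict_flow _ _ hT, h.rotation.flow_coordinate hbase]
    · rw [← ConnectedComponents.coe_eq_coe', hbase]
    · intro C hC
      refine indicator_of_notMem (fun hb => hC ?_) _
      rw [← ConnectedComponents.coe_eq_coe', hbase] at hb
      exact hb.symm
  simp only [key]
  refine Measurable.tsum fun C => Measurable.indicator ?_
    isClosed_connectedComponent.measurableSet
  exact Measurable.tsum fun γ => (measurable_one.indicator hT).comp
    ((continuous_orbit Ψ γ.1).measurable.comp (h.rotation.measurable_coordinate hbase))

/-- The pullback of the measure on `B` is the sum of Lebesgue measures over the orbits. -/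
theorem bind_count_eq :
    ((lebesgue φ base).bind fun b => Measure.count.restrict {γ : A | r γ = b}) =
      curveMeasure (fun (j : Σ C, {γ // r γ = base C}) t => Ψ t j.2.1)
        fun j => periodAt φ (base j.1) := by
  have := h.rotation.finite_components
  have := Fintype.ofFinite (ConnectedComponents B)
  have hc : ∀ C, Countable {γ // r γ = base C} := fun C => (h.countable (base C)).to_subtype
  refine Measure.ext fun T hT => ?_
  have hm := h.measurable_count_restrict hbase
  rw [Measure.bind_apply hT hm.aemeasurable,
    show ∫⁻ b, Measure.count.restrict {γ : A | r γ = b} T ∂(lebesgue φ base) = _ from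
      IsRotationFlow.lintegral_lebesgue hbase ((Measure.measurable_coe hT).comp hm), curveMeasure,
    Measure.sum_apply _ hT, ENNReal.tsum_sigma', tsum_fintype]
  refine Finset.sum_congr rfl fun C _ => ?_
  simp only [h.count_restrict_flow _ _ hT]
  have hmo : ∀ γ : A, Measurable fun t => Ψ t γ := fun γ => (continuous_orbit Ψ γ).measurable
  have hi : ∀ γ : {γ // r γ = base C}, Measurable fun t => T.indicator (1 : A → ℝ≥0∞) (Ψ t γ.1) :=
    fun γ => (measurable_one.indicator hT).comp (hmo γ.1)
  rw [lintegral_tsum fun γ => (hi γ).aemeasurable]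
  refine tsum_congr fun γ => ?_
  rw [Measure.map_apply (hmo γ.1) hT, ← lintegral_indicator_one (hmo γ.1 hT)]
  rfl

omit hbase [MeasurableSpace A] [BorelSpace A] [MeasurableSpace B] [BorelSpace B] in
theorem continuous_kernel_diag {f : A × ℝ → ℂ} (hf : IsTest Ψ f) :
    Continuous fun b => kernel φ s r f b b :=
  h.rotation.continuous_of_orbit fun b => (h.contDiff_kernel hf b b).continuous.comp
    (continuous_id.prodMk continuous_id)

theorem kernelTrace_eq_sum [Fintype (ConnectedComponents B)] {f : A × ℝ → ℂ} (hf : IsTest Ψ f) :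
    kernelTrace φ s r base f = ∑ C, ∫ t in Ico 0 (periodAt φ (base C)),
      kernel φ s r f (φ t (base C)) (φ t (base C)) :=
  integral_lebesgue hbase (h.continuous_kernel_diag hf)

/-- The pullback measure is Lebesgue measure on orbits. At time `t` on the orbit of an arrow over
`base C`, the range has coordinate `t`, and the times in the integrand are those of the
automorphisms at that point. Summation over orbits and periods gives the kernel on the diagonal,
with finitely many nonzero terms. -/
theorem hasSum_trace {f : A × ℝ → ℂ} (hf : IsTest Ψ f) :
    (∀ (C : ConnectedComponents B) (m : ℤ), IntegrableOn
      (fun γ => f (γ, m * periodAt φ (base C) + coordinate φ base (r γ)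
        - coordinate φ base (s γ)))
      {γ | (s γ : ConnectedComponents B) = C ∧ (r γ : ConnectedComponents B) = C}
      ((lebesgue φ base).bind fun b => Measure.count.restrict {γ : A | r γ = b})) ∧
    HasSum (fun x : ConnectedComponents B × ℤ =>
      ∫ γ in {γ | (s γ : ConnectedComponents B) = x.1 ∧ (r γ : ConnectedComponents B) = x.1},
        f (γ, x.2 * periodAt φ (base x.1) + coordinate φ base (r γ) - coordinate φ base (s γ))
        ∂((lebesgue φ base).bind fun b => Measure.count.restrict {γ : A | r γ = b}))
      (kernelTrace φ s r base f) := by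
  classical
  have := h.rotation.finite_components
  have := Fintype.ofFinite (ConnectedComponents B)
  have := h.secondCountableTopology hbase
  have hc : ∀ C, Countable {γ // r γ = base C} := fun C => (h.countable (base C)).to_subtype
  rw [h.bind_count_eq hbase, h.kernelTrace_eq_sum hbase hf]
  set N := fun C => {γ : A | (s γ : ConnectedComponents B) = C ∧ (r γ : ConnectedComponents B) = C}
    with hN
  have hcomp : ∀ C, IsClosed {b : B | (b : ConnectedComponents B) = C} := fun C => by
    have : {b : B | (b : ConnectedComponents B) = C} = connectedComponent (base C) := by
      ext b
      rw [← ConnectedComponents.coe_eq_coe', hbase]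
      rfl
    rw [this]
    exact isClosed_connectedComponent
  have hNm : ∀ C, MeasurableSet (N C) := fun C =>
    (((hcomp C).preimage h.continuous_src).inter ((hcomp C).preimage h.continuous_rng)).measurableSet
  set F := fun (C : ConnectedComponents B) (m : ℤ) (γ : A) =>
    f (γ, m * periodAt φ (base C) + coordinate φ base (r γ) - coordinate φ base (s γ)) with hF
  have hcm := h.rotation.measurable_coordinate hbase
  have hFm : ∀ C m, Measurable (F C m) := fun C m => (hf.continuous h).measurable.comp
    (measurable_id.prodMk ((measurable_const.add (hcm.comp h.continuous_rng.measurable)).sub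
      (hcm.comp h.continuous_src.measurable)))
  obtain ⟨R, hR⟩ := hf.compact.exists_bound_of_continuous (hf.continuous h)
  -- The arrows over the base-point whose orbits meet the support of `f` within one period.
  let T : ConnectedComponents B → Finset A := fun C => (h.finite_fiber
    (isCompact_sweep Ψ (isCompact_Icc (a := -periodAt φ (base C)) (b := 0))
      hf.isCompact_arrowSupport) (base C)).toFinset
  have hT : ∀ C γ, γ ∈ T C ↔ γ ∈ sweep Ψ (Icc (-periodAt φ (base C)) 0) (arrowSupport f) ∧
    r γ = base C := fun C γ => by simp [T]
  have hT0 : ∀ C γ, r γ = base C → γ ∉ T C → ∀ t ∈ Ico 0 (periodAt φ (base C)), ∀ u,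
      f (Ψ t γ, u) = 0 := by
    intro C γ hγ hγT t ht u
    by_contra hne
    refine hγT ((hT C γ).2 ⟨?_, hγ⟩)
    have := mem_sweep (ψ := Ψ) (J := Icc (-periodAt φ (base C)) 0) (t := -t)
      ⟨by linarith [ht.2], by linarith [ht.1]⟩ (mem_arrowSupport hne)
    rwa [flow_neg_flow] at this
  have key := fun C m => integrable_curveMeasure
    (c := fun (j : Σ C, {γ // r γ = base C}) t => Ψ t j.2.1) (fun j => continuous_orbit Ψ _)
    (p := fun j => periodAt φ (base j.1)) ((hFm C m).indicator (hNm C)) (R := R)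
    (fun γ => (norm_indicator_le_norm_self _ _).trans (hR _))
    (({C} : Finset _).sigma fun C => (T C).subtype fun γ => r γ = base C) (by
      rintro ⟨C', γ, hγ⟩ hj t ht
      by_cases hmem : Ψ t γ ∈ N C
      · rw [indicator_of_mem hmem]
        have e1 : C' = C := by rw [← hmem.2, h.rng_flow, hγ, h.rotation.coe_flow, hbase]
        subst e1
        refine hT0 C' γ hγ (fun hγT => hj ?_) t ht _
        simpa using hγT
      · exact indicator_of_notMem hmem _)
  refine ⟨fun C m => (integrable_indicator_iff (hNm C)).1 (key C m).1, ?_⟩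
  have hint : ∀ C m, ∫ γ in N C, F C m γ ∂(curveMeasure
      (fun (j : Σ C, {γ // r γ = base C}) t => Ψ t j.2.1) fun j => periodAt φ (base j.1)) =
      ∑ γ ∈ T C, ∫ t in Ico 0 (periodAt φ (base C)), (N C).indicator (F C m) (Ψ t γ) := fun C m => by
    rw [← integral_indicator (hNm C), (key C m).2, Finset.sum_sigma, Finset.sum_singleton]
    exact Finset.sum_subtype_of_mem (fun γ => ∫ t in Ico 0 (periodAt φ (base C)),
      (N C).indicator (F C m) (Ψ t γ)) fun γ hγ => ((hT C γ).1 hγ).2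
  choose M hM using fun C : ConnectedComponents B =>
    exists_finset_periods (h.rotation.periodAt_pos (base C)) hf.isCompact_timeSupport
  -- The coordinates of range and source differ by less than a period, so finitely many `m` suffice;
  -- one finite set serves all components.
  have hM0 : ∀ C, ∀ m ∉ Finset.univ.biUnion M, ∀ γ ∈ N C, F C m γ = 0 := by
    intro C m hm γ hγ
    by_contra hne
    have h1 := mem_timeSupport hne
    rw [add_sub_assoc] at h1
    refine hM C m (fun hmC => hm (Finset.mem_biUnion.2 ⟨C, Finset.mem_univ _, hmC⟩)) _
      (h.coordinate_mem_Ioo hbase hγ.1 ?_) h1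
    have := h.rotation.coordinate_mem hbase (r γ)
    rwa [hγ.2] at this
  have hsum := hasSum_sum_of_ne_finset_zero (L := .unconditional _)
    (s := Finset.univ ×ˢ Finset.univ.biUnion M)
    (f := fun x : ConnectedComponents B × ℤ => ∫ γ in N x.1, F x.1 x.2 γ ∂(curveMeasure
      (fun (j : Σ C, {γ // r γ = base C}) t => Ψ t j.2.1) fun j => periodAt φ (base j.1))) (by
    intro x hx
    refine setIntegral_eq_zero_of_forall_eq_zero fun γ hγ => hM0 x.1 x.2 (fun hm => hx ?_) γ hγ
    exact Finset.mem_product.2 ⟨Finset.mem_univ _, hm⟩)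
  rw [Finset.sum_product] at hsum
  have transfer : ∀ {a b : ℂ} {G : ConnectedComponents B × ℤ → ℂ}, a = b → HasSum G a → HasSum G b :=
    fun h1 h2 => h1 ▸ h2
  refine transfer (Finset.sum_congr rfl fun C _ => ?_) hsum
  simp only [hint]
  have hii : ∀ m γ, IntegrableOn (fun t => (N C).indicator (F C m) (Ψ t γ))
      (Ico 0 (periodAt φ (base C))) := fun m γ =>
    Measure.integrableOn_of_bounded (M := R) (by simp)
      (((hFm C m).indicator (hNm C)).comp (continuous_orbit Ψ γ).measurable).aestronglyMeasurable
      (Filter.Eventually.of_forall fun t => (norm_indicator_le_norm_self _ _).trans (hR _))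
  rw [Finset.sum_comm, ← Finset.sum_congr rfl fun γ _ => integral_finsetSum _ fun m _ => hii m γ,
    ← integral_finsetSum _ fun γ _ => integrable_finsetSum _ fun m _ => hii m γ]
  refine setIntegral_congr_fun measurableSet_Ico fun t ht => ?_
  -- The kernel at `φ t (base C)` is written over arrows `Ψ t γ` with `γ` in `T C`; those with
  -- source on another circle are removed by the indicator on the other side.
  rw [h.kernel_eq_sum_periods hbase C t
    (((T C).filter fun γ => (s γ : ConnectedComponents B) = C).image (Ψ t)) (Finset.univ.biUnion M),
    Finset.sum_image (flow_injective Ψ t).injOn, Finset.sum_filter]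
  · refine Finset.sum_congr rfl fun γ hγ => ?_
    have hrγ := ((hT C γ).1 hγ).2
    split_ifs with hsC
    · refine Finset.sum_congr rfl fun m _ => ?_
      rw [indicator_of_mem]
      · simp only [hF, h.rng_flow, hrγ, h.rotation.isLeast_coordinate hbase C ht]
        congr 2
        ring
      · exact ⟨by rw [h.src_flow, h.rotation.coe_flow, hsC],
          by rw [h.rng_flow, h.rotation.coe_flow, hrγ, hbase]⟩
    · refine Finset.sum_eq_zero fun m _ => indicator_of_notMem (fun hmem => hsC ?_) _
      rw [← hmem.1, h.src_flow, h.rotation.coe_flow]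
  · intro γ' hγ'
    obtain ⟨γ, hγ, rfl⟩ := Finset.mem_image.1 hγ'
    have h1 := Finset.mem_filter.1 hγ
    exact ⟨by rw [h.rng_flow, ((hT C γ).1 h1.1).2], by rw [h.src_flow, h.rotation.coe_flow, h1.2]⟩
  · intro γ hγ hγC m hm
    have e1 : m * periodAt φ (base C) - coordinate φ base (s γ) + t = m * periodAt φ (base C)
        + coordinate φ base (r γ) - coordinate φ base (s γ) := by
      rw [hγ, h.rotation.isLeast_coordinate hbase C ht]
      ring
    rcases hm with hm | hm
    · have e2 := hT0 C (Ψ (-t) γ) (by rw [h.rng_flow, hγ, flow_neg_flow]) (fun hmem => hm ?_) t ht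
      · rw [← e2, flow_flow_neg]
      · refine Finset.mem_image.2 ⟨_, Finset.mem_filter.2 ⟨hmem, ?_⟩, flow_flow_neg Ψ t γ⟩
        rw [h.src_flow, h.rotation.coe_flow, hγC]
    · rw [e1]
      exact hM0 C m hm γ ⟨hγC, by rw [hγ, h.rotation.coe_flow, hbase]⟩

omit hbase [MeasurableSpace B] [BorelSpace B] [MeasurableSpace A] [BorelSpace A] [CompactSpace B] in
theorem countable_arrowsBetween (b b' : B) : (arrowsBetween φ s r b b').Countable := by
  have h1 : arrowsBetween φ s r b b' ⊆
      ⋃ γ ∈ {γ | r γ = b}, ⋃ N : ℕ, ({γ} ×ˢ Icc (-(N : ℝ)) N) ∩ arrowsBetween φ s r b b' := by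
    intro g hg
    obtain ⟨N, hN⟩ := exists_nat_ge |g.2|
    exact mem_iUnion₂.2 ⟨g.1, hg.1, mem_iUnion.2 ⟨N, ⟨rfl, abs_le.1 hN⟩, hg⟩⟩
  refine Set.Countable.mono h1 ((h.countable b).biUnion fun γ _ => countable_iUnion fun N => ?_)
  exact (h.finite_arrowsBetween (isCompact_singleton.prod isCompact_Icc) b b').countable

theorem integral_isotropyMeasure [Fintype (ConnectedComponents B)] {F : A × ℝ → ℂ}
    (hF : Measurable F) {R : ℝ} (hR : ∀ x, ‖F x‖ ≤ R) (T : ConnectedComponents B → Finset (A × ℝ))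
    (hT : ∀ C, ∀ g ∈ T C, g ∈ arrowsBetween φ s r (base C) (base C))
    (h0 : ∀ C, ∀ g ∈ arrowsBetween φ s r (base C) (base C), g ∉ T C →
      ∀ t ∈ Ico 0 (periodAt φ (base C)), F (Ψ t g.1, g.2) = 0) :
    Integrable F (isotropyMeasure φ Ψ s r base) ∧ ∫ x, F x ∂(isotropyMeasure φ Ψ s r base) =
      ∑ C, ∑ g ∈ T C, ∫ t in Ico 0 (periodAt φ (base C)), F (Ψ t g.1, g.2) := by
  classical
  have := h.secondCountableTopology hbase
  have hc : ∀ C, Countable (arrowsBetween φ s r (base C) (base C)) := fun C =>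
    (h.countable_arrowsBetween _ _).to_subtype
  have key := integrable_curveMeasure (c := isotropyCurve φ Ψ s r base)
    continuous_isotropyCurve (p := fun j => periodAt φ (base j.1)) hF hR
    (Finset.univ.sigma fun C => (T C).subtype (· ∈ arrowsBetween φ s r (base C) (base C))) (by
      rintro ⟨C, g, hg⟩ hj t ht
      refine h0 C g hg (fun hgT => hj ?_) t ht
      simpa using hgT)
  refine ⟨key.1, key.2.trans ?_⟩
  rw [Finset.sum_sigma]
  refine Finset.sum_congr rfl fun C _ => ?_
  exact Finset.sum_subtype_of_mem (fun g => ∫ t in Ico 0 (periodAt φ (base C)),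
    F (Ψ t g.1, g.2)) (hT C)

/-- When both points of the kernel move by the same time, the time component of each arrow stays
fixed, so the diagonal integral runs along the isotropy curves. -/
theorem kernelTrace_eq_integral {f : A × ℝ → ℂ} (hf : IsTest Ψ f) :
    kernelTrace φ s r base f = ∫ x, f x ∂(isotropyMeasure φ Ψ s r base) := by
  have := h.rotation.finite_components
  have := Fintype.ofFinite (ConnectedComponents B)
  have := h.secondCountableTopology hbase
  obtain ⟨R, hR⟩ := hf.compact.exists_bound_of_continuous (hf.continuous h)
  choose T hT hT0 hTk using fun C => h.exists_kernel_flow hf (base C) (base C)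
    (isCompact_Icc (a := 0) (b := periodAt φ (base C)))
    (isCompact_Icc (a := 0) (b := periodAt φ (base C)))
  rw [h.kernelTrace_eq_sum hbase hf, (h.integral_isotropyMeasure hbase
    (hf.continuous h).measurable hR T hT fun C g hg hgT t ht => by
      have := hT0 C g hg hgT t (Ico_subset_Icc_self ht) t (Ico_subset_Icc_self ht)
      rwa [add_sub_cancel_right] at this).2]
  refine Finset.sum_congr rfl fun C _ => ?_
  rw [← integral_finsetSum]
  · refine setIntegral_congr_fun measurableSet_Ico fun t ht => ?_
    rw [hTk C t (Ico_subset_Icc_self ht) t (Ico_subset_Icc_self ht)]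
    simp only [add_sub_cancel_right]
  · intro g _
    exact (((hf.continuous h).comp ((continuous_orbit Ψ g.1).prodMk
      continuous_const)).integrableOn_Icc).mono_set Ico_subset_Icc_self

theorem isLocallyFiniteMeasure_isotropyMeasure :
    IsLocallyFiniteMeasure (isotropyMeasure φ Ψ s r base) := by
  have := h.rotation.finite_components
  have := Fintype.ofFinite (ConnectedComponents B)
  have := h.secondCountableTopology hbase
  have := h.t2Space
  refine ⟨fun g => ?_⟩
  let K : Set (A × ℝ) := sweep Ψ (Icc (-1) 1) {g.1} ×ˢ Icc (g.2 - 1) (g.2 + 1)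
  have hK : IsCompact K := (isCompact_sweep Ψ isCompact_Icc isCompact_singleton).prod isCompact_Icc
  refine ⟨K, ?_, ?_⟩
  · refine prod_mem_nhds ?_ (Icc_mem_nhds (by linarith) (by linarith))
    rw [h.nhds_arrow]
    refine Filter.mem_map.2 ?_
    filter_upwards [Icc_mem_nhds (a := -1) (b := 1) (x := (0 : ℝ)) (by norm_num) (by norm_num)]
      with t ht using mem_sweep ht rfl
  · let K' : ConnectedComponents B → Set (A × ℝ) := fun C =>
      sweep Ψ (Icc (-periodAt φ (base C)) 0) (Prod.fst '' K) ×ˢ (Prod.snd '' K)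
    have hK' : ∀ C, IsCompact (K' C) := fun C =>
      (isCompact_sweep Ψ isCompact_Icc (hK.image continuous_fst)).prod (hK.image continuous_snd)
    -- Finitely many isotropy curves meet the compact neighbourhood `K` during their period, so its
    -- indicator is integrable and `K` has finite measure.
    have key := (h.integral_isotropyMeasure hbase
      ((measurable_const (a := (1 : ℂ))).indicator hK.measurableSet) (R := 1)
      (fun x => (norm_indicator_le_norm_self _ _).trans (by simp))
      (fun C => (h.finite_arrowsBetween (hK' C) (base C) (base C)).toFinset)
      (fun C g hg => ((Set.Finite.mem_toFinset _).1 hg).2) fun C g hg hgT t ht => by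
        refine indicator_of_notMem (fun hmem => hgT ((Set.Finite.mem_toFinset _).2 ⟨⟨?_, ?_⟩, hg⟩)) _
        · have := mem_sweep (ψ := Ψ) (J := Icc (-periodAt φ (base C)) 0) (t := -t)
            ⟨by linarith [ht.2], by linarith [ht.1]⟩ (mem_image_of_mem Prod.fst hmem)
          rwa [flow_neg_flow] at this
        · exact ⟨_, hmem, rfl⟩).1
    rw [integrable_indicator_iff hK.measurableSet, integrableOn_const_iff] at key
    simpa using key

theorem support_isotropyMeasure :
    (isotropyMeasure φ Ψ s r base).support = {g : A × ℝ | φ g.2 (s g.1) = r g.1} := by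
  have := h.secondCountableTopology hbase
  apply Subset.antisymm
  · refine support_curveMeasure_subset continuous_isotropyCurve h.isClosed_isotropy fun j t => ?_
    simp only [isotropyCurve, mem_ofPred_eq, h.src_flow, h.rng_flow]
    rw [flow_comm, j.2.2.2, j.2.2.1]
  · rintro ⟨γ, w⟩ hg
    obtain ⟨C, δ, hδ, t, ht, rfl⟩ := h.exists_base hbase γ
    refine mem_support_curveMeasure (c := isotropyCurve φ Ψ s r base)
      continuous_isotropyCurve (p := fun j => periodAt φ (base j.1)) ⟨C, (δ, w), hδ, ?_⟩ ht
    rw [mem_ofPred_eq, h.src_flow, h.rng_flow, flow_comm, flow_flow_eq_iff, hδ] at hg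
    exact hg

end IsFlowRelation

end Trace

/-! ### Traces of absolutely convergent series of rank one operators -/

section Nuclear

/-- Cauchy–Schwarz and Bessel. The bound is uniform in `F`, as dominated convergence requires. -/
theorem norm_sum_inner_mul_inner_le {H κ : Type*} [NormedAddCommGroup H] [InnerProductSpace ℂ H]
    {e : κ → H} (he : Orthonormal ℂ e) (F : Finset κ) (x y : H) :
    ‖∑ i ∈ F, inner ℂ x (e i) * inner ℂ (e i) y‖ ≤ ‖x‖ * ‖y‖ := by
  refine (norm_sum_le _ _).trans (abs_le_of_sq_le_sq' ?_ (by positivity)).2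
  have h1 := Finset.sum_mul_sq_le_sq_mul_sq F (fun i => ‖inner ℂ (e i) x‖) fun i => ‖inner ℂ (e i) y‖
  have h2 := he.sum_inner_products_le (s := F) x
  have h3 := he.sum_inner_products_le (s := F) y
  have h4 : ∀ i, ‖inner ℂ x (e i) * inner ℂ (e i) y‖ = ‖inner ℂ (e i) x‖ * ‖inner ℂ (e i) y‖ :=
    fun i => by rw [norm_mul, norm_inner_symm]
  simp only [h4]
  rw [mul_pow]
  exact h1.trans (mul_le_mul h2 h3 (Finset.sum_nonneg fun i _ => sq_nonneg _) (sq_nonneg _))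

/-- The trace of an absolutely convergent series of operators of rank one. -/
theorem hasSum_inner_tsum_rankOne {H J κ : Type*} [NormedAddCommGroup H] [InnerProductSpace ℂ H]
    [CompleteSpace H] {α β : J → H} (hs : Summable fun j => ‖α j‖ * ‖β j‖)
    (e : HilbertBasis κ ℂ H) :
    HasSum (fun i => inner ℂ (e i) ((∑' j, InnerProductSpace.rankOne ℂ (α j) (β j)) (e i)))
      (∑' j, inner ℂ (β j) (α j)) := by
  have hS : Summable fun j => InnerProductSpace.rankOne ℂ (α j) (β j) :=
    Summable.of_norm (by simpa only [InnerProductSpace.norm_rankOne] using hs)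
  have h1 : ∀ i, HasSum (fun j => inner ℂ (β j) (e i) * inner ℂ (e i) (α j))
      (inner ℂ (e i) ((∑' j, InnerProductSpace.rankOne ℂ (α j) (β j)) (e i))) := fun i => by
    have h2 := (hS.hasSum.mapL (ContinuousLinearMap.apply ℂ H (e i))).mapL (innerSL ℂ (e i))
    simpa [inner_smul_right] using h2
  have h2 : ∀ F : Finset κ,
      ∑ i ∈ F, inner ℂ (e i) ((∑' j, InnerProductSpace.rankOne ℂ (α j) (β j)) (e i)) =
      ∑' j, ∑ i ∈ F, inner ℂ (β j) (e i) * inner ℂ (e i) (α j) := fun F =>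
    (hasSum_sum fun i _ => h1 i).tsum_eq.symm
  rw [HasSum, SummationFilter.unconditional_filter]
  simp only [h2]
  -- Dominated convergence exchanges the limit over finite parts of the basis with the sum over `j`;
  -- Parseval gives the limit of each term.
  refine tendsto_tsum_of_dominated_convergence hs (fun j => e.hasSum_inner_mul_inner (β j) (α j))
    (Filter.Eventually.of_forall fun F j => ?_)
  rw [mul_comm]
  exact norm_sum_inner_mul_inner_le e.orthonormal F (β j) (α j)

variable {X : Type*} [TopologicalSpace X] [CompactSpace X] [MeasurableSpace X] [BorelSpace X]

theorem hasSum_integral_continuousMap (μ : Measure X) [IsFiniteMeasure μ] {J : Type*} [Countable J]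
    {g : J → C(X, ℂ)} {b : J → ℝ} (hb : Summable b) (hg : ∀ j x, ‖g j x‖ ≤ b j) {G : X → ℂ}
    (hG : ∀ x, HasSum (fun j => g j x) (G x)) :
    HasSum (fun j => ∫ x, g j x ∂μ) (∫ x, G x ∂μ) := by
  have hi : ∀ j, Integrable (fun x => g j x) μ := fun j =>
    Integrable.of_bound (g j).continuous.measurable.aestronglyMeasurable (b j)
      (Filter.Eventually.of_forall (hg j))
  have h1 := hasSum_integral_of_summable_integral_norm hi
    (Summable.of_nonneg_of_le (fun j => integral_nonneg fun x => norm_nonneg _) (fun j => by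
      refine (integral_mono (hi j).norm (integrable_const (b j)) (hg j)).trans_eq ?_
      rw [integral_const, smul_eq_mul]) (hb.mul_left (μ.real univ)))
  simpa only [fun x => (hG x).tsum_eq] using h1

/-- The operator is the norm convergent sum of the rank one operators with kernels `a j x * c j y`.
Their traces are the integrals of `c j * a j`, which add up to the integral of `k` over the
diagonal. -/
theorem exists_operatorTrace (μ : Measure X) [IsFiniteMeasure μ] {J : Type*} [Countable J]
    {a c : J → C(X, ℂ)} (hs : Summable fun j => ‖a j‖ * ‖c j‖) {k : X → X → ℂ}
    (hk : ∀ x y, HasSum (fun j => a j x * c j y) (k x y)) :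
    ∃ S : Lp ℂ 2 μ →L[ℂ] Lp ℂ 2 μ,
      (∀ (ξ : C(X, ℂ)) (u : Lp ℂ 2 μ), u =ᵐ[μ] ξ → S u =ᵐ[μ] fun x => ∫ y, k x y * ξ y ∂μ) ∧
      ∀ (κ : Type) (e : HilbertBasis κ ℂ (Lp ℂ 2 μ)),
        HasSum (fun i => inner ℂ (e i) (S (e i))) (∫ x, k x x ∂μ) := by
  let L := ContinuousMap.toLp (E := ℂ) 2 μ ℂ
  have hb : ∀ j x y, ‖a j x * c j y‖ ≤ ‖a j‖ * ‖c j‖ := fun j x y => by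
    rw [norm_mul]
    exact mul_le_mul ((a j).norm_coe_le_norm x) ((c j).norm_coe_le_norm y) (norm_nonneg _)
      (norm_nonneg _)
  have hs' : Summable fun j => ‖L (a j)‖ * ‖L (star (c j))‖ := by
    refine Summable.of_nonneg_of_le (fun j => by positivity) (fun j => ?_)
      (hs.mul_left (‖L‖ * ‖L‖))
    have h1 := L.le_opNorm (a j)
    have h2 := L.le_opNorm (star (c j))
    rw [norm_star] at h2
    calc _ ≤ (‖L‖ * ‖a j‖) * (‖L‖ * ‖c j‖) := mul_le_mul h1 h2 (norm_nonneg _) (by positivity)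
      _ = _ := by ring
  have hS : Summable fun j => InnerProductSpace.rankOne ℂ (L (a j)) (L (star (c j))) :=
    Summable.of_norm (by simpa only [InnerProductSpace.norm_rankOne] using hs')
  -- The inner product conjugates its first argument, and `star` undoes this.
  have hin : ∀ j (ξ : C(X, ℂ)), inner ℂ (L (star (c j))) (L ξ) = ∫ y, c j y * ξ y ∂μ :=
    fun j ξ => by
      rw [ContinuousMap.inner_toLp]
      refine integral_congr_ae (Filter.Eventually.of_forall fun y => ?_)
      simp [mul_comm]
  refine ⟨∑' j, InnerProductSpace.rankOne ℂ (L (a j)) (L (star (c j))), fun ξ u hu => ?_,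
    fun κ e => ?_⟩
  · have hu' : u = L ξ := Lp.ext (hu.trans (ContinuousMap.coeFn_toLp μ ξ).symm)
    have h1 := hS.hasSum.mapL (ContinuousLinearMap.apply ℂ (Lp ℂ 2 μ) (L ξ))
    simp only [ContinuousLinearMap.apply_apply, InnerProductSpace.rankOne_apply, hin] at h1
    have hsum : Summable fun j => (∫ y, c j y * ξ y ∂μ) • a j := by
      refine Summable.of_norm_bounded (g := fun j => ‖ξ‖ * μ.real univ * (‖a j‖ * ‖c j‖))
        (hs.mul_left _) fun j => ?_
      have h2 : ‖∫ y, c j y * ξ y ∂μ‖ ≤ ‖c j‖ * ‖ξ‖ * μ.real univ := by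
        refine norm_integral_le_of_norm_le_const (Filter.Eventually.of_forall fun y => ?_)
        rw [norm_mul]
        exact mul_le_mul ((c j).norm_coe_le_norm y) (ξ.norm_coe_le_norm y) (norm_nonneg _)
          (norm_nonneg _)
      rw [norm_smul]
      calc _ ≤ (‖c j‖ * ‖ξ‖ * μ.real univ) * ‖a j‖ :=
            mul_le_mul_of_nonneg_right h2 (norm_nonneg _)
        _ = _ := by ring
    have h2 := hsum.hasSum.mapL L
    simp only [map_smul] at h2
    rw [hu', h1.unique h2]
    refine (ContinuousMap.coeFn_toLp μ _).trans (Filter.Eventually.of_forall fun x => ?_)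
    have h3 := ContinuousMap.hasSum_apply hsum.hasSum x
    have h4 := hasSum_integral_continuousMap μ (g := fun j => a j x • (c j * ξ))
      (G := fun y => k x y * ξ y) (hs.mul_right ‖ξ‖) (fun j y => by
        have := mul_le_mul_of_nonneg_right (hb j x y) (norm_nonneg (ξ y))
        rw [← norm_mul] at this
        refine (le_of_eq ?_).trans (this.trans (mul_le_mul_of_nonneg_left (ξ.norm_coe_le_norm y)
          (by positivity)))
        simp [mul_assoc]) (fun y => by
        simpa [mul_assoc] using (hk x y).mul_right (ξ y))
    refine h3.unique (Eq.mp (congrArg (fun G => HasSum G _) (funext fun j => ?_)) h4)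
    simp only [ContinuousMap.smul_apply, ContinuousMap.mul_apply, smul_eq_mul]
    rw [integral_const_mul, mul_comm]
  · have h1 := hasSum_inner_tsum_rankOne hs' e
    have h2 := hasSum_integral_continuousMap μ (g := fun j => c j * a j)
      (G := fun x => k x x) hs (fun j x => by simpa [mul_comm] using hb j x x)
      (fun x => by simpa [mul_comm] using hk x x)
    simp only [hin] at h1
    rwa [show ∑' j, ∫ y, c j y * a j y ∂μ = _ from h2.tsum_eq] at h1

end Nuclear

/-! ### Decay of Fourier coefficients -/

section Fourier

theorem norm_fourierCoeffOn_le {p : ℝ} (hp : 0 < p) {f : ℝ → ℂ} {D : ℝ}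
    (hD : ∀ x ∈ Icc 0 p, ‖f x‖ ≤ D) (n : ℤ) : ‖fourierCoeffOn hp f n‖ ≤ D := by
  rw [fourierCoeffOn_eq_integral, norm_smul]
  have h1 := intervalIntegral.norm_integral_le_of_norm_le_const (a := 0) (b := p) (C := D)
    (f := fun x => fourier (-n) (x : AddCircle (p - 0)) • f x) fun x hx => by
      rw [uIoc_of_le hp.le] at hx
      rw [norm_smul, fourier_apply, Circle.norm_coe, one_mul]
      exact hD x ⟨hx.1.le, hx.2⟩
  rw [sub_zero, abs_of_pos hp] at h1
  rw [sub_zero, Real.norm_eq_abs, abs_of_pos (by positivity : 0 < 1 / p)]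
  calc 1 / p * _ ≤ 1 / p * (D * p) := mul_le_mul_of_nonneg_left (by simpa using h1) (by positivity)
    _ = D := by field_simp

theorem fourierCoeffOn_of_periodic {p : ℝ} (hp : 0 < p) {f f' : ℝ → ℂ}
    (hf : ∀ x, HasDerivAt f (f' x) x) (hf' : Continuous f') (hper : f p = f 0) {n : ℤ}
    (hn : n ≠ 0) :
    fourierCoeffOn hp f n = p / (2 * Real.pi * Complex.I * n) * fourierCoeffOn hp f' n := by
  rw [fourierCoeffOn_of_hasDerivAt hp hn (fun x _ => hf x) (hf'.intervalIntegrable _ _), hper]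
  simp only [sub_self, mul_zero, zero_sub, Complex.ofReal_zero, sub_zero]
  have h1 : (Real.pi : ℂ) ≠ 0 := by exact_mod_cast Real.pi_ne_zero
  have h2 : (n : ℂ) ≠ 0 := by exact_mod_cast hn
  have h3 := Complex.I_ne_zero
  field_simp

/-- Two integrations by parts, without boundary terms. Decay of order `1/n²` suffices for absolute
convergence. -/
theorem norm_fourierCoeffOn_le_div {p : ℝ} (hp : 0 < p) {f f' f'' : ℝ → ℂ}
    (hf : ∀ x, HasDerivAt f (f' x) x) (hf' : ∀ x, HasDerivAt f' (f'' x) x) (hf'' : Continuous f'')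
    (h0 : f p = f 0) (h1 : f' p = f' 0) {D : ℝ} (hD : ∀ x ∈ Icc 0 p, ‖f'' x‖ ≤ D) {n : ℤ}
    (hn : n ≠ 0) : ‖fourierCoeffOn hp f n‖ ≤ p ^ 2 * D * (1 / (n : ℝ) ^ 2) := by
  rw [fourierCoeffOn_of_periodic hp hf
    (continuous_iff_continuousAt.2 fun x => (hf' x).continuousAt) h0 hn,
    fourierCoeffOn_of_periodic hp hf' hf'' h1 hn, ← mul_assoc, norm_mul, ← sq, norm_pow]
  have h2 := norm_fourierCoeffOn_le hp hD n
  have hn' : 0 < |(n : ℝ)| := abs_pos.2 (by exact_mod_cast hn)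
  have h3 : ‖(p : ℂ) / (2 * Real.pi * Complex.I * n)‖ ≤ p / |(n : ℝ)| := by
    rw [norm_div]
    simp only [norm_mul, Complex.norm_real, Complex.norm_I, Complex.norm_intCast, Real.norm_eq_abs,
      abs_of_pos hp, abs_of_pos Real.pi_pos, Complex.norm_ofNat, mul_one]
    refine div_le_div_of_nonneg_left hp.le hn' ?_
    nlinarith [Real.pi_gt_three]
  have hD0 : 0 ≤ D := (norm_nonneg _).trans (hD 0 ⟨le_rfl, hp.le⟩)
  calc _ ≤ (p / |(n : ℝ)|) ^ 2 * D :=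
        mul_le_mul (pow_le_pow_left₀ (norm_nonneg _) h3 2) h2 (norm_nonneg _) (by positivity)
    _ = _ := by rw [div_pow, sq_abs]; ring

end Fourier

/-! ### Fourier expansion of smooth kernels -/

section FourierExpansion

theorem exists_partialDeriv {K : ℝ × ℝ → ℂ} (hK : ContDiff ℝ ∞ K) :
    ∃ K' : ℝ × ℝ → ℂ, ContDiff ℝ ∞ K' ∧ ∀ t x, HasDerivAt (fun x => K (t, x)) (K' (t, x)) x := by
  refine ⟨fun q => fderiv ℝ K q (0, 1),
    (hK.fderiv_right (m := ∞) (by simp)).clm_apply contDiff_const, fun t x => ?_⟩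
  exact ((hK.differentiable (by simp)) (t, x)).hasFDerivAt.comp_hasDerivAt x
    ((hasDerivAt_const x t).prodMk (hasDerivAt_id x))

theorem periodic_deriv {f f' : ℝ → ℂ} {p : ℝ} (hf : ∀ x, HasDerivAt f (f' x) x)
    (hp : Function.Periodic f p) : Function.Periodic f' p := fun x => by
  have h1 := (hf (x + p)).comp_add_const x p
  rw [show (fun x => f (x + p)) = f from funext hp] at h1
  exact h1.unique (hf x)

theorem fourierCoeff_lift_eq {p : ℝ} [Fact (0 < p)] (hp : 0 < p) {f : ℝ → ℂ}
    (hf : Function.Periodic f p) (n : ℤ) : fourierCoeff hf.lift n = fourierCoeffOn hp f n := by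
  rw [fourierCoeff_eq_intervalIntegral _ n 0, fourierCoeffOn_eq_integral]
  simp only [fourier_coe_apply, sub_zero, zero_add]
  rfl

variable {B : Type*} [TopologicalSpace B] [T2Space B] [CompactSpace B] {φ : Flow ℝ B}
  {base : ConnectedComponents B → B}

namespace IsRotationFlow

variable (h : IsRotationFlow φ) (hbase : ∀ C, (base C : ConnectedComponents B) = C)

include h

theorem continuous_fourierCoeffOn_kernel {k : B → B → ℂ}
    (hk : ∀ b b', ContDiff ℝ ∞ fun p : ℝ × ℝ => k (φ p.1 b) (φ p.2 b')) (n : ℤ) (b' : B) :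
    Continuous fun b => fourierCoeffOn (h.periodAt_pos b') (fun x => k b (φ x b')) n := by
  refine h.continuous_of_orbit fun b => ?_
  simp only [fourierCoeffOn_eq_integral]
  have h1 : Continuous (Function.uncurry fun t x : ℝ =>
      fourier (-n) (x : AddCircle (periodAt φ b' - 0)) • k (φ t b) (φ x b')) :=
    ((fourier (-n)).continuous.comp ((AddCircle.continuous_mk' _).comp continuous_snd)).smul
      (hk b b').continuous
  exact (intervalIntegral.continuous_parametric_intervalIntegral_of_continuous' h1 _ _).const_smul
    (1 / (periodAt φ b' - 0))

theorem periodic_kernel (k : B → B → ℂ) (b b' : B) :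
    Function.Periodic (fun x => k b (φ x b')) (periodAt φ b') := fun x => by
  have : φ (periodAt φ b') b' = b' := (h.flow_eq_self_iff b' _).2 ⟨1, by simp⟩
  simp only [φ.map_add, this]

include hbase

/-- The bound has to be uniform in `b`, because sup norms are summed later. The second derivative in
the second variable is bounded on a compact box for each of the finitely many components of `b`. -/
theorem exists_norm_fourierCoeffOn_le {k : B → B → ℂ}
    (hk : ∀ b b', ContDiff ℝ ∞ fun p : ℝ × ℝ => k (φ p.1 b) (φ p.2 b'))
    (C : ConnectedComponents B) : ∃ D : ℝ, 0 ≤ D ∧ ∀ n : ℤ, n ≠ 0 → ∀ b,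
      ‖fourierCoeffOn (h.periodAt_pos (base C)) (fun x => k b (φ x (base C))) n‖ ≤
        D * (1 / (n : ℝ) ^ 2) := by
  have := h.finite_components
  choose K₁ hK₁ hd₁ using fun C' => exists_partialDeriv (hk (base C') (base C))
  choose K₂ hK₂ hd₂ using fun C' => exists_partialDeriv (hK₁ C')
  choose R hR using fun C' => (isCompact_Icc (a := 0) (b := periodAt φ (base C'))).prod
    (isCompact_Icc (a := 0) (b := periodAt φ (base C)))
    |>.exists_bound_of_continuousOn (hK₂ C').continuous.continuousOn
  obtain ⟨D, hD⟩ := Finite.exists_le R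
  refine ⟨periodAt φ (base C) ^ 2 * |D|, by positivity, fun n hn b => ?_⟩
  obtain ⟨t, ht, htb⟩ := h.exists_mem_Ico hbase b
  rw [← htb]
  have h0 := h.periodic_kernel k (φ t (base b)) (base C)
  have h1 := periodic_deriv (hd₁ b t) h0
  have e0 := h0 0
  have e1 := h1 0
  simp only [zero_add] at e0 e1
  exact norm_fourierCoeffOn_le_div (h.periodAt_pos (base C)) (hd₁ b t) (hd₂ b t)
    ((hK₂ b).continuous.comp (Continuous.prodMk_right t)) e0 e1
    (fun x hx => (hR b (t, x) ⟨Ico_subset_Icc_self ht, hx⟩).trans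
      ((hD _).trans (le_abs_self D))) hn

/-- The coordinate jumps at the base-point, but not modulo the period; so the characters of the
circle are continuous on `B`. -/
theorem coordinate_flow_eq {b : B} {C : ConnectedComponents B} (hb : (b : ConnectedComponents B) = C)
    (t : ℝ) : ((coordinate φ base (φ t b) : ℝ) : AddCircle (periodAt φ (base C))) =
      (coordinate φ base b + t : ℝ) := by
  have h1 := h.flow_coordinate hbase (φ t b)
  have h2 := h.flow_coordinate hbase b
  rw [h.coe_flow, hb] at h1
  rw [hb] at h2
  conv_rhs at h1 => rw [← h2, ← φ.map_add]
  rw [flow_eq_flow_iff, h.flow_eq_self_iff] at h1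
  obtain ⟨m, hm⟩ := h1
  refine QuotientAddGroup.eq_iff_sub_mem.2 (AddSubgroup.mem_zmultiples_iff.2 ⟨m, ?_⟩)
  rw [zsmul_eq_mul]
  linarith

open Classical in
theorem continuous_character (C : ConnectedComponents B) (n : ℤ) :
    Continuous fun b : B => if (b : ConnectedComponents B) = C then
      fourier n ((coordinate φ base b : ℝ) : AddCircle (periodAt φ (base C))) else 0 := by
  refine h.continuous_of_orbit fun b => ?_
  simp only [h.coe_flow]
  split_ifs with hb
  · simp only [h.coordinate_flow_eq hbase hb]
    exact (fourier n).continuous.comp ((AddCircle.continuous_mk' _).comp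
      (continuous_const.add continuous_id))
  · exact continuous_const

/-- A smooth kernel is an absolutely convergent series of products of functions. -/
theorem exists_hasSum_kernel {k : B → B → ℂ}
    (hk : ∀ b b', ContDiff ℝ ∞ fun p : ℝ × ℝ => k (φ p.1 b) (φ p.2 b')) :
    ∃ a c : ConnectedComponents B × ℤ → C(B, ℂ), (Summable fun j => ‖a j‖ * ‖c j‖) ∧
      ∀ b b', HasSum (fun j => a j b * c j b') (k b b') := by
  classical
  have := h.finite_components
  let a : ConnectedComponents B × ℤ → C(B, ℂ) := fun j => 
    ⟨_, h.continuous_fourierCoeffOn_kernel hk j.2 (base j.1)⟩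
  let c : ConnectedComponents B × ℤ → C(B, ℂ) := fun j => 
    ⟨_, h.continuous_character hbase j.1 j.2⟩
  have hc : ∀ j, ‖c j‖ ≤ 1 := fun j => (ContinuousMap.norm_le _ zero_le_one).2 fun b => by
    change ‖if (b : ConnectedComponents B) = j.1 then _ else _‖ ≤ _
    split_ifs
    · rw [fourier_apply, Circle.norm_coe]
    · simp
  have hs : Summable fun j => ‖a j‖ := by
    refine (summable_prod_of_nonneg fun j => norm_nonneg _).2 ⟨fun C => ?_,
      summable_of_hasFiniteSupport (Set.toFinite _)⟩
    obtain ⟨D, hD0, hD⟩ := h.exists_norm_fourierCoeffOn_le hbase hk C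
    -- The estimate says nothing for `n = 0`, and a single term does not affect summability.
    refine Summable.of_norm_bounded_eventually
      ((Real.summable_one_div_int_pow.2 one_lt_two).mul_left D) ?_
    filter_upwards [(Set.finite_singleton (0 : ℤ)).compl_mem_cofinite] with n hn
    rw [norm_norm]
    exact (ContinuousMap.norm_le _ (by positivity)).2 fun b => hD n hn b
  refine ⟨a, c, Summable.of_nonneg_of_le (fun j => by positivity) (fun j =>
    mul_le_of_le_one_right (norm_nonneg _) (hc j)) hs, fun b b' => ?_⟩
  set C : ConnectedComponents B := (b' : ConnectedComponents B) with hC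
  have hp := h.periodAt_pos (base C)
  have : Fact (0 < periodAt φ (base C)) := ⟨hp⟩
  have hinj : Function.Injective fun n : ℤ => (C, n) := fun m n e => (Prod.ext_iff.1 e).2
  -- Characters of other components vanish at `b'`. The remaining terms are the Fourier series of `k
  -- b` on the circle of `b'`.
  rw [← hinj.hasSum_iff]
  · have hper := h.periodic_kernel k b (base C)
    have hcont : Continuous hper.lift := by
      refine continuous_quot_lift _ ?_
      have := (hk b (base C)).continuous.comp (Continuous.prodMk_right (0 : ℝ))
      simpa [Function.comp_def, φ.map_zero_apply] using this
    have h1 : ∀ n, fourierCoeff (ContinuousMap.mk _ hcont) n = a (C, n) b := fun n =>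
      fourierCoeff_lift_eq hp hper n
    have h2 : Summable (fourierCoeff (ContinuousMap.mk _ hcont)) := by
      refine Summable.of_norm_bounded (g := fun n => ‖a (C, n)‖) (hs.comp_injective hinj) fun n => ?_
      rw [h1]
      exact (a (C, n)).norm_coe_le_norm b
    have h3 := has_pointwise_sum_fourier_series_of_summable h2
      ((coordinate φ base b' : ℝ) : AddCircle (periodAt φ (base C)))
    have h4 : ContinuousMap.mk _ hcont ((coordinate φ base b' : ℝ) : AddCircle (periodAt φ (base C)))
        = k b b' := by
      change k b (φ (coordinate φ base b') (base C)) = _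
      rw [hC, h.flow_coordinate hbase]
    rw [h4] at h3
    refine Eq.mp (congrArg (fun G => HasSum G _) (funext fun n => ?_)) h3
    rw [h1, smul_eq_mul, Function.comp_apply]
    congr 1
    exact (if_pos rfl).symm
  · rintro ⟨C', n⟩ hj
    have : ¬ (b' : ConnectedComponents B) = C' := fun e => hj ⟨n, Prod.ext e rfl⟩
    have h5 : c (C', n) b' = 0 := if_neg this
    rw [h5, mul_zero]

end IsRotationFlow

end FourierExpansion

/-! ### Linearity of the action and of the trace -/

section Bilinear

variable {A B : Type*} [TopologicalSpace A] [TopologicalSpace B] {φ : Flow ℝ B} {Ψ : Flow ℝ A}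
  {s r : A → B}

theorem act_smul_left {Z : Type*} {a : Z → B} {D : A → ℝ → Z → Z} (c : ℂ) (f : A × ℝ → ℂ)
    (ξ : Z → ℂ) (z : Z) : act r a D (c • f) ξ z = c * act r a D f ξ z := by
  unfold act
  simp only [Pi.smul_apply, smul_eq_mul, mul_assoc, integral_const_mul, tsum_mul_left]

theorem act_smul_right {Z : Type*} {a : Z → B} {D : A → ℝ → Z → Z} (c : ℂ) (f : A × ℝ → ℂ)
    (ξ : Z → ℂ) (z : Z) : act r a D f (c • ξ) z = c * act r a D f ξ z := by
  unfold act
  simp only [Pi.smul_apply, smul_eq_mul, mul_left_comm _ c, integral_const_mul, tsum_mul_left]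

namespace IsFlowRelation

variable [T2Space B] (h : IsFlowRelation φ Ψ s r)

include h

theorem act_eq_sum_of_isCompact {Z : Type*} {a : Z → B} {D : A → ℝ → Z → Z} {f : A × ℝ → ℂ}
    {ξ : Z → ℂ} {z : Z} {K : Set A} (hK : IsCompact K) (hfK : ∀ γ t, f (γ, t) ≠ 0 → γ ∈ K) :
    act r a D f ξ z = ∑ γ ∈ (h.finite_fiber hK (a z)).toFinset, ∫ t, f (γ, t) * ξ (D γ t z) := by
  refine act_eq_sum _ (fun γ hγ => ((Set.Finite.mem_toFinset _).1 hγ).2) fun γ hγ hγS t => ?_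
  by_contra hne
  exact hγS ((Set.Finite.mem_toFinset _).2 ⟨hfK γ t (left_ne_zero_of_mul hne), hγ⟩)

theorem integrable_act {Z : Type*} {D : A → ℝ → Z → Z} {f : A × ℝ → ℂ} (hf : IsTest Ψ f)
    {ξ : Z → ℂ} {z : Z} {γ : A} (hξ : Continuous fun t => ξ (D γ t z)) :
    Integrable fun t => f (γ, t) * ξ (D γ t z) := by
  refine ((hf.continuous_time h γ).mul hξ).integrable_of_hasCompactSupport ?_
  refine HasCompactSupport.intro hf.isCompact_timeSupport fun t ht => ?_
  by_contra hne
  exact ht (mem_timeSupport (left_ne_zero_of_mul hne))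

theorem act_add_left {Z : Type*} {a : Z → B} {D : A → ℝ → Z → Z} {f f' : A × ℝ → ℂ}
    (hf : IsTest Ψ f) (hf' : IsTest Ψ f') {ξ : Z → ℂ} {z : Z}
    (hξ : ∀ γ, r γ = a z → Continuous fun t => ξ (D γ t z)) :
    act r a D (f + f') ξ z = act r a D f ξ z + act r a D f' ξ z := by
  have hK := hf.isCompact_arrowSupport.union hf'.isCompact_arrowSupport
  rw [h.act_eq_sum_of_isCompact (f := f) hK fun γ t hne => Or.inl (mem_arrowSupport hne),
    h.act_eq_sum_of_isCompact (f := f') hK fun γ t hne => Or.inr (mem_arrowSupport hne),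
    h.act_eq_sum_of_isCompact (f := f + f') hK fun γ t hne => ?_, ← Finset.sum_add_distrib]
  · refine Finset.sum_congr rfl fun γ hγ => ?_
    have hγ' := hξ γ ((Set.Finite.mem_toFinset _).1 hγ).2
    rw [← integral_add (h.integrable_act hf hγ') (h.integrable_act hf' hγ')]
    simp only [Pi.add_apply, add_mul]
  · by_cases hne' : f (γ, t) = 0
    · refine Or.inr (mem_arrowSupport (t := t) fun h0 => hne ?_)
      rw [Pi.add_apply, hne', h0, add_zero]
    · exact Or.inl (mem_arrowSupport hne')

theorem act_add_right {Z : Type*} {a : Z → B} {D : A → ℝ → Z → Z} {f : A × ℝ → ℂ}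
    (hf : IsTest Ψ f) {ξ ξ' : Z → ℂ} {z : Z}
    (hξ : ∀ γ, r γ = a z → Continuous fun t => ξ (D γ t z))
    (hξ' : ∀ γ, r γ = a z → Continuous fun t => ξ' (D γ t z)) :
    act r a D f (ξ + ξ') z = act r a D f ξ z + act r a D f ξ' z := by
  have hK := hf.isCompact_arrowSupport
  rw [h.act_eq_sum_of_isCompact (ξ := ξ) hK fun γ t hne => mem_arrowSupport hne,
    h.act_eq_sum_of_isCompact (ξ := ξ') hK fun γ t hne => mem_arrowSupport hne,
    h.act_eq_sum_of_isCompact (ξ := ξ + ξ') hK fun γ t hne => mem_arrowSupport hne,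
    ← Finset.sum_add_distrib]
  refine Finset.sum_congr rfl fun γ hγ => ?_
  have hγ' := ((Set.Finite.mem_toFinset _).1 hγ).2
  rw [← integral_add (h.integrable_act hf (hξ γ hγ')) (h.integrable_act hf (hξ' γ hγ'))]
  simp only [Pi.add_apply, mul_add]

theorem continuous_translate {f : A × ℝ → ℂ} (hf : IsTest Ψ f) (γ : A) (x : A × ℝ) :
    Continuous fun t => f (translate Ψ s r γ t x) :=
  (hf.continuous h).comp ((continuous_orbit Ψ _).prodMk (continuous_const.sub continuous_id))

theorem kernelTrace_add [CompactSpace B] [MeasurableSpace B] [BorelSpace B]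
    {base : ConnectedComponents B → B} (hbase : ∀ C, (base C : ConnectedComponents B) = C)
    {f g : A × ℝ → ℂ} (hf : IsTest Ψ f) (hg : IsTest Ψ g) :
    kernelTrace φ s r base (f + g) = kernelTrace φ s r base f + kernelTrace φ s r base g := by
  have := h.rotation.isFiniteMeasure_lebesgue hbase
  have hi : ∀ {f}, IsTest Ψ f → Integrable (fun b => kernel φ s r f b b) (lebesgue φ base) :=
    fun {f} hf => by
      have hc := h.continuous_kernel_diag hf
      obtain ⟨M, hM⟩ := isCompact_univ.exists_bound_of_continuousOn hc.continuousOn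
      exact Integrable.of_bound hc.measurable.aestronglyMeasurable M
        (Filter.Eventually.of_forall fun b => hM b (mem_univ b))
  unfold kernelTrace
  rw [← integral_add (hi hf) (hi hg)]
  simp only [h.kernel_add hf hg]

end IsFlowRelation

theorem kernelTrace_smul [MeasurableSpace B] (base : ConnectedComponents B → B) (c : ℂ)
    (f : A × ℝ → ℂ) : kernelTrace φ s r base (c • f) = c * kernelTrace φ s r base f := by
  unfold kernelTrace
  simp only [kernel_smul, integral_const_mul]

end Bilinear

/-! ### The algebra, the representation and the trace for `H_B` -/

section Assembly

variable {n : ℕ} {V : Type*} [TopologicalSpace V] [T2Space V] [CompactSpace V]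
  [ChartedSpace (Model n) V] [IsManifold 𝓘(ℝ, Model n) ∞ V] {φ : Flow ℝ V}
  {B : Type*} [TopologicalSpace B] [T2Space B] [CompactSpace B] [ChartedSpace ℝ B]
  [IsManifold 𝓘(ℝ, ℝ) ∞ B] {ι : B → V} {φb : Flow ℝ B}

namespace IsTransverseSystem

variable (D : IsTransverseSystem n φ ι φb)

include D

theorem isTest (f : testFunctions n ι) : IsTest D.arrowFlow (f : CrossedProduct n ι → ℂ) :=
  ⟨D.smoothOnG_iff.1 f.2.1, f.2.2⟩

theorem mem_testFunctions {f : CrossedProduct n ι → ℂ} (hf : IsTest D.arrowFlow f) :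
    f ∈ testFunctions n ι := ⟨D.smoothOnG_iff.2 hf.smooth, hf.compact⟩

/-- A factorization `γ₁ γ₂ = γ` is determined by `γ₁`, since `γ₂ = γ₁⁻¹ γ`; so the sum over
factorizations is a sum over a fibre of the range map. -/
theorem convolution_eq (f g : CrossedProduct n ι → ℂ) :
    convolution φb f g = conv D.arrowFlow Arrow.src Arrow.rng f g := by
  have h := D.isFlowRelation
  funext x
  let e : {γ : Arrow n ι // γ.rng = x.1.rng} ≃
      {p : Arrow n ι × Arrow n ι // IsComp p.1 p.2 x.1} :=
    { toFun := fun γ => ⟨(γ.1, ldiv Arrow.src Arrow.rng γ.1 x.1), D.isComp_iff.2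
        ⟨(h.rng_ldiv γ.2).symm, (h.src_ldiv γ.2).symm, γ.2.symm⟩⟩
      invFun := fun p => ⟨p.1.1, (D.isComp_iff.1 p.2).2.2.symm⟩
      left_inv := fun γ => rfl
      right_inv := fun p => by
        have hp := D.isComp_iff.1 p.2
        refine Subtype.ext (Prod.ext rfl (h.ext _ _ ?_ ?_))
        · exact (h.src_ldiv hp.2.2.symm).trans hp.2.1
        · exact (h.rng_ldiv hp.2.2.symm).trans hp.1 }
  unfold convolution conv act
  rw [← e.tsum_eq]
  refine tsum_congr fun γ => ?_
  simp only [D.liftedFlow_eq]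
  rfl

omit [T2Space V] [CompactSpace V] [T2Space B] [CompactSpace B] [IsManifold 𝓘(ℝ, Model n) ∞ V]
  [IsManifold 𝓘(ℝ, ℝ) ∞ B] D in
theorem action_eq (f : CrossedProduct n ι → ℂ) (ξ : B → ℂ) : action φb f ξ =
    act Arrow.rng (fun b => b) (fun γ t _ => φb t γ.src) f ξ := rfl

theorem continuous_source (ξ : smoothFunctions B) (γ : Arrow n ι) :
    Continuous fun t => (ξ : B → ℂ) (φb t γ.src) :=
  (D.contDiff_orbit ξ.2 γ.src).continuous

theorem action_mem (f : testFunctions n ι) (ξ : smoothFunctions B) :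
    action φb (f : CrossedProduct n ι → ℂ) ξ ∈ smoothFunctions B := by
  have h := D.isFlowRelation
  refine D.contMDiff_of_orbit fun b => ?_
  rw [action_eq]
  refine h.contDiff_act (D.isTest f) (w := fun t : ℝ => t) contDiff_id
    (z := fun t => φb t b) (fun t => rfl) fun γ hγ => ?_
  simp only [h.src_flow, ← φb.map_add]
  exact (D.contDiff_orbit ξ.2 γ.src).comp (contDiff_snd.add contDiff_fst)

/-- The convolution product of test functions. -/
noncomputable def mul : testFunctions n ι →ₗ[ℂ] testFunctions n ι →ₗ[ℂ] testFunctions n ι :=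
  LinearMap.mk₂ ℂ (fun f g => ⟨convolution φb (f : CrossedProduct n ι → ℂ) g, by
      rw [D.convolution_eq]
      exact D.mem_testFunctions (D.isFlowRelation.isTest_conv (D.isTest f) (D.isTest g))⟩)
    (fun f f' g => Subtype.ext <| funext fun x => by
      simp only [D.convolution_eq]
      exact D.isFlowRelation.act_add_left (D.isTest f) (D.isTest f') fun γ _ =>
        D.isFlowRelation.continuous_translate (D.isTest g) γ x)
    (fun c f g => Subtype.ext <| funext fun x => by
      simp only [D.convolution_eq]
      exact act_smul_left c _ _ _)
    (fun f g g' => Subtype.ext <| funext fun x => by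
      simp only [D.convolution_eq]
      exact D.isFlowRelation.act_add_right (D.isTest f)
        (fun γ _ => D.isFlowRelation.continuous_translate (D.isTest g) γ x) fun γ _ =>
        D.isFlowRelation.continuous_translate (D.isTest g') γ x)
    (fun c f g => Subtype.ext <| funext fun x => by
      simp only [D.convolution_eq]
      exact act_smul_right c _ _ _)

/-- The representation of the convolution algebra on smooth functions. -/
noncomputable def rep : testFunctions n ι →ₗ[ℂ] Module.End ℂ (smoothFunctions B) :=
  LinearMap.mk₂ ℂ (fun f ξ => ⟨action φb (f : CrossedProduct n ι → ℂ) ξ, D.action_mem f ξ⟩)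
    (fun f f' ξ => Subtype.ext <| funext fun _ => by
      simp only [action_eq]
      exact D.isFlowRelation.act_add_left (D.isTest f) (D.isTest f') fun γ _ =>
        D.continuous_source ξ γ)
    (fun c f ξ => Subtype.ext <| funext fun _ => by
      simp only [action_eq]
      exact act_smul_left c _ _ _)
    (fun f ξ ξ' => Subtype.ext <| funext fun _ => by
      simp only [action_eq]
      exact D.isFlowRelation.act_add_right (D.isTest f)
        (fun γ _ => D.continuous_source ξ γ) fun γ _ => D.continuous_source ξ' γ)
    (fun c f ξ => Subtype.ext <| funext fun _ => by
      simp only [action_eq]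
      exact act_smul_right c _ _ _)

variable [MeasurableSpace B] [BorelSpace B] {base : ConnectedComponents B → B}
  (hbase : ∀ C, (base C : ConnectedComponents B) = C)

/-- The trace on the convolution algebra. -/
noncomputable def tr : testFunctions n ι →ₗ[ℂ] ℂ where
  toFun f := kernelTrace φb Arrow.src Arrow.rng base (f : CrossedProduct n ι → ℂ)
  map_add' f g := D.isFlowRelation.kernelTrace_add hbase (D.isTest f) (D.isTest g)
  map_smul' c _ := kernelTrace_smul base c _

include hbase

theorem rep_apply (f : testFunctions n ι) (ξ : smoothFunctions B) (b : B) :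
    (D.rep f ξ : B → ℂ) b = ∫ b', kernel φb Arrow.src Arrow.rng (f : CrossedProduct n ι → ℂ) b b' *
      (ξ : B → ℂ) b' ∂(lebesgue φb base) :=
  D.isFlowRelation.act_eq_integral hbase (D.isTest f) ξ.2.continuous b

theorem isSmoothing_rep (f : testFunctions n ι) : IsSmoothing (lebesgue φb base) (D.rep f) :=
  ⟨fun p => kernel φb Arrow.src Arrow.rng (f : CrossedProduct n ι → ℂ) p.1 p.2,
    D.contMDiff_kernel fun b b' => D.isFlowRelation.contDiff_kernel (D.isTest f) b b',
    D.rep_apply hbase f⟩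

theorem isOperatorTrace_rep (f : testFunctions n ι) :
    IsOperatorTrace (lebesgue φb base) (D.rep f) (D.tr hbase f) := by
  have h := D.isFlowRelation
  have := h.rotation.isFiniteMeasure_lebesgue hbase
  have := h.rotation.finite_components
  obtain ⟨a, c, hs, hk⟩ := h.rotation.exists_hasSum_kernel hbase
    fun b b' => h.contDiff_kernel (D.isTest f) b b'
  obtain ⟨S, hS, htr⟩ := exists_operatorTrace (lebesgue φb base) hs hk
  refine ⟨S, fun ξ u hu => ?_, htr⟩
  refine (hS ⟨ξ, ξ.2.continuous⟩ u hu).trans (Filter.Eventually.of_forall fun b => ?_)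
  exact (D.rep_apply hbase f ξ b).symm

end IsTransverseSystem

end Assembly

end TransverseFlow

theorem proposition6p2 (n : ℕ)
    {V : Type*} [TopologicalSpace V] [T2Space V] [CompactSpace V]
    [ChartedSpace (Model n) V] [IsManifold 𝓘(ℝ, Model n) ∞ V]
    (hV : IsFoliatedAtlas n V)
    (φ : Flow ℝ V) (hφ : IsTransverseFlow n φ)
    {B : Type*} [TopologicalSpace B] [T2Space B] [CompactSpace B]
    [ChartedSpace ℝ B] [IsManifold 𝓘(ℝ, ℝ) ∞ B] [MeasurableSpace B] [BorelSpace B]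
    (ι : B → V) (hι : IsCompleteTransversal n ι)
    (φb : Flow ℝ B) (hφb : IsInducedFlow n φ ι φb)
    (base : ConnectedComponents B → B)
    (hbase : ∀ C, (base C : ConnectedComponents B) = C) :
    -- each component of `B` is a circle `ℝ/pℤ` on which the flow acts by rotation
    (∀ C : ConnectedComponents B, 0 < periodAt φb (base C)) ∧
    (∀ b : B, coordinate φb base b ∈ Ico 0 (periodAt φb (base b)) ∧
      φb (coordinate φb base b) (base b) = b ∧
      ∀ t : ℝ, φb t b = b ↔ ∃ m : ℤ, t = m * periodAt φb (base b)) ∧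
    -- the flow on `B` lifts to a flow on `H_B` by homomorphisms
    (∃ Ψ : Flow ℝ (Arrow n ι), (∀ t γ, Ψ t γ = liftedFlow φb t γ) ∧
      (∀ t γ, (Ψ t γ).src = φb t γ.src ∧ (Ψ t γ).rng = φb t γ.rng) ∧
      ∀ t γ δ ε, IsComp γ δ ε → IsComp (Ψ t γ) (Ψ t δ) (Ψ t ε)) ∧
    ∃ (mul : testFunctions n ι →ₗ[ℂ] testFunctions n ι →ₗ[ℂ] testFunctions n ι)
      (ρ : testFunctions n ι →ₗ[ℂ] Module.End ℂ (smoothFunctions B))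
      (Tr : testFunctions n ι →ₗ[ℂ] ℂ),
      -- the convolution algebra
      (∀ f g, (mul f g : CrossedProduct n ι → ℂ) = convolution φb (f : CrossedProduct n ι → ℂ) g) ∧
      (∀ f g h, mul (mul f g) h = mul f (mul g h)) ∧
      -- its representation on `C^∞(B)` by smoothing operators
      (∀ f ξ, (ρ f ξ : B → ℂ) = action φb (f : CrossedProduct n ι → ℂ) ξ) ∧
      (∀ f g, ρ (mul f g) = ρ f * ρ g) ∧
      (∀ f, IsSmoothing (lebesgue φb base) (ρ f)) ∧
      -- the operator trace
      (∀ f, IsOperatorTrace (lebesgue φb base) (ρ f) (Tr f)) ∧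
      (∀ f : testFunctions n ι,
        (∀ (C : ConnectedComponents B) (m : ℤ),
          IntegrableOn
            (fun γ : Arrow n ι => (f : CrossedProduct n ι → ℂ)
              (γ, m * periodAt φb (base C) + coordinate φb base γ.rng
                - coordinate φb base γ.src))
            (arrowsIn n ι C) (pullback (lebesgue φb base))) ∧
        HasSum
          (fun x : ConnectedComponents B × ℤ =>
            ∫ γ in arrowsIn n ι x.1, (f : CrossedProduct n ι → ℂ)
              (γ, x.2 * periodAt φb (base x.1) + coordinate φb base γ.rng
                - coordinate φb base γ.src) ∂(pullback (lebesgue φb base)))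
          (Tr f)) ∧
      -- the distribution kernel of the trace is a measure supported by the automorphisms of `G`
      (∃ ν : Measure (CrossedProduct n ι), IsLocallyFiniteMeasure ν ∧
        (∀ f : testFunctions n ι, Tr f = ∫ x, (f : CrossedProduct n ι → ℂ) x ∂ν) ∧
        ν.support = automorphisms n ι φb) ∧
      -- which form a closed submanifold: locally, a slice `U × {t}` of `H_B × ℝ`
      IsClosed (automorphisms n ι φb) ∧
      (∀ g ∈ automorphisms n ι φb, ∃ U ∈ 𝓝 g.1, ∃ J ∈ 𝓝 g.2,
        automorphisms n ι φb ∩ U ×ˢ J = U ×ˢ {g.2}) := by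
  have D : IsTransverseSystem n φ ι φb := ⟨hV, hφ, hι, hφb⟩
  have h := D.isFlowRelation
  refine ⟨fun C => h.rotation.periodAt_pos (base C), fun b => ⟨h.rotation.coordinate_mem hbase b,
    h.rotation.flow_coordinate hbase b, fun t => ?_⟩, ⟨D.arrowFlow, fun t γ => (D.liftedFlow_eq t γ).symm,
    fun t γ => ⟨h.src_flow t γ, h.rng_flow t γ⟩, fun t γ δ ε hc => ?_⟩,
    D.mul, D.rep, D.tr hbase, fun f g => rfl, fun f g k => ?_, fun f ξ => rfl, fun f g => ?_,
    D.isSmoothing_rep hbase, D.isOperatorTrace_rep hbase, fun f => h.hasSum_trace hbase (D.isTest f),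
    ⟨isotropyMeasure φb D.arrowFlow Arrow.src Arrow.rng base,
      h.isLocallyFiniteMeasure_isotropyMeasure hbase,
      fun f => h.kernelTrace_eq_integral hbase (D.isTest f), h.support_isotropyMeasure hbase⟩,
    h.isClosed_isotropy, fun g hg => h.isotropy_slice hg⟩
  · rw [h.rotation.periodAt_base hbase]
    exact h.rotation.flow_eq_self_iff b t
  · rw [D.isComp_iff] at hc ⊢
    simp only [h.src_flow, h.rng_flow, hc.1, hc.2.1, hc.2.2, and_self]
  · refine Subtype.ext (funext fun x => ?_)
    change convolution φb (convolution φb _ _) _ x = convolution φb _ (convolution φb _ _) x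
    simp only [D.convolution_eq]
    -- Associativity is the representation property for `G` acting on itself by left translation.
    exact h.act_conv (D.isTest f) (D.isTest g) h.isGroupoidAction_translate x fun γ _ =>
      h.continuous_translate (D.isTest k) γ x
  · refine LinearMap.ext fun ξ => Subtype.ext (funext fun b => ?_)
    change action φb (convolution φb _ _) _ b = action φb _ (action φb _ _) b
    rw [D.convolution_eq]
    exact h.act_conv (D.isTest f) (D.isTest g) h.isGroupoidAction_base b fun γ _ =>
      D.continuous_source ξ γ
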